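/- **Setting.** Let $S,A$ be Polish spaces, $\gamma\in(0,1)$, and let $\mathcal P(\cdot,\cdot\mid s,a)$ be a Markov kernel giving the joint law of the reward $r\in[0,1]$ and the next state $s'$. Let $\pi$ be a policy (a Markov kernel from $S$ to $A$) whose state chain has a unique stationary distribution $\mu$. Let $\phi:S\to\mathbb R^d$ be measurable with $\|\phi(s)\|\le 1$, let $\Sigma=\mathbb E_{s\sim\mu}[\phi(s)\phi(s)^\top]$, and assume that its smallest eigenvalue $\lambda_{\min}$ is positive. Let $K$ be an integer, $\iota=[K(1-\gamma)]^{-1}$ and $x_k=k\iota$ for $0\le k\le K$. For $\theta=(\theta(0),\dots,\theta(K-1))\in\mathbb R^{dK}$ let $\eta_\theta(s)=\sum_{k=0}^K (F_k(s;\theta)-F_{k-1}(s;\theta))\,\delta_{x_k}$, where $F_{-1}=0$, $F_K=1$ and $F_k(s;\theta)=\phi(s)^\top\theta(k)+\frac{k+1}{K+1}$ for $0\le k<K$. For families of signed measures on $[0,(1-\gamma)^{-1}]$ let $\ell_{2,\mu}$ and $W_{1,\mu}$ be the distances $(\mathbb E_{s\sim\mu}[\,\cdot\,]^2)^{1/2}$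 built from the $L^2$ distance $\ell_2$, respectively the $L^1$ distance $W_1$, of the CDFs $x\mapsto\nu([0,x])$ on $[0,(1-\gamma)^{-1}]$. Let $[\mathcal T\eta](s)=\mathbb E_{a\sim\pi(\cdot|s),(r,s')\sim\mathcal P(\cdot,\cdot|s,a)}[(x\mapsto r+\gamma x)_\#\eta(s')]$, and let $\theta^\star$ be the solution of the linear-categorical projected Bellman equation, i.e. $\theta^\star\in\arg\min_\theta \ell_{2,\mu}(\mathcal T\eta_{\theta^\star},\eta_\theta)$. Put $\mathcal L(\theta)=W_{1,\mu}(\eta_{\theta^\star},\eta_\theta)$. **Algorithm (Linear-CTD, generative model).** Let $(s_t,a_t,r_t,s'_t)_{t\ge1}$ be i.i.d. with $s_t\sim\mu$, $a_t\sim\pi(\cdot|s_t)$, $(r_t,s'_t)\sim\mathcal P(\cdot,\cdot|s_t,a_t)$. For a deterministic $\theta_0$ and $\alpha>0$ let $\theta_t=\theta_{t-1}-\alpha(A_t\theta_{t-1}-b_t)$, where $$A_t=I_K\otimes\phi(s_t)\phi(s_t)^\top-(C\tilde G(r_t)C^{-1})\otimes\phi(s_t)\phi(s'_t)^\top,\qquad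 b_t=\tfrac1{K+1}\Big[C\Big(\sum_{j=0}^K g_j(r_t)-\mathbf 1_K\Big)\Big]\otimes\phi(s_t).$$ Here $C\in\mathbb R^{K\times K}$ is the lower triangular all-ones matrix, $g_{j,k}(r)=(1-|(r+\gamma x_j-x_k)/\iota|)_+$, $g_j=(g_{j,k})_{k=0}^{K-1}$, and $\tilde G(r)$ has columns $g_j(r)-g_K(r)$, $0\le j\le K-1$. For even $T\ge2$ let $\bar\theta_T=(T/2+1)^{-1}\sum_{t=T/2}^T\theta_t$. **Theorem.** There are universal constants $c>0$ and $m\in\mathbb N$ such that the following holds in every such setting. Let $\varepsilon>0$, $\delta\in(0,1)$, $K\ge(1-\gamma)^{-1}$, let $T\ge2$ be even, $0<\alpha<\dfrac{1-\sqrt\gamma}{38\log(T/\delta^2)}$, and put $\ell_\delta=\max\{1,\log\frac1\delta\}$, $V_1=\dfrac{\|\theta^\star\|_{I_K\otimes\Sigma}}{\sqrt K(1-\gamma)}$ with $\|\theta\|_B=\sqrt{\theta^\top B\theta}$, $V_2=\dfrac{\|\theta_0-\theta^\star\|}{\sqrt K(1-\gamma)}$, and $$\Lambda=\log\Big(e+\tfrac1{1-\gamma}+\tfrac1{\lambda_{\min}}+\tfrac1\alpha+\tfrac1\varepsilon+K+\|\theta^\star\|_{I_K\otimes\Sigma}+\log\tfrac1\delta\Big).$$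 If $$T\ \ge\ c\,\Lambda^m\left[\frac{V_1^2+1}{\varepsilon^2(1-\gamma)^2\lambda_{\min}}\Big(1+\frac{\alpha\,\ell_\delta}{(1-\gamma)\lambda_{\min}}\Big)\ell_\delta+\frac{V_1+1}{\varepsilon\sqrt\alpha(1-\gamma)^{3/2}\lambda_{\min}}\,\ell_\delta+\frac{\log(1+V_2/\varepsilon)}{\alpha(1-\gamma)\lambda_{\min}}\right],$$ then $\mathcal L(\bar\theta_T)\le\varepsilon$ with probability at least $1-\delta$. -/

import Mathlib

open MeasureTheory ProbabilityTheory

noncomputable section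

namespace LinearCTD

/-! ### Markov decision processes, policies, stationary distributions -/

/-- A discounted MDP with state space `S` and action space `A`: `P (s, a)` is the joint law of the
reward and the next state given `(s, a)`; rewards lie in `[0, 1]` and the discount factor `γ` lies
in `(0, 1)`. -/
structure MDP (S A : Type*) [MeasurableSpace S] [MeasurableSpace A] where
  /-- joint law of (reward, next state) given (state, action) -/
  P : Kernel (S × A) (ℝ × S)
  isMarkov : IsMarkovKernel P
  /-- discount factor -/
  γ : ℝ
  γ_pos : 0 < γ
  γ_lt_one : γ < 1
  reward_mem : ∀ z : S × A, ∀ᵐ y ∂(P z), y.1 ∈ Set.Icc (0 : ℝ) 1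

attribute [instance] MDP.isMarkov

section MDP

variable {S A : Type*} [MeasurableSpace S] [MeasurableSpace A]

/-- Law of `(a, r, s')` given `s`: `a ∼ π(· | s)`, `(r, s') ∼ P(·, · | s, a)`. -/
def stepKernel (M : MDP S A) (π : Kernel S A) : Kernel S (A × (ℝ × S)) :=
  Kernel.compProd π M.P

/-- Transition kernel of the state chain `(s_t)` under the policy `π`. -/
def stateKernel (M : MDP S A) (π : Kernel S A) : Kernel S S :=
  (stepKernel M π).map (fun y => y.2.2)

/-- `μ` is the unique stationary distribution of the state chain under `π`. -/
def IsUniqueStationary (M : MDP S A) (π : Kernel S A) (μ : Measure S) : Prop :=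
  IsProbabilityMeasure μ ∧ (stateKernel M π).Invariant μ ∧
    ∀ ν : Measure S, IsProbabilityMeasure ν → (stateKernel M π).Invariant ν → ν = μ

/-- Law of one generative-model sample `(s, a, r, s')`:
`s ∼ μ`, `a ∼ π(· | s)`, `(r, s') ∼ P(·, · | s, a)`. -/
def sampleLaw (M : MDP S A) (π : Kernel S A) (μ : Measure S) : Measure (S × (A × (ℝ × S))) :=
  μ.compProd (stepKernel M π)

end MDP

/-! ### Signed measures on `[0, (1 - γ)⁻¹]` and distances between them -/

/-- `F_ν(x) = ν([0, x])`. Signed measures are used through their values on sets. -/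
def cdfAt (ν : Set ℝ → ℝ) (x : ℝ) : ℝ := ν (Set.Icc 0 x)

/-- Square of the Cramér distance: squared `L²` distance of the CDFs on `[0, (1 - γ)⁻¹]`. -/
def cramerSq (γ : ℝ) (ν₁ ν₂ : Set ℝ → ℝ) : ℝ :=
  ∫ x in (0 : ℝ)..(1 - γ)⁻¹, (cdfAt ν₁ x - cdfAt ν₂ x) ^ 2

/-- 1-Wasserstein distance: `L¹` distance of the CDFs on `[0, (1 - γ)⁻¹]`. -/
def wasserstein (γ : ℝ) (ν₁ ν₂ : Set ℝ → ℝ) : ℝ :=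
  ∫ x in (0 : ℝ)..(1 - γ)⁻¹, |cdfAt ν₁ x - cdfAt ν₂ x|

/-- `μ`-weighted Cramér distance `(E_{s ∼ μ} [ℓ₂(η₁(s), η₂(s))²])^{1/2}`. -/
def cramerDist {S : Type*} [MeasurableSpace S] (γ : ℝ) (μ : Measure S)
    (η₁ η₂ : S → Set ℝ → ℝ) : ℝ :=
  √(∫ s, cramerSq γ (η₁ s) (η₂ s) ∂μ)

/-- `μ`-weighted 1-Wasserstein distance `(E_{s ∼ μ} [W₁(η₁(s), η₂(s))²])^{1/2}`. -/
def wassersteinDist {S : Type*} [MeasurableSpace S] (γ : ℝ) (μ : Measure S)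
    (η₁ η₂ : S → Set ℝ → ℝ) : ℝ :=
  √(∫ s, wasserstein γ (η₁ s) (η₂ s) ^ 2 ∂μ)

/-- The distributional Bellman operator
`[T^π η](s) = E_{a ∼ π(·|s), (r, s') ∼ P(·,·|s,a)} [(b_{r,γ})_# η(s')]`, `b_{r,γ}(x) = r + γ x`;
the expectation of a random signed measure is taken setwise. -/
def bellman {S A : Type*} [MeasurableSpace S] [MeasurableSpace A] (M : MDP S A) (π : Kernel S A)
    (η : S → SignedMeasure ℝ) (s : S) : Set ℝ → ℝ :=
  fun B => ∫ y, (η y.2.2).map (fun x : ℝ => y.2.1 + M.γ * x) B ∂(stepKernel M π s)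

/-! ### Linear-categorical parametrization -/

/-- Spacing `ι_K = (K (1 - γ))⁻¹` of the support points. -/
def gap (γ : ℝ) (K : ℕ) : ℝ := ((K : ℝ) * (1 - γ))⁻¹

/-- Support points `x_k = k ι_K`, `0 ≤ k ≤ K`. -/
def supportPt (γ : ℝ) (K : ℕ) (k : ℕ) : ℝ := (k : ℝ) * gap γ K

/-- The parameter space `ℝ^{dK}`: `θ = (θ(0), …, θ(K-1))` with `θ(k) ∈ ℝ^d`, so that
`θ (k, i)` is the `i`-th coordinate of `θ(k)`. -/
abbrev Param (K d : ℕ) : Type := EuclideanSpace ℝ (Fin K × Fin d)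

section Parametrization

variable {S : Type*} {K d : ℕ}

/-- `F_k(s; θ) = φ(s)ᵀ θ(k) + (k + 1) / (K + 1)` for `k < K`, and `F_k(s; θ) = 1` for `k = K`. -/
def cumProb (φ : S → EuclideanSpace ℝ (Fin d)) (θ : Param K d) (s : S) (k : ℕ) : ℝ :=
  if h : k < K then (∑ i, φ s i * θ (⟨k, h⟩, i)) + ((k : ℝ) + 1) / ((K : ℝ) + 1) else 1

/-- `p_k(s; θ) = F_k(s; θ) - F_{k-1}(s; θ)`, with `F_{-1} = 0`. -/
def massProb (φ : S → EuclideanSpace ℝ (Fin d)) (θ : Param K d) (s : S) (k : ℕ) : ℝ :=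
  cumProb φ θ s k - (if k = 0 then 0 else cumProb φ θ s (k - 1))

/-- `η_θ(s) = ∑_{k=0}^{K} p_k(s; θ) δ_{x_k}`. -/
def eta (γ : ℝ) (φ : S → EuclideanSpace ℝ (Fin d)) (θ : Param K d) (s : S) : SignedMeasure ℝ :=
  ∑ k ∈ Finset.range (K + 1),
    massProb φ θ s k • (Measure.dirac (supportPt γ K k)).toSignedMeasure

variable [MeasurableSpace S]

/-- `θ` solves the linear-categorical projected Bellman equation `η_θ = Π_{φ,K}^π T^π η_θ`, where
`Π_{φ,K}^π η` is the minimizer over all `η_{θ'}` of the `μ`-weighted Cramér distance to `η`. -/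
def IsProjectedBellmanSolution {A : Type*} [MeasurableSpace A] (M : MDP S A) (π : Kernel S A)
    (μ : Measure S) (φ : S → EuclideanSpace ℝ (Fin d)) (θ : Param K d) : Prop :=
  ∀ θ' : Param K d,
    cramerDist M.γ μ (bellman M π (eta M.γ φ θ)) (fun s => eta M.γ φ θ s) ≤
      cramerDist M.γ μ (bellman M π (eta M.γ φ θ)) (fun s => eta M.γ φ θ' s)

/-- The estimation error `𝓛(θ) = W_{1,μ}(η_{θ⋆}, η_θ)`. -/
def loss (γ : ℝ) (μ : Measure S) (φ : S → EuclideanSpace ℝ (Fin d)) (θstar θ : Param K d) : ℝ :=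
  wassersteinDist γ μ (fun s => eta γ φ θstar s) (fun s => eta γ φ θ s)

/-- `Σ_φ = E_{s ∼ μ} [φ(s) φ(s)ᵀ]`. -/
def featureCov (μ : Measure S) (φ : S → EuclideanSpace ℝ (Fin d)) : Matrix (Fin d) (Fin d) ℝ :=
  Matrix.of fun i j => ∫ s, φ s i * φ s j ∂μ

/-- The smallest eigenvalue `λ_min` of `Σ_φ`. -/
def lamMin (μ : Measure S) (φ : S → EuclideanSpace ℝ (Fin d)) : ℝ :=
  sInf (spectrum ℝ (featureCov μ φ))

end Parametrization

/-! ### The Linear-CTD algorithm -/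

/-- `g_{j,k}(r) = (1 - |(r + γ x_j - x_k) / ι_K|)_+`. -/
def g (γ : ℝ) (K : ℕ) (j k : ℕ) (r : ℝ) : ℝ :=
  max (1 - |(r + γ * supportPt γ K j - supportPt γ K k) / gap γ K|) 0

/-- `g_j(r) = (g_{j,k}(r))_{k=0}^{K-1}`. -/
def gVec (γ : ℝ) (K : ℕ) (j : ℕ) (r : ℝ) : Fin K → ℝ := fun k => g γ K j k r

/-- `G̃(r) = G(r) - 1_Kᵀ ⊗ g_K(r)`, where `G(r)` has columns `g_0(r), …, g_{K-1}(r)`. -/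
def Gtilde (γ : ℝ) (K : ℕ) (r : ℝ) : Matrix (Fin K) (Fin K) ℝ :=
  Matrix.of fun k j => gVec γ K j r k - gVec γ K K r k

/-- The lower triangular all-ones matrix `C`, which maps masses to cumulative sums. -/
def Cmat (K : ℕ) : Matrix (Fin K) (Fin K) ℝ :=
  Matrix.of fun i j => if j ≤ i then 1 else 0

section Algorithm

variable {S A Ω : Type*} {d : ℕ}

/-- `A_t = I_K ⊗ (φ(s) φ(s)ᵀ) - (C G̃(r) C⁻¹) ⊗ (φ(s) φ(s')ᵀ)` for the sample `(s, a, r, s')`. -/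
def Amat (γ : ℝ) (K : ℕ) (φ : S → EuclideanSpace ℝ (Fin d)) (z : S × (A × (ℝ × S))) :
    Matrix (Fin K × Fin d) (Fin K × Fin d) ℝ :=
  Matrix.kronecker (1 : Matrix (Fin K) (Fin K) ℝ) (Matrix.vecMulVec (φ z.1) (φ z.1)) -
    Matrix.kronecker (Cmat K * Gtilde γ K z.2.2.1 * (Cmat K)⁻¹)
      (Matrix.vecMulVec (φ z.1) (φ z.2.2.2))

/-- `b_t = (K + 1)⁻¹ [C (∑_{j=0}^{K} g_j(r) - 1_K)] ⊗ φ(s)` for the sample `(s, a, r, s')`. -/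
def bVec (γ : ℝ) (K : ℕ) (φ : S → EuclideanSpace ℝ (Fin d)) (z : S × (A × (ℝ × S))) :
    Param K d :=
  WithLp.toLp 2 fun q =>
    ((K : ℝ) + 1)⁻¹ *
      (Cmat K).mulVec ((∑ j ∈ Finset.range (K + 1), gVec γ K j z.2.2.1) - 1) q.1 * φ z.1 q.2

/-- The Linear-CTD iterates `θ_t = θ_{t-1} - α (A_t θ_{t-1} - b_t)`; the sample used in iteration
`t + 1` is `X t`. -/
def ctdIterate (γ : ℝ) (K : ℕ) (φ : S → EuclideanSpace ℝ (Fin d)) (α : ℝ) (θ₀ : Param K d)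
    (X : ℕ → Ω → S × (A × (ℝ × S))) : ℕ → Ω → Param K d
  | 0, _ => θ₀
  | t + 1, ω =>
    ctdIterate γ K φ α θ₀ X t ω -
      α • (Matrix.toEuclideanLin (Amat γ K φ (X t ω)) (ctdIterate γ K φ α θ₀ X t ω) -
        bVec γ K φ (X t ω))

/-- Polyak–Ruppert tail average `θ̄_T = (T/2 + 1)⁻¹ ∑_{t=T/2}^{T} θ_t` (for even `T`). -/
def tailAverage (γ : ℝ) (K : ℕ) (φ : S → EuclideanSpace ℝ (Fin d)) (α : ℝ) (θ₀ : Param K d)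
    (X : ℕ → Ω → S × (A × (ℝ × S))) (T : ℕ) (ω : Ω) : Param K d :=
  ((T : ℝ) / 2 + 1)⁻¹ • ∑ t ∈ Finset.Icc (T / 2) T, ctdIterate γ K φ α θ₀ X t ω

end Algorithm

/-! ### Norms and the sample size bound -/

/-- `‖θ‖_{I_K ⊗ Σ} = (θᵀ (I_K ⊗ Σ) θ)^{1/2}`. -/
def normCov {K d : ℕ} (Sig : Matrix (Fin d) (Fin d) ℝ) (θ : Param K d) : ℝ :=
  √(dotProduct θ.ofLp
    ((Matrix.kronecker (1 : Matrix (Fin K) (Fin K) ℝ) Sig).mulVec θ.ofLp))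

/-- `‖θ‖_{V₁} = ‖θ‖_{I_K ⊗ Σ} / (√K (1 - γ))`. -/
def normV₁ {K d : ℕ} (γ : ℝ) (Sig : Matrix (Fin d) (Fin d) ℝ) (θ : Param K d) : ℝ :=
  normCov Sig θ / (√(K : ℝ) * (1 - γ))

/-- `‖θ‖_{V₂} = ‖θ‖ / (√K (1 - γ))`. -/
def normV₂ {K d : ℕ} (γ : ℝ) (θ : Param K d) : ℝ :=
  ‖θ‖ / (√(K : ℝ) * (1 - γ))

/-- `log(1/δ)`, replaced by `1` when `δ > e⁻¹`. -/
def logInv (δ : ℝ) : ℝ := max 1 (Real.log (1 / δ))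

/-- The leading order of the sample size. Here `v₁ = ‖θ⋆‖_{V₁}`, `v₂ = ‖θ₀ - θ⋆‖_{V₂}` and
`lam = λ_min`. -/
def sampleOrder (γ lam α ε δ v₁ v₂ : ℝ) : ℝ :=
  (v₁ ^ 2 + 1) / (ε ^ 2 * (1 - γ) ^ 2 * lam) *
      (1 + α * logInv δ / ((1 - γ) * lam)) * logInv δ +
    (v₁ + 1) / (ε * √α * (1 - γ) ^ (3 / 2 : ℝ) * lam) * logInv δ +
    Real.log (1 + v₂ / ε) / (α * (1 - γ) * lam)

/-- The logarithmic factor whose powers are hidden in `Õ`. It depends on `δ` only through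
`log (log (1/δ))`. Here `v = ‖θ⋆‖_{I_K ⊗ Σ}`. -/
def hiddenLog (γ lam α ε δ : ℝ) (K : ℕ) (v : ℝ) : ℝ :=
  Real.log (Real.exp 1 + (1 - γ)⁻¹ + lam⁻¹ + α⁻¹ + ε⁻¹ + K + v + Real.log (1 / δ))

end LinearCTD

end

/-!
The error `y_t = θ_t - θ⋆` of Linear-CTD follows a linear stochastic approximation recursion
`y_t = y_{t-1} - α (A_t y_{t-1} + e_t)` with i.i.d. `(A_t, e_t)`, and the theorem is a
high-probability bound for the tail average of such a recursion.

**The model.** In CDF coordinates the matrix `C G̃(r) C⁻¹` is nonnegative, its rows sum to at most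
`1` and its columns to at most `γ`, so by the Schur test its operator norm is at most `√γ`
(`sum_sq_cdfBackup_mulVec`). Since current and next state have the same law `μ`, the mean drift is
coercive with constant `1 - √γ` in the covariance seminorm `N(θ) = θᵀ (I_K ⊗ Σ) θ`, while
`E ‖A_t θ‖² ≤ 4 N(θ)` (`isLSAModel_ctd`). The noise `e_t = A_t θ⋆ - b_t` has mean zero, because this
is the first-order condition of the projection that defines `θ⋆`: integrating CDFs cell by cell
turns the derivative of the squared Cramér distance into `E e_t` (`integral_ctdNoise_eq_zero`).
Finally the loss is at most `√N(θ - θ⋆) / (√K (1 - γ))` by the Cauchy–Schwarz inequality (`loss_le`).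

**The recursion.** Split `y_t` into the noiseless recursion started at `θ₀ - θ⋆` and the noisy one
started at `0`. For `q` of the order of `log (T / δ²)`, the step size condition keeps the one-step
change of the `2q`-th moment under control (`norm_add_pow_le`): the moments of the noiseless part
decay geometrically, and those of the noisy part stay below `R^(2q)` up to a factor polynomial in
`T / δ`. With such a `q`, Markov's inequality and a union bound over all times lose only a constant
factor in the bound for the norm. Summing the recursion over the second half of the time horizon
expresses `E[A] ∑ y_t` through two boundary terms, of size `R / α`, and a martingale, whose `2q`-th
moments are bounded by the same one-step inequality. Coercivity turns this into a bound for `N` of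
the tail average (`IsLSAModel.measure_tailAverage`).

**The constants.** The resulting bounds contain `log T`. The assumption on `T` involves only the
explicit logarithm `Λ`, and `exists_mul_pow_le_imp_mul_log_pow_le` passes from one to the other:
either `log T` is of the order of `Λ`, or `√T` dominates both the power of `log T` and the factor
depending on the remaining parameters.
-/

namespace LinearCTD

/-! ### The categorical projection on the grid -/

/-- The piecewise linear function rising from `0` at `x = 0` to `1` at `x = 1`. A unit mass at
position `t ≥ 0` (in units of the gap), projected to the grid, has cumulative mass
`ramp (k + 1 - t)` at the `k`-th grid point. -/
noncomputable def ramp (x : ℝ) : ℝ := max 0 (min 1 x)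

lemma ramp_nonneg (x : ℝ) : 0 ≤ ramp x := le_max_left _ _

lemma ramp_le_one (x : ℝ) : ramp x ≤ 1 := max_le zero_le_one (min_le_left _ _)

lemma ramp_mono : Monotone ramp := fun _ _ h => max_le_max le_rfl (min_le_min le_rfl h)

lemma ramp_add_hat (u : ℝ) : ramp u + max (1 - |u|) 0 = ramp (u + 1) := by
  unfold ramp
  rcases le_total 0 u with h | h
  · rw [abs_of_nonneg h]
    rcases le_total u 1 with h1 | h1
    · rw [min_eq_right h1, min_eq_left (by linarith), max_eq_right h, max_eq_left (by linarith)]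
      norm_num
    · rw [min_eq_left h1, min_eq_left (by linarith), max_eq_right (by linarith : 1 - u ≤ 0)]
      norm_num
  · rw [abs_of_nonpos h, min_eq_right (by linarith), max_eq_left h, min_eq_right (by linarith)]
    rw [max_comm, zero_add]
    congr 1
    ring

/-- The hat functions centred at `0, …, k` sum to a ramp. -/
lemma sum_hat {t : ℝ} (ht : 0 ≤ t) (k : ℕ) :
    ∑ i ∈ Finset.range (k + 1), max (1 - |t - i|) 0 = ramp (k + 1 - t) := by
  induction k with
  | zero =>
    have h := ramp_add_hat (-t)
    have h0 : ramp (-t) = 0 := by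
      unfold ramp
      rw [min_eq_right (by linarith), max_eq_left (by linarith)]
    rw [h0, abs_neg, zero_add] at h
    simp only [zero_add, Finset.range_one, Finset.sum_singleton, Nat.cast_zero, sub_zero, h]
    congr 1
    ring
  | succ k ih =>
    rw [Finset.sum_range_succ, ih]
    have h := ramp_add_hat (k + 1 - t)
    rw [abs_sub_comm] at h
    push_cast
    rw [h]
    congr 1
    ring

lemma sum_ramp (t : ℝ) (K : ℕ) :
    ∑ k ∈ Finset.range K, ramp (k + 1 - t) = max 0 (min (K : ℝ) (K - t)) := by
  induction K with
  | zero => simp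
  | succ n ih =>
    rw [Finset.sum_range_succ, ih]
    unfold ramp
    have hn : (0 : ℝ) ≤ n := n.cast_nonneg
    push_cast
    simp only [max_def, min_def]
    split_ifs <;> linarith

lemma sum_ramp_sub (a : ℝ) (K : ℕ) :
    ∑ j ∈ Finset.range K, ramp (a - j) = max 0 (min (K : ℝ) a) := by
  induction K with
  | zero => simp
  | succ n ih =>
    rw [Finset.sum_range_succ, ih]
    unfold ramp
    have hn : (0 : ℝ) ≤ n := n.cast_nonneg
    push_cast
    simp only [max_def, min_def]
    split_ifs <;> linarith

/-- The position of `r + γ x_j`, in units of the gap. -/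
noncomputable def gridPos (γ : ℝ) (K : ℕ) (r : ℝ) (j : ℕ) : ℝ := r / gap γ K + γ * j

/-- The matrix `C G̃(r) C⁻¹` in closed form: the projected Bellman backup in CDF coordinates. -/
noncomputable def cdfBackup (γ : ℝ) (K : ℕ) (r : ℝ) : Matrix (Fin K) (Fin K) ℝ :=
  Matrix.of fun k j =>
    ramp ((k : ℕ) + 1 - gridPos γ K r j) - ramp ((k : ℕ) + 1 - gridPos γ K r (j + 1))

section

variable {γ : ℝ} {K : ℕ} {r : ℝ}

lemma gap_pos (hγ : γ < 1) (hK : 0 < K) : 0 < gap γ K := by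
  unfold gap
  have : (0 : ℝ) < K := by exact_mod_cast hK
  have : 0 < 1 - γ := by linarith
  positivity

lemma gridPos_nonneg (hγ0 : 0 ≤ γ) (hγ : γ < 1) (hK : 0 < K) (hr : 0 ≤ r) (j : ℕ) :
    0 ≤ gridPos γ K r j := by
  have := gap_pos hγ hK
  unfold gridPos
  positivity

lemma g_eq_hat (hγ : γ < 1) (hK : 0 < K) (j i : ℕ) :
    g γ K j i r = max (1 - |gridPos γ K r j - i|) 0 := by
  have h := (gap_pos hγ hK).ne'
  unfold g gridPos supportPt
  congr 4
  field_simp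

lemma Cmat_mulVec (v : ℕ → ℝ) (k : Fin K) :
    (Cmat K).mulVec (fun i => v i) k = ∑ i ∈ Finset.range ((k : ℕ) + 1), v i := by
  simp only [Matrix.mulVec, dotProduct, Cmat, Matrix.of_apply, ite_mul, one_mul, zero_mul]
  have h1 : ∀ i : Fin K, (if i ≤ k then v i else 0) =
      (fun i : ℕ => if i ≤ (k : ℕ) then v i else 0) i := fun i => by simp only [Fin.le_def]
  rw [Finset.sum_congr rfl fun i _ => h1 i, Fin.sum_univ_eq_sum_range
    (fun i : ℕ => if i ≤ (k : ℕ) then v i else 0) K, ← Finset.sum_filter]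
  congr 1
  ext i
  have := k.2
  simp only [Finset.mem_filter, Finset.mem_range]
  omega

/-- Cumulative sums of the projection weights are ramps. -/
lemma sum_g (hγ0 : 0 ≤ γ) (hγ : γ < 1) (hr : 0 ≤ r) (hK : 0 < K) (j k : ℕ) :
    ∑ i ∈ Finset.range (k + 1), g γ K j i r = ramp (k + 1 - gridPos γ K r j) := by
  rw [Finset.sum_congr rfl fun i _ => g_eq_hat hγ hK j i]
  exact sum_hat (gridPos_nonneg hγ0 hγ hK hr j) k

lemma isUnit_det_Cmat : IsUnit (Cmat K).det := by
  have : (Cmat K).det = 1 := by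
    rw [Matrix.det_of_isLowerTriangular]
    · simp [Cmat]
    · intro i j hij
      have : ¬ j ≤ i := by simpa using hij
      simp [Cmat, this]
  rw [this]
  exact isUnit_one

lemma cdfBackup_eq (hγ0 : 0 ≤ γ) (hγ : γ < 1) (hr : 0 ≤ r) :
    Cmat K * Gtilde γ K r * (Cmat K)⁻¹ = cdfBackup γ K r := by
  have h : Cmat K * Gtilde γ K r = cdfBackup γ K r * Cmat K := by
    ext k j
    have hK : 0 < K := k.pos
    have h1 : (Cmat K * Gtilde γ K r) k j =
        ramp ((k : ℕ) + 1 - gridPos γ K r j) - ramp ((k : ℕ) + 1 - gridPos γ K r K) := by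
      have := Cmat_mulVec (K := K) (fun i => g γ K j i r - g γ K K i r) k
      rw [Finset.sum_sub_distrib, sum_g hγ0 hγ hr hK, sum_g hγ0 hγ hr hK] at this
      rw [← this]
      rfl
    have h2 : (cdfBackup γ K r * Cmat K) k j =
        ∑ i ∈ Finset.Ico (j : ℕ) K, (ramp ((k : ℕ) + 1 - gridPos γ K r i) -
          ramp ((k : ℕ) + 1 - gridPos γ K r (i + 1))) := by
      simp only [Matrix.mul_apply, Cmat, cdfBackup, Matrix.of_apply, mul_ite, mul_one, mul_zero]
      have h3 : ∀ i : Fin K, (if j ≤ i then ramp ((k : ℕ) + 1 - gridPos γ K r i) -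
          ramp ((k : ℕ) + 1 - gridPos γ K r (i + 1)) else 0) =
          (fun i : ℕ => if (j : ℕ) ≤ i then ramp ((k : ℕ) + 1 - gridPos γ K r i) -
          ramp ((k : ℕ) + 1 - gridPos γ K r (i + 1)) else 0) i := fun i => by
        simp only [Fin.le_def]
      rw [Finset.sum_congr rfl fun i _ => h3 i, Fin.sum_univ_eq_sum_range
        (fun i : ℕ => if (j : ℕ) ≤ i then ramp ((k : ℕ) + 1 - gridPos γ K r i) -
          ramp ((k : ℕ) + 1 - gridPos γ K r (i + 1)) else 0) K, ← Finset.sum_filter]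
      congr 1
      ext i
      simp only [Finset.mem_filter, Finset.mem_range, Finset.mem_Ico]
      omega
    rw [h1, h2, Finset.sum_Ico_eq_sum_range]
    have := Finset.sum_range_sub' (fun i => ramp ((k : ℕ) + 1 - gridPos γ K r (j + i))) (K - j)
    rw [Nat.add_sub_cancel' j.2.le, add_zero] at this
    rw [← this]
    rfl
  rw [h, Matrix.mul_nonsing_inv_cancel_right _ _ isUnit_det_Cmat]

lemma gridPos_mono (hγ0 : 0 ≤ γ) : Monotone (gridPos γ K r) := by
  intro i j hij
  have : (i : ℝ) ≤ j := by exact_mod_cast hij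
  unfold gridPos
  gcongr

lemma cdfBackup_nonneg (hγ0 : 0 ≤ γ) (k j : Fin K) : 0 ≤ cdfBackup γ K r k j := by
  simp only [cdfBackup, Matrix.of_apply, sub_nonneg]
  exact ramp_mono (by linarith [gridPos_mono (K := K) (r := r) hγ0 (Nat.le_succ (j : ℕ))])

lemma cdfBackup_row_sum (k : Fin K) : ∑ j, cdfBackup γ K r k j ≤ 1 := by
  simp only [cdfBackup, Matrix.of_apply]
  rw [Fin.sum_univ_eq_sum_range (fun j : ℕ => ramp ((k : ℕ) + 1 - gridPos γ K r j) -
    ramp ((k : ℕ) + 1 - gridPos γ K r (j + 1))), Finset.sum_range_sub'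
    (fun j : ℕ => ramp ((k : ℕ) + 1 - gridPos γ K r j))]
  linarith [ramp_le_one ((k : ℕ) + 1 - gridPos γ K r 0),
    ramp_nonneg ((k : ℕ) + 1 - gridPos γ K r K)]

lemma cdfBackup_col_sum (hγ0 : 0 ≤ γ) (j : Fin K) : ∑ k, cdfBackup γ K r k j ≤ γ := by
  simp only [cdfBackup, Matrix.of_apply]
  rw [Fin.sum_univ_eq_sum_range (fun k : ℕ => ramp (k + 1 - gridPos γ K r j) -
    ramp (k + 1 - gridPos γ K r (j + 1))), Finset.sum_sub_distrib, sum_ramp, sum_ramp]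
  have h : gridPos γ K r (j + 1) = gridPos γ K r j + γ := by
    unfold gridPos
    push_cast
    ring
  rw [h]
  simp only [max_def, min_def]
  split_ifs <;> linarith

/-- The Schur test: the rows of `C G̃(r) C⁻¹` sum to at most `1` and its columns to at most `γ`,
so its operator norm is at most `√γ`. -/
lemma sum_sq_cdfBackup_mulVec (hγ0 : 0 ≤ γ) (u : Fin K → ℝ) :
    ∑ k, ((cdfBackup γ K r).mulVec u k) ^ 2 ≤ γ * ∑ j, u j ^ 2 := by
  calc ∑ k, ((cdfBackup γ K r).mulVec u k) ^ 2
      ≤ ∑ k, ∑ j, cdfBackup γ K r k j * u j ^ 2 := by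
        refine Finset.sum_le_sum fun k _ => ?_
        have h := Finset.sum_sq_le_sum_mul_sum_of_sq_le_mul Finset.univ
          (r := fun j => cdfBackup γ K r k j * u j) (f := fun j => cdfBackup γ K r k j)
          (g := fun j => cdfBackup γ K r k j * u j ^ 2)
          (fun j _ => cdfBackup_nonneg hγ0 k j)
          (fun j _ => mul_nonneg (cdfBackup_nonneg hγ0 k j) (sq_nonneg _)) (fun j _ => by nlinarith)
        refine h.trans ?_
        have h0 : 0 ≤ ∑ j, cdfBackup γ K r k j * u j ^ 2 := Finset.sum_nonneg fun j _ =>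
          mul_nonneg (cdfBackup_nonneg hγ0 k j) (sq_nonneg _)
        nlinarith [cdfBackup_row_sum (γ := γ) (r := r) k]
    _ = ∑ j, (∑ k, cdfBackup γ K r k j) * u j ^ 2 := by
        rw [Finset.sum_comm]
        simp only [Finset.sum_mul]
    _ ≤ ∑ j, γ * u j ^ 2 := Finset.sum_le_sum fun j _ =>
        mul_le_mul_of_nonneg_right (cdfBackup_col_sum hγ0 j) (sq_nonneg _)
    _ = γ * ∑ j, u j ^ 2 := by rw [Finset.mul_sum]

lemma Cmat_mulVec_sum_gVec_sub_one (hγ0 : 0 ≤ γ) (hγ : γ < 1) (hr : 0 ≤ r) (k : Fin K) :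
    (Cmat K).mulVec ((∑ j ∈ Finset.range (K + 1), gVec γ K j r) - 1) k =
      ∑ j ∈ Finset.range (K + 1), ramp ((k : ℕ) + 1 - gridPos γ K r j) - ((k : ℕ) + 1) := by
  have hK : 0 < K := k.pos
  have := Cmat_mulVec (K := K) (fun i => ∑ j ∈ Finset.range (K + 1), g γ K j i r - 1) k
  rw [Finset.sum_sub_distrib, Finset.sum_comm,
    Finset.sum_congr rfl fun j _ => sum_g hγ0 hγ hr hK j k] at this
  simp only [Finset.sum_const, Finset.card_range, nsmul_eq_mul, mul_one] at this
  push_cast at this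
  rw [← this]
  congr 1
  ext i
  simp [gVec]

/-- The shift `(1 - γ) j - r / ι` of every support point is at most `K (1 - γ)` in absolute value,
and shifting all of them by the same amount changes the cumulative sums by that amount. -/
lemma abs_Cmat_mulVec_sum_gVec_sub_one_le (hγ0 : 0 ≤ γ) (hγ : γ < 1) (hr : 0 ≤ r) (hr1 : r ≤ 1)
    (k : Fin K) :
    |(Cmat K).mulVec ((∑ j ∈ Finset.range (K + 1), gVec γ K j r) - 1) k| ≤ K * (1 - γ) := by
  have hK : 0 < K := k.pos
  have hKr : (0 : ℝ) < K := by exact_mod_cast hK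
  have hkK : ((k : ℕ) : ℝ) + 1 ≤ K := by exact_mod_cast k.2
  have hk0 : (0 : ℝ) ≤ (k : ℕ) := Nat.cast_nonneg _
  have hsum := Cmat_mulVec_sum_gVec_sub_one hγ0 hγ hr k
  have hρ : r / gap γ K = r * (K * (1 - γ)) := by
    unfold gap
    rw [div_inv_eq_mul]
  have hs : 0 ≤ K * (1 - γ) := mul_nonneg hKr.le (by linarith)
  have hρ0 : 0 ≤ r / gap γ K := by rw [hρ]; positivity
  have hρ1 : r / gap γ K ≤ K * (1 - γ) := by rw [hρ]; nlinarith
  have hup : ∑ j ∈ Finset.range (K + 1), ramp ((k : ℕ) + 1 - gridPos γ K r j) ≤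
      ∑ j ∈ Finset.range (K + 1), ramp (((k : ℕ) + 1 + K * (1 - γ)) - j) := by
    refine Finset.sum_le_sum fun j hj => ramp_mono ?_
    have hj' : (j : ℝ) ≤ K := by
      have := Finset.mem_range.mp hj
      exact_mod_cast Nat.lt_succ_iff.mp this
    unfold gridPos
    nlinarith
  have hlow : ∑ j ∈ Finset.range (K + 1), ramp (((k : ℕ) + 1 - K * (1 - γ)) - j) ≤
      ∑ j ∈ Finset.range (K + 1), ramp ((k : ℕ) + 1 - gridPos γ K r j) := by
    refine Finset.sum_le_sum fun j _ => ramp_mono ?_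
    have hj' : (0 : ℝ) ≤ j := j.cast_nonneg
    unfold gridPos
    nlinarith
  rw [sum_ramp_sub] at hup hlow
  push_cast at hup hlow
  rw [hsum, abs_le]
  constructor
  · refine le_trans ?_ (sub_le_sub_right hlow _)
    rw [min_eq_right (by linarith)]
    linarith [le_max_right 0 ((k : ℕ) + 1 - K * (1 - γ))]
  · refine le_trans (sub_le_sub_right hup _) ?_
    rw [max_eq_right (le_min (by linarith) (by linarith))]
    linarith [min_le_right ((K : ℝ) + 1) ((k : ℕ) + 1 + K * (1 - γ))]

end

/-! ### One-step moment inequalities in a Hilbert space -/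

section MomentInequalities

/-- Second-order Taylor bound for `x ↦ x ^ q` between two nonnegative points. -/
lemma pow_le_taylor_two {a b m : ℝ} (ha : 0 ≤ a) (hb : 0 ≤ b) (ham : a ≤ m) (hbm : b ≤ m)
    (q : ℕ) :
    b ^ (q + 2) ≤ a ^ (q + 2) + (q + 2) * a ^ (q + 1) * (b - a) +
      (q + 2) * (q + 1) / 2 * (b - a) ^ 2 * m ^ q := by
  have hm : 0 ≤ m := ha.trans ham
  induction q with
  | zero => norm_num; nlinarith
  | succ n ih =>
    have h1 : b ^ (n + 1 + 2) ≤ b * (a ^ (n + 2) + (n + 2) * a ^ (n + 1) * (b - a) +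
      (n + 2) * (n + 1) / 2 * (b - a) ^ 2 * m ^ n) := by
      have := mul_le_mul_of_nonneg_left ih hb
      calc b ^ (n + 1 + 2) = b * b ^ (n + 2) := by ring
        _ ≤ _ := this
    have h2 : a ^ (n + 1) ≤ m ^ (n + 1) := pow_le_pow_left₀ ha ham _
    have h3 : b * m ^ n ≤ m ^ (n + 1) := by
      rw [pow_succ']
      exact mul_le_mul_of_nonneg_right hbm (pow_nonneg hm _)
    have hn : (0 : ℝ) ≤ n := n.cast_nonneg
    have h4 : (n + 2 : ℝ) * (b - a) ^ 2 * a ^ (n + 1) ≤ (n + 2 : ℝ) * (b - a) ^ 2 * m ^ (n + 1) :=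
      mul_le_mul_of_nonneg_left h2 (by positivity)
    have h5 : (n + 2 : ℝ) * (n + 1) / 2 * (b - a) ^ 2 * (b * m ^ n) ≤
        (n + 2 : ℝ) * (n + 1) / 2 * (b - a) ^ 2 * m ^ (n + 1) :=
      mul_le_mul_of_nonneg_left h3 (by positivity)
    push_cast
    refine h1.trans ?_
    ring_nf at h4 h5 ⊢
    linarith

lemma one_add_inv_pow_le (q : ℕ) : (1 + (q : ℝ)⁻¹) ^ (2 * q) ≤ Real.exp 2 := by
  rcases Nat.eq_zero_or_pos q with h | h
  · subst h
    simp
  · have hq : (0 : ℝ) < q := by exact_mod_cast h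
    calc (1 + (q : ℝ)⁻¹) ^ (2 * q) ≤ (Real.exp (q : ℝ)⁻¹) ^ (2 * q) := by
          refine pow_le_pow_left₀ (by positivity) ?_ _
          linarith [Real.add_one_le_exp (q : ℝ)⁻¹]
      _ = Real.exp 2 := by
          rw [← Real.exp_nat_mul]
          congr 1
          push_cast
          field_simp

variable {H : Type*} [NormedAddCommGroup H] [InnerProductSpace ℝ H]

/-- An even moment after a small increment: the first-order term is the change of `‖x‖²`, and the
second-order term is controlled as long as the increment is at most `‖x‖ / q`. -/
lemma norm_add_pow_le {x w : H} {q : ℕ} (hq : 1 ≤ q) (h : q * ‖w‖ ≤ ‖x‖) :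
    ‖x + w‖ ^ (2 * q) ≤ ‖x‖ ^ (2 * q) +
      q * ‖x‖ ^ (2 * (q - 1)) * (2 * inner ℝ x w + (1 + 34 * (q - 1)) * ‖w‖ ^ 2) := by
  have hexp : ‖x + w‖ ^ 2 = ‖x‖ ^ 2 + (2 * inner ℝ x w + ‖w‖ ^ 2) := by
    rw [norm_add_sq_real]
    ring
  obtain ⟨p, rfl⟩ : ∃ p, q = p + 1 := ⟨q - 1, by omega⟩
  rcases p with _ | p
  · simp only [zero_add, mul_one, hexp]
    norm_num
  · set y := ‖x‖ with hy
    set u := ‖w‖ with hu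
    have hy0 : 0 ≤ y := norm_nonneg _
    have hu0 : 0 ≤ u := norm_nonneg _
    set ξ := 2 * inner ℝ x w + u ^ 2 with hξ
    have hp : (0 : ℝ) ≤ p := p.cast_nonneg
    have hqu : ((p : ℝ) + 1 + 1) * u ≤ y := by
      have := h
      push_cast at this
      exact this
    have huy : u ≤ y := by nlinarith
    have hinner : |inner ℝ x w| ≤ y * u := abs_real_inner_le_norm x w
    have hξ2 : ξ ^ 2 ≤ 9 * (y ^ 2 * u ^ 2) := by
      have h1 : |ξ| ≤ 3 * (y * u) := by
        rw [hξ]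
        refine (abs_add_le _ _).trans ?_
        rw [abs_mul, abs_of_nonneg (sq_nonneg u)]
        norm_num
        nlinarith
      calc ξ ^ 2 = |ξ| ^ 2 := (sq_abs _).symm
        _ ≤ (3 * (y * u)) ^ 2 := pow_le_pow_left₀ (abs_nonneg _) h1 2
        _ = _ := by ring
    set m := (y * (1 + ((p + 1 + 1 : ℕ) : ℝ)⁻¹)) ^ 2 with hm
    have hinv : 0 ≤ ((p + 1 + 1 : ℕ) : ℝ)⁻¹ := by positivity
    have hu' : u ≤ y * ((p + 1 + 1 : ℕ) : ℝ)⁻¹ := by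
      rw [← div_eq_mul_inv, le_div_iff₀ (by positivity)]
      push_cast
      linarith
    have ham : y ^ 2 ≤ m := by
      refine pow_le_pow_left₀ hy0 ?_ 2
      nlinarith
    have hbm : ‖x + w‖ ^ 2 ≤ m := by
      refine pow_le_pow_left₀ (norm_nonneg _) ((norm_add_le _ _).trans ?_) 2
      rw [mul_add, mul_one]
      linarith
    have hmp : m ^ p ≤ 7.5 * y ^ (2 * p) := by
      rw [hm, ← pow_mul, mul_pow, mul_comm]
      refine mul_le_mul_of_nonneg_right ?_ (by positivity)
      calc (1 + ((p + 1 + 1 : ℕ) : ℝ)⁻¹) ^ (2 * p)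
          ≤ (1 + ((p + 1 + 1 : ℕ) : ℝ)⁻¹) ^ (2 * (p + 1 + 1)) :=
            pow_le_pow_right₀ (by linarith) (by omega)
        _ ≤ Real.exp 2 := one_add_inv_pow_le _
        _ = Real.exp 1 ^ 2 := by rw [← Real.exp_nat_mul]; norm_num
        _ ≤ 7.5 := by nlinarith [Real.exp_one_lt_d9, Real.exp_pos 1]
    have key := pow_le_taylor_two (sq_nonneg y) (sq_nonneg ‖x + w‖) ham hbm p
    have hba : ‖x + w‖ ^ 2 - y ^ 2 = ξ := by rw [hexp]; ring
    rw [hba] at key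
    have h3 : ((p : ℝ) + 2) * (p + 1) / 2 * ξ ^ 2 * m ^ p ≤
        (p + 2) * (p + 1) / 2 * (9 * (y ^ 2 * u ^ 2)) * (7.5 * y ^ (2 * p)) := by
      refine mul_le_mul ?_ hmp (by positivity) (by positivity)
      exact mul_le_mul_of_nonneg_left hξ2 (by positivity)
    have h4 : 0 ≤ ((p : ℝ) + 2) * (p + 1) * (u ^ 2 * y ^ (2 * (p + 1))) := by positivity
    rw [pow_mul]
    refine key.trans ?_
    simp only [← pow_mul]
    push_cast
    have e2 : 2 * (p + 2) = 2 * (p + 1 + 1) := by ring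
    rw [e2]
    have e3 : y ^ (2 * (p + 1)) = y ^ (2 * p) * y ^ 2 := by ring
    rw [e3] at h4 ⊢
    have e4 : (2 * inner ℝ x w + (1 + 34 * ((p : ℝ) + 1 + 1 - 1)) * u ^ 2) =
      ξ + 34 * (p + 1) * u ^ 2 := by rw [hξ]; ring
    rw [e4]
    nlinarith

lemma norm_add_pow_le_of_le {H : Type*} [NormedAddCommGroup H] {x w : H} {q : ℕ}
    (hq : 1 ≤ q) {R : ℝ} (hx : ‖x‖ ≤ R) (h : q * ‖w‖ ≤ R) : ‖x + w‖ ^ (2 * q) ≤ Real.exp 2 * R ^ (2 * q) := by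
  have hq0 : (0 : ℝ) < q := by exact_mod_cast hq
  have hR : 0 ≤ R := (norm_nonneg _).trans hx
  have hw : ‖w‖ ≤ R * (q : ℝ)⁻¹ := by
    rw [← div_eq_mul_inv, le_div_iff₀ hq0]
    linarith
  calc ‖x + w‖ ^ (2 * q) ≤ ((1 + (q : ℝ)⁻¹) * R) ^ (2 * q) := by
        refine pow_le_pow_left₀ (norm_nonneg _) ((norm_add_le _ _).trans ?_) _
        linarith
    _ = (1 + (q : ℝ)⁻¹) ^ (2 * q) * R ^ (2 * q) := mul_pow _ _ _
    _ ≤ _ := mul_le_mul_of_nonneg_right (one_add_inv_pow_le q) (by positivity)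

variable {Z : Type*} [MeasurableSpace Z] {ν : Measure Z} [IsProbabilityMeasure ν]

lemma lintegral_ofReal_le_of_ae_le {f : Z → ℝ} {c : ℝ} (h : ∀ᵐ z ∂ν, f z ≤ c) :
    ∫⁻ z, ENNReal.ofReal (f z) ∂ν ≤ ENNReal.ofReal c := by
  calc ∫⁻ z, ENNReal.ofReal (f z) ∂ν ≤ ∫⁻ _, ENNReal.ofReal c ∂ν :=
        lintegral_mono_ae (h.mono fun z hz => ENNReal.ofReal_le_ofReal hz)
    _ = ENNReal.ofReal c := by simp

/-- Moment growth over one step from a point outside the ball of radius `q b`. -/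
lemma lintegral_norm_add_pow_le [MeasurableSpace H] [BorelSpace H] [FiniteDimensional ℝ H]
    {x : H} {w : Z → H} (hw : Measurable w) {q : ℕ} (hq : 1 ≤ q) {b c : ℝ}
    (hb : ∀ᵐ z ∂ν, ‖w z‖ ≤ b) (hx : q * b ≤ ‖x‖)
    (hc : 2 * ∫ z, inner ℝ x (w z) ∂ν + (1 + 34 * (q - 1)) * ∫ z, ‖w z‖ ^ 2 ∂ν ≤ c * ‖x‖ ^ 2) :
    ∫⁻ z, ENNReal.ofReal (‖x + w z‖ ^ (2 * q)) ∂ν ≤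
      ENNReal.ofReal ((1 + q * c) * ‖x‖ ^ (2 * q)) := by
  have hq0 : (0 : ℝ) < q := by exact_mod_cast hq
  have hq1 : (1 : ℝ) ≤ q := by exact_mod_cast hq
  have hb' : ∀ᵐ z ∂ν, ‖w z‖ ^ 2 ≤ b ^ 2 :=
    hb.mono fun z hz => pow_le_pow_left₀ (norm_nonneg _) hz 2
  have hmeas : Measurable fun z => ‖w z‖ ^ 2 := by fun_prop
  have hint : Integrable (fun z => ‖w z‖ ^ 2) ν := by
    refine Integrable.of_bound hmeas.aestronglyMeasurable (b ^ 2) ?_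
    filter_upwards [hb'] with z hz
    rwa [Real.norm_of_nonneg (sq_nonneg _)]
  have hmeasi : Measurable fun z => inner ℝ x (w z) := by fun_prop
  have hinti : Integrable (fun z => inner ℝ x (w z)) ν := by
    refine Integrable.of_bound hmeasi.aestronglyMeasurable (‖x‖ * b) ?_
    filter_upwards [hb] with z hz
    exact (abs_real_inner_le_norm _ _).trans (mul_le_mul_of_nonneg_left hz (norm_nonneg _))
  set F : Z → ℝ := fun z => ‖x‖ ^ (2 * q) +
      q * ‖x‖ ^ (2 * (q - 1)) * (2 * inner ℝ x (w z) + (1 + 34 * (q - 1)) * ‖w z‖ ^ 2) with hF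
  have hle : ∀ᵐ z ∂ν, ‖x + w z‖ ^ (2 * q) ≤ F z := by
    filter_upwards [hb] with z hz
    exact norm_add_pow_le hq ((mul_le_mul_of_nonneg_left hz hq0.le).trans hx)
  have hadd : Integrable
      (fun z => 2 * inner ℝ x (w z) + (1 + 34 * ((q : ℝ) - 1)) * ‖w z‖ ^ 2) ν :=
    (hinti.const_mul 2).add (hint.const_mul _)
  have hFi : Integrable F ν := (integrable_const _).add (hadd.const_mul _)
  calc ∫⁻ z, ENNReal.ofReal (‖x + w z‖ ^ (2 * q)) ∂ν
      ≤ ∫⁻ z, ENNReal.ofReal (F z) ∂ν :=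
        lintegral_mono_ae (hle.mono fun z hz => ENNReal.ofReal_le_ofReal hz)
    _ = ENNReal.ofReal (∫ z, F z ∂ν) := by
        rw [ofReal_integral_eq_lintegral_ofReal hFi]
        filter_upwards [hle] with z hz
        exact le_trans (by positivity) hz
    _ ≤ _ := by
        refine ENNReal.ofReal_le_ofReal ?_
        have hval : ∫ z, F z ∂ν = ‖x‖ ^ (2 * q) + q * ‖x‖ ^ (2 * (q - 1)) *
            (2 * ∫ z, inner ℝ x (w z) ∂ν + (1 + 34 * (q - 1)) * ∫ z, ‖w z‖ ^ 2 ∂ν) := by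
          rw [hF, integral_add (integrable_const _) (hadd.const_mul _), integral_const_mul,
            integral_add (hinti.const_mul 2) (hint.const_mul _), integral_const_mul,
            integral_const_mul]
          simp
        rw [hval]
        have e : ‖x‖ ^ (2 * q) = ‖x‖ ^ (2 * (q - 1)) * ‖x‖ ^ 2 := by
          rw [← pow_add]
          congr 1
          omega
        have := mul_le_mul_of_nonneg_left hc
          (by positivity : 0 ≤ (q : ℝ) * ‖x‖ ^ (2 * (q - 1)))
        rw [e]
        linarith

end MomentInequalities

/-! ### Moments along a random recursion -/

/-- The recursion `x_{t+1} = F (x_t, X_t)` started at `x₀`. -/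
def chain {E Z Ω : Type*} (F : E → Z → E) (x₀ : E) (X : ℕ → Ω → Z) : ℕ → Ω → E
  | 0, _ => x₀
  | t + 1, ω => F (chain F x₀ X t ω) (X t ω)

section Chain

variable {E Z Ω : Type*} [MeasurableSpace E] [mZ : MeasurableSpace Z]
  {X : ℕ → Ω → Z} {F : E → Z → E} {x₀ : E}

lemma measurable_chain_past (hF : Measurable (Function.uncurry F)) (t : ℕ) :
    Measurable[⨆ i ∈ Set.Iio t, mZ.comap (X i)] (chain F x₀ X t) := by
  induction t with
  | zero => exact measurable_const
  | succ t ih =>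
    have h1 : Measurable[⨆ i ∈ Set.Iio (t + 1), mZ.comap (X i)] (chain F x₀ X t) :=
      ih.mono (biSup_mono fun i hi => Set.mem_Iio.mpr
        ((Set.mem_Iio.mp hi).trans (Nat.lt_succ_self t))) le_rfl
    have h2 : Measurable[⨆ i ∈ Set.Iio (t + 1), mZ.comap (X i)] (X t) :=
      Measurable.mono (comap_measurable (X t))
        (le_biSup (fun i => mZ.comap (X i)) (Set.mem_Iio.mpr (Nat.lt_succ_self t))) le_rfl
    exact hF.comp (h1.prodMk h2)

variable [mΩ : MeasurableSpace Ω] {Pr : Measure Ω}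

lemma measurable_chain (hF : Measurable (Function.uncurry F)) (hX : ∀ t, Measurable (X t))
    (t : ℕ) : Measurable (chain F x₀ X t) :=
  (measurable_chain_past hF t).mono (iSup₂_le fun i _ => (hX i).comap_le) le_rfl

lemma indepFun_chain (hF : Measurable (Function.uncurry F)) (hX : ∀ t, Measurable (X t))
    (hind : iIndepFun X Pr) (t : ℕ) : IndepFun (chain F x₀ X t) (X t) Pr := by
  have h := indep_iSup_of_disjoint (fun i => (hX i).comap_le) hind
    (S := Set.Iio t) (T := {t}) (by simp)
  rw [IndepFun_iff_Indep]
  refine indep_of_indep_of_le_left (indep_of_indep_of_le_right h ?_)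
    (measurable_chain_past hF t).comap_le
  exact le_biSup (fun i => mZ.comap (X i)) (Set.mem_singleton t)

variable [IsProbabilityMeasure Pr] {ν : Measure Z} [IsProbabilityMeasure ν]

/-- A one-step bound on the potential `V` valid from every state passes to expectations, since the
current state is independent of the next sample. -/
lemma lintegral_chain_succ_le (hF : Measurable (Function.uncurry F))
    (hX : ∀ t, Measurable (X t)) (hind : iIndepFun X Pr) (hlaw : ∀ t, Pr.map (X t) = ν)
    {V : E → ENNReal} (hV : Measurable V) {a D : ENNReal}
    (hstep : ∀ x, ∫⁻ z, V (F x z) ∂ν ≤ a * V x + D) (t : ℕ) :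
    ∫⁻ ω, V (chain F x₀ X (t + 1) ω) ∂Pr ≤ a * ∫⁻ ω, V (chain F x₀ X t ω) ∂Pr + D := by
  have hm := measurable_chain (x₀ := x₀) hF hX t
  have hprod := (indepFun_iff_map_prod_eq_prod_map_map hm.aemeasurable (hX t).aemeasurable).mp
    (indepFun_chain (x₀ := x₀) hF hX hind t)
  have hmap : IsProbabilityMeasure (Pr.map (chain F x₀ X t)) :=
    Measure.isProbabilityMeasure_map hm.aemeasurable
  have hVF : Measurable fun p : E × Z => V (F p.1 p.2) := hV.comp hF
  calc ∫⁻ ω, V (chain F x₀ X (t + 1) ω) ∂Pr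
      = ∫⁻ p, V (F p.1 p.2) ∂(Pr.map fun ω => (chain F x₀ X t ω, X t ω)) := by
        rw [lintegral_map hVF (hm.prodMk (hX t))]
        rfl
    _ = ∫⁻ x, ∫⁻ z, V (F x z) ∂ν ∂(Pr.map (chain F x₀ X t)) := by
        rw [hprod, hlaw t, lintegral_prod _ hVF.aemeasurable]
    _ ≤ ∫⁻ x, (a * V x + D) ∂(Pr.map (chain F x₀ X t)) := lintegral_mono hstep
    _ = a * ∫⁻ ω, V (chain F x₀ X t ω) ∂Pr + D := by
        rw [lintegral_add_right _ measurable_const, lintegral_const_mul _ hV, lintegral_map hV hm]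
        simp

lemma lintegral_chain_le_pow (hF : Measurable (Function.uncurry F))
    (hX : ∀ t, Measurable (X t)) (hind : iIndepFun X Pr) (hlaw : ∀ t, Pr.map (X t) = ν)
    {V : E → ENNReal} (hV : Measurable V) {a : ENNReal}
    (hstep : ∀ x, ∫⁻ z, V (F x z) ∂ν ≤ a * V x) (t : ℕ) :
    ∫⁻ ω, V (chain F x₀ X t ω) ∂Pr ≤ a ^ t * V x₀ := by
  induction t with
  | zero => simp [chain]
  | succ t ih =>
    have h := lintegral_chain_succ_le (x₀ := x₀) hF hX hind hlaw hV (a := a) (D := 0)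
      (fun x => by simpa using hstep x) t
    rw [add_zero] at h
    refine h.trans ((mul_le_mul_right ih a).trans ?_)
    rw [pow_succ', mul_assoc]

lemma lintegral_chain_le_mul (hF : Measurable (Function.uncurry F))
    (hX : ∀ t, Measurable (X t)) (hind : iIndepFun X Pr) (hlaw : ∀ t, Pr.map (X t) = ν)
    {V : E → ENNReal} (hV : Measurable V) {a D : ENNReal} (ha : 1 ≤ a)
    (hstep : ∀ x, ∫⁻ z, V (F x z) ∂ν ≤ a * V x + D) (h0 : V x₀ = 0) (t : ℕ) :
    ∫⁻ ω, V (chain F x₀ X t ω) ∂Pr ≤ a ^ t * (t * D) := by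
  induction t with
  | zero => simp [chain, h0]
  | succ t ih =>
    refine (lintegral_chain_succ_le hF hX hind hlaw hV hstep t).trans ?_
    have h1 : (1 : ENNReal) ≤ a ^ (t + 1) := one_le_pow₀ ha
    calc a * ∫⁻ ω, V (chain F x₀ X t ω) ∂Pr + D
        ≤ a * (a ^ t * (t * D)) + a ^ (t + 1) * D := by
          gcongr
          calc D = 1 * D := (one_mul D).symm
            _ ≤ _ := by gcongr
      _ = a ^ (t + 1) * ((t + 1 : ℕ) * D) := by
          push_cast
          ring

end Chain

/-- Markov's inequality for an even moment. -/
lemma measure_lt_norm_le {H Ω : Type*} [NormedAddCommGroup H] [MeasurableSpace H] [BorelSpace H]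
    [MeasurableSpace Ω] {Pr : Measure Ω} {Y : Ω → H} (hY : Measurable Y) {q : ℕ} (hq : 1 ≤ q)
    {M R p : ℝ} (hM : 0 < M) (hR : 0 ≤ R)
    (h : ∫⁻ ω, ENNReal.ofReal (‖Y ω‖ ^ (2 * q)) ∂Pr ≤ ENNReal.ofReal (p * R ^ (2 * q))) :
    Pr {ω | M * R < ‖Y ω‖} ≤ ENNReal.ofReal (p / M ^ (2 * q)) := by
  have hq2 : 2 * q ≠ 0 := by omega
  rcases hR.eq_or_lt with hR | hR
  · rw [← hR, zero_pow hq2, mul_zero, ENNReal.ofReal_zero, nonpos_iff_eq_zero,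
      lintegral_eq_zero_iff (by fun_prop)] at h
    have h0 : Pr {ω | M * R < ‖Y ω‖} = 0 := by
      rw [← hR, mul_zero]
      refine measure_mono_null (fun ω hω => ?_) h
      have : 0 < ‖Y ω‖ ^ (2 * q) := pow_pos hω _
      change ¬ENNReal.ofReal (‖Y ω‖ ^ (2 * q)) = 0
      rw [ENNReal.ofReal_eq_zero]
      exact not_le.mpr this
    simp [h0]
  have hc : 0 < (M * R) ^ (2 * q) := by positivity
  calc Pr {ω | M * R < ‖Y ω‖}
      ≤ Pr {ω | ENNReal.ofReal ((M * R) ^ (2 * q)) ≤ ENNReal.ofReal (‖Y ω‖ ^ (2 * q))} := by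
        refine measure_mono fun ω hω => ENNReal.ofReal_le_ofReal ?_
        exact pow_le_pow_left₀ (by positivity) (le_of_lt hω) _
    _ ≤ (∫⁻ ω, ENNReal.ofReal (‖Y ω‖ ^ (2 * q)) ∂Pr) / ENNReal.ofReal ((M * R) ^ (2 * q)) := by
        refine meas_ge_le_lintegral_div ?_ (by simpa using hc) ENNReal.ofReal_ne_top
        fun_prop
    _ ≤ ENNReal.ofReal (p * R ^ (2 * q)) / ENNReal.ofReal ((M * R) ^ (2 * q)) :=
        ENNReal.div_le_div_right h _
    _ = ENNReal.ofReal (p / M ^ (2 * q)) := by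
        rw [← ENNReal.ofReal_div_of_pos hc, mul_pow]
        congr 1
        field_simp

/-! ### Linear stochastic approximation with constant step size -/

section Recursion

variable {H Z Ω : Type*} [NormedAddCommGroup H] [InnerProductSpace ℝ H] [FiniteDimensional ℝ H]
  [MeasurableSpace H] [BorelSpace H] [MeasurableSpace Z] [MeasurableSpace Ω]

/-- The conditions on a linear stochastic approximation recursion
`x_{t+1} = x_t - α (A (X_t) x_t + e (X_t))` used for the tail-average bound: `N` plays the role of
the squared norm `‖x‖²_{I ⊗ Σ}`, with respect to which the mean of `A` is `κ`-coercive, and the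
noise `e` is centred, bounded by `B` and has second moment at most `σ²`. -/
structure IsLSAModel (ν : Measure Z) (A : Z → H →ₗ[ℝ] H) (e : Z → H) (N : H → ℝ)
    (κ lam σ B : ℝ) : Prop where
  κ_pos : 0 < κ
  lam_pos : 0 < lam
  B_nonneg : 0 ≤ B
  measurable_op : Measurable fun p : H × Z => A p.2 p.1
  measurable_noise : Measurable e
  norm_op : ∀ᵐ z ∂ν, ∀ x, ‖A z x‖ ≤ 2 * ‖x‖
  drift : ∀ x, κ * N x ≤ ∫ z, inner ℝ x (A z x) ∂ν
  sq_op : ∀ x, ∫ z, ‖A z x‖ ^ 2 ∂ν ≤ 4 * N x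
  le_N : ∀ x, lam * ‖x‖ ^ 2 ≤ N x
  N_le : ∀ x, N x ≤ ‖x‖ ^ 2
  N_add : ∀ x y, N (x + y) ≤ 2 * N x + 2 * N y
  norm_noise : ∀ᵐ z ∂ν, ‖e z‖ ≤ B
  mean_noise : ∫ z, e z ∂ν = 0
  sq_noise : ∫ z, ‖e z‖ ^ 2 ∂ν ≤ σ ^ 2

lemma integrable_sq_norm_of_ae_le {ν : Measure Z} [IsFiniteMeasure ν] {f : Z → H}
    (hf : Measurable f) {b : ℝ} (hb : ∀ᵐ z ∂ν, ‖f z‖ ≤ b) : Integrable (fun z => ‖f z‖ ^ 2) ν := by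
  refine Integrable.of_bound (C := b ^ 2) (by fun_prop) ?_
  filter_upwards [hb] with z hz
  rw [Real.norm_of_nonneg (sq_nonneg _)]
  exact pow_le_pow_left₀ (norm_nonneg _) hz 2

lemma integral_sq_norm_sub_mean_le {ν : Measure Z} [IsProbabilityMeasure ν] {f : Z → H}
    (hf : Measurable f) {b : ℝ} (hb : ∀ᵐ z ∂ν, ‖f z‖ ≤ b) :
    ∫ z, ‖f z - ∫ y, f y ∂ν‖ ^ 2 ∂ν ≤ ∫ z, ‖f z‖ ^ 2 ∂ν := by
  have hfi : Integrable f ν := Integrable.of_bound hf.aestronglyMeasurable b hb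
  set m := ∫ y, f y ∂ν with hm
  have h1 : ∀ z, ‖f z - m‖ ^ 2 = ‖f z‖ ^ 2 - 2 * inner ℝ m (f z) + ‖m‖ ^ 2 := fun z => by
    rw [norm_sub_sq_real, real_inner_comm]
  have hi1 : Integrable (fun z => ‖f z‖ ^ 2) ν := integrable_sq_norm_of_ae_le hf hb
  have hi2 : Integrable (fun z => 2 * inner ℝ m (f z)) ν := (hfi.const_inner m).const_mul 2
  have hi3 : Integrable (fun z => ‖f z‖ ^ 2 - 2 * inner ℝ m (f z)) ν := hi1.sub hi2
  simp_rw [h1]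
  rw [integral_add hi3 (integrable_const _), integral_sub hi1 hi2, integral_const_mul,
    integral_inner hfi, ← hm, real_inner_self_eq_norm_sq]
  simp only [integral_const, probReal_univ, smul_eq_mul, one_mul]
  nlinarith [sq_nonneg ‖m‖]

lemma integral_sq_norm_add_le {ν : Measure Z} [IsProbabilityMeasure ν] {f g : Z → H}
    (hf : Measurable f) (hg : Measurable g) {b c : ℝ} (hb : ∀ᵐ z ∂ν, ‖f z‖ ≤ b)
    (hc : ∀ᵐ z ∂ν, ‖g z‖ ≤ c) :
    ∫ z, ‖f z + g z‖ ^ 2 ∂ν ≤ 2 * ∫ z, ‖f z‖ ^ 2 ∂ν + 2 * ∫ z, ‖g z‖ ^ 2 ∂ν := by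
  have hi1 := integrable_sq_norm_of_ae_le hf hb
  have hi2 := integrable_sq_norm_of_ae_le hg hc
  rw [← integral_const_mul, ← integral_const_mul, ← integral_add (hi1.const_mul 2)
    (hi2.const_mul 2)]
  refine integral_mono (integrable_sq_norm_of_ae_le (hf.add hg) (b := b + c) ?_)
    ((hi1.const_mul 2).add (hi2.const_mul 2)) fun z => ?_
  · filter_upwards [hb, hc] with z h1 h2
    exact (norm_add_le _ _).trans (add_le_add h1 h2)
  · have h1 := parallelogram_law_with_norm ℝ (f z) (g z)
    simp only at *
    nlinarith [sq_nonneg ‖f z - g z‖]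

/-- The recursion without noise. -/
def transientStep (A : Z → H →ₗ[ℝ] H) (α : ℝ) (x : H) (z : Z) : H := x - α • A z x

/-- One step of the linear stochastic approximation recursion. -/
def noisyStep (A : Z → H →ₗ[ℝ] H) (e : Z → H) (α : ℝ) (x : H) (z : Z) : H :=
  x - α • (A z x + e z)

/-- The noisy recursion together with the martingale `∑ (e + (A - E A) x)` driving its average. The
multiplicative part of an increment is dropped while `x` is outside the ball of radius `R`; this
makes the increments bounded. -/
noncomputable def noiseSumStep (ν : Measure Z) (A : Z → H →ₗ[ℝ] H) (e : Z → H) (α R : ℝ)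
    (p : H × H) (z : Z) : H × H :=
  (noisyStep A e α p.1 z,
    p.2 + (e z + if ‖p.1‖ ≤ R then A z p.1 - ∫ y, A y p.1 ∂ν else 0))

namespace IsLSAModel

variable {ν : Measure Z} [IsProbabilityMeasure ν] {A : Z → H →ₗ[ℝ] H} {e : Z → H} {N : H → ℝ}
  {κ lam σ B : ℝ} {α : ℝ} {q : ℕ}

omit [FiniteDimensional ℝ H] [BorelSpace H] [IsProbabilityMeasure ν] in
lemma measurable_op_apply (h : IsLSAModel ν A e N κ lam σ B) (x : H) :
    Measurable fun z => A z x :=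
  h.measurable_op.comp measurable_prodMk_left

lemma integrable_op (h : IsLSAModel ν A e N κ lam σ B) (x : H) :
    Integrable (fun z => A z x) ν :=
  Integrable.of_bound (h.measurable_op_apply x).aestronglyMeasurable (2 * ‖x‖)
    (h.norm_op.mono fun _ hz => hz x)

lemma integrable_noise (h : IsLSAModel ν A e N κ lam σ B) : Integrable e ν :=
  Integrable.of_bound h.measurable_noise.aestronglyMeasurable B h.norm_noise

omit [IsProbabilityMeasure ν] in
lemma measurable_transientStep (h : IsLSAModel ν A e N κ lam σ B) :
    Measurable (Function.uncurry (transientStep A α)) :=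
  measurable_fst.sub (h.measurable_op.const_smul α)

omit [IsProbabilityMeasure ν] in
lemma measurable_noisyStep (h : IsLSAModel ν A e N κ lam σ B) :
    Measurable (Function.uncurry (noisyStep A e α)) :=
  measurable_fst.sub
    ((h.measurable_op.add (h.measurable_noise.comp measurable_snd)).const_smul α)

lemma measurable_noiseSumStep (h : IsLSAModel ν A e N κ lam σ B) (R : ℝ) :
    Measurable (Function.uncurry (noiseSumStep ν A e α R)) := by
  have h1 : Measurable fun p : (H × H) × Z => A p.2 p.1.1 :=
    h.measurable_op.comp ((measurable_fst.comp measurable_fst).prodMk measurable_snd)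
  have h2 : Measurable fun x : H => ∫ y, A y x ∂ν :=
    (h.measurable_op.stronglyMeasurable.integral_prod_right (ν := ν)).measurable
  have h3 : Measurable fun p : (H × H) × Z => ∫ y, A y p.1.1 ∂ν :=
    h2.comp (measurable_fst.comp measurable_fst)
  refine Measurable.prodMk ?_ ?_
  · exact h.measurable_noisyStep.comp
      ((measurable_fst.comp measurable_fst).prodMk measurable_snd)
  · refine (measurable_snd.comp measurable_fst).add
      ((h.measurable_noise.comp measurable_snd).add (Measurable.ite ?_ (h1.sub h3)
        measurable_const))
    exact measurableSet_le (measurable_norm.comp (measurable_fst.comp measurable_fst))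
      measurable_const

/-- Exponential stability in the `2q`-th moment: this is where a step size of order
`(1 - √γ) / q` is needed. -/
lemma transient_moment_step (h : IsLSAModel ν A e N κ lam σ B) (hα : 0 < α) (hq : 1 ≤ q)
    (hq1 : 4 * (q * α) ≤ 1) (hq2 : 8 * (α * (1 + 34 * (q - 1))) ≤ κ) (x : H) :
    ∫⁻ z, ENNReal.ofReal (‖transientStep A α x z‖ ^ (2 * q)) ∂ν ≤
      ENNReal.ofReal (Real.exp (-(q * (α * κ * lam)))) * ENNReal.ofReal (‖x‖ ^ (2 * q)) := by
  have hq0 : (1 : ℝ) ≤ q := by exact_mod_cast hq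
  have hN : 0 ≤ N x := (mul_nonneg h.lam_pos.le (sq_nonneg _)).trans (h.le_N x)
  have hw : Measurable fun z => -(α • A z x) := ((h.measurable_op_apply x).const_smul α).neg
  have hstep := lintegral_norm_add_pow_le (ν := ν) (x := x) hw hq (b := 2 * α * ‖x‖)
    (c := -(α * κ * lam)) ?_ ?_ ?_
  · simp only [transientStep, sub_eq_add_neg]
    refine hstep.trans ?_
    rw [← ENNReal.ofReal_mul (Real.exp_pos _).le]
    refine ENNReal.ofReal_le_ofReal (mul_le_mul_of_nonneg_right ?_ (by positivity))
    linarith [Real.add_one_le_exp (-(q * (α * κ * lam)))]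
  · filter_upwards [h.norm_op] with z hz
    rw [norm_neg, norm_smul, Real.norm_of_nonneg hα.le]
    nlinarith [hz x]
  · nlinarith [norm_nonneg x]
  · simp only [inner_neg_right, real_inner_smul_right, norm_neg, norm_smul, mul_pow,
      Real.norm_of_nonneg hα.le, integral_neg, integral_const_mul]
    have h1 := mul_le_mul_of_nonneg_left (h.drift x) hα.le
    have h2 := mul_le_mul_of_nonneg_left (h.sq_op x)
      (by nlinarith : 0 ≤ (1 + 34 * ((q : ℝ) - 1)) * α ^ 2)
    have h3 := mul_le_mul_of_nonneg_right hq2 (by positivity : 0 ≤ α * N x)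
    have h4 := mul_le_mul_of_nonneg_left (h.le_N x) (mul_pos hα h.κ_pos).le
    have h5 : 0 ≤ α * κ * N x := mul_nonneg (mul_pos hα h.κ_pos).le hN
    nlinarith

/-- Outside the ball of radius `R` the `2q`-th moment does not grow; from inside it, one step
cannot leave the ball by more than a factor `1 + 1 / q`. -/
lemma noisy_moment_step (h : IsLSAModel ν A e N κ lam σ B) (hα : 0 < α) (hq : 1 ≤ q)
    (hq1 : 4 * (q * α) ≤ 1) (hq2 : 8 * (α * (1 + 34 * (q - 1))) ≤ κ) {R : ℝ}
    (hR1 : 2 * (q * α * B) ≤ R) (hR2 : 68 * (q * α * σ ^ 2) ≤ κ * lam * R ^ 2) (x : H) :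
    ∫⁻ z, ENNReal.ofReal (‖noisyStep A e α x z‖ ^ (2 * q)) ∂ν ≤
      1 * ENNReal.ofReal (‖x‖ ^ (2 * q)) + ENNReal.ofReal (Real.exp 2 * R ^ (2 * q)) := by
  have hq0 : (1 : ℝ) ≤ q := by exact_mod_cast hq
  have hN : 0 ≤ N x := (mul_nonneg h.lam_pos.le (sq_nonneg _)).trans (h.le_N x)
  have hR0 : 0 ≤ R := le_trans (by have := h.B_nonneg; positivity) hR1
  have hw : Measurable fun z => -(α • (A z x + e z)) :=
    (((h.measurable_op_apply x).add h.measurable_noise).const_smul α).neg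
  have hwb : ∀ᵐ z ∂ν, ‖-(α • (A z x + e z))‖ ≤ α * (2 * ‖x‖ + B) := by
    filter_upwards [h.norm_op, h.norm_noise] with z hz hz'
    rw [norm_neg, norm_smul, Real.norm_of_nonneg hα.le]
    exact mul_le_mul_of_nonneg_left ((norm_add_le _ _).trans (add_le_add (hz x) hz')) hα.le
  simp only [noisyStep, sub_eq_add_neg]
  rcases le_total R ‖x‖ with hx | hx
  · have hstep := lintegral_norm_add_pow_le (ν := ν) (x := x) hw hq (c := 0) hwb ?_ ?_
    · rw [mul_zero, add_zero, one_mul] at hstep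
      rw [one_mul]
      exact hstep.trans le_self_add
    · nlinarith [norm_nonneg x]
    · simp only [inner_neg_right, real_inner_smul_right, norm_neg, norm_smul, mul_pow,
        Real.norm_of_nonneg hα.le, integral_neg, integral_const_mul, inner_add_right]
      rw [integral_add ((h.integrable_op x).const_inner x) (h.integrable_noise.const_inner x),
        integral_inner h.integrable_noise, h.mean_noise, inner_zero_right, add_zero]
      have hsq := integral_sq_norm_add_le (h.measurable_op_apply x) h.measurable_noise
        (h.norm_op.mono fun _ hz => hz x) h.norm_noise
      have h1 := mul_le_mul_of_nonneg_left (h.drift x) hα.le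
      have h2 := mul_le_mul_of_nonneg_left
        (hsq.trans (add_le_add (mul_le_mul_of_nonneg_left (h.sq_op x) two_pos.le)
          (mul_le_mul_of_nonneg_left h.sq_noise two_pos.le)))
        (by nlinarith : 0 ≤ (1 + 34 * ((q : ℝ) - 1)) * α ^ 2)
      have h3 := mul_le_mul_of_nonneg_right hq2 (by positivity : 0 ≤ α * N x)
      have h4 := mul_le_mul_of_nonneg_left (h.le_N x) (mul_pos hα h.κ_pos).le
      have hRx : R ^ 2 ≤ ‖x‖ ^ 2 := pow_le_pow_left₀ hR0 hx 2
      have h5 := mul_le_mul_of_nonneg_left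
        (hR2.trans (mul_le_mul_of_nonneg_left hRx (mul_pos h.κ_pos h.lam_pos).le)) hα.le
      have h6 : 0 ≤ α ^ 2 * σ ^ 2 := by positivity
      nlinarith
  · refine (lintegral_ofReal_le_of_ae_le (c := Real.exp 2 * R ^ (2 * q)) ?_).trans le_add_self
    filter_upwards [hwb] with z hz
    refine norm_add_pow_le_of_le hq hx ?_
    calc (q : ℝ) * ‖-(α • (A z x + e z))‖ ≤ q * (α * (2 * ‖x‖ + B)) := by gcongr
      _ ≤ q * (α * (2 * R + B)) := by gcongr
      _ ≤ R := by nlinarith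

lemma noiseSum_moment_step (h : IsLSAModel ν A e N κ lam σ B) (hq : 1 ≤ q)
    {R₁ R T : ℝ} (hR₁ : 0 ≤ R₁) (hT : 0 < T) (hR1 : q * (B + 4 * R₁) ≤ R)
    (hR2 : q * T * (2 * σ ^ 2 + 8 * R₁ ^ 2) ≤ R ^ 2) (p : H × H) :
    ∫⁻ z, ENNReal.ofReal (‖(noiseSumStep ν A e α R₁ p z).2‖ ^ (2 * q)) ∂ν ≤
      ENNReal.ofReal (1 + 34 * q / T) * ENNReal.ofReal (‖p.2‖ ^ (2 * q)) +
        ENNReal.ofReal (Real.exp 2 * R ^ (2 * q)) := by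
  obtain ⟨x, S⟩ := p
  have hq0 : (1 : ℝ) ≤ q := by exact_mod_cast hq
  have hB := h.B_nonneg
  have hR0 : 0 ≤ R := le_trans (by positivity) hR1
  set m : Z → H := fun z => if ‖x‖ ≤ R₁ then A z x - ∫ y, A y x ∂ν else 0 with hm
  have hmm : Measurable m := by
    by_cases hx : ‖x‖ ≤ R₁
    · simp only [hm, hx, if_true]
      exact (h.measurable_op_apply x).sub measurable_const
    · simp only [hm, hx, if_false]
      exact measurable_const
  have hmb : ∀ᵐ z ∂ν, ‖m z‖ ≤ 4 * R₁ := by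
    by_cases hx : ‖x‖ ≤ R₁
    · have h1 : ‖∫ y, A y x ∂ν‖ ≤ 2 * ‖x‖ := by
        have := norm_integral_le_of_norm_le_const (h.norm_op.mono fun _ hz => hz x)
        simpa using this
      filter_upwards [h.norm_op] with z hz
      simp only [hm, hx, if_true]
      linarith [norm_sub_le (A z x) (∫ y, A y x ∂ν), hz x]
    · simp [hm, hx, hR₁]
  have hm0 : ∫ z, m z ∂ν = 0 := by
    by_cases hx : ‖x‖ ≤ R₁
    · simp only [hm, hx, if_true]
      rw [integral_sub (h.integrable_op x) (integrable_const _)]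
      simp
    · simp [hm, hx]
  have hm2 : ∫ z, ‖m z‖ ^ 2 ∂ν ≤ 4 * R₁ ^ 2 := by
    by_cases hx : ‖x‖ ≤ R₁
    · simp only [hm, hx, if_true]
      have := pow_le_pow_left₀ (norm_nonneg _) hx 2
      linarith [integral_sq_norm_sub_mean_le (h.measurable_op_apply x)
        (h.norm_op.mono fun _ hz => hz x), h.sq_op x, h.N_le x]
    · simp only [hm, hx, if_false]
      simp
      positivity
  have hwm : Measurable fun z => e z + m z := h.measurable_noise.add hmm
  have hwb : ∀ᵐ z ∂ν, ‖e z + m z‖ ≤ B + 4 * R₁ := by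
    filter_upwards [h.norm_noise, hmb] with z hz hz'
    exact (norm_add_le _ _).trans (add_le_add hz hz')
  change ∫⁻ z, ENNReal.ofReal (‖S + (e z + m z)‖ ^ (2 * q)) ∂ν ≤ _
  rcases le_total R ‖S‖ with hS | hS
  · refine (lintegral_norm_add_pow_le (ν := ν) (x := S) hwm hq (c := 34 / T) hwb
      (hR1.trans hS) ?_).trans ?_
    · have hmi : Integrable m ν := Integrable.of_bound hmm.aestronglyMeasurable _ hmb
      have hsum : Integrable (fun z => e z + m z) ν := h.integrable_noise.add hmi
      rw [integral_inner hsum, integral_add h.integrable_noise hmi, h.mean_noise, hm0]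
      simp only [add_zero, inner_zero_right, mul_zero, zero_add]
      have hsq := integral_sq_norm_add_le h.measurable_noise hmm h.norm_noise hmb
      have hSR : R ^ 2 ≤ ‖S‖ ^ 2 := pow_le_pow_left₀ hR0 hS 2
      have h1 : ∫ z, ‖e z + m z‖ ^ 2 ∂ν ≤ 2 * σ ^ 2 + 8 * R₁ ^ 2 := by
        linarith [h.sq_noise]
      have h0 : 0 ≤ 2 * σ ^ 2 + 8 * R₁ ^ 2 := by positivity
      rw [div_mul_eq_mul_div, le_div_iff₀ hT]
      calc (1 + 34 * ((q : ℝ) - 1)) * (∫ z, ‖e z + m z‖ ^ 2 ∂ν) * T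
          ≤ (34 * q) * (2 * σ ^ 2 + 8 * R₁ ^ 2) * T := by
            refine mul_le_mul_of_nonneg_right ?_ hT.le
            refine mul_le_mul (by linarith) h1 ?_ (by positivity)
            exact integral_nonneg fun z => sq_nonneg _
        _ = 34 * (q * T * (2 * σ ^ 2 + 8 * R₁ ^ 2)) := by ring
        _ ≤ 34 * ‖S‖ ^ 2 := by linarith
    · refine le_trans (le_of_eq ?_) le_self_add
      rw [← ENNReal.ofReal_mul (by positivity)]
      congr 2
      ring
  · refine (lintegral_ofReal_le_of_ae_le (c := Real.exp 2 * R ^ (2 * q)) ?_).trans le_add_self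
    filter_upwards [hwb] with z hz
    refine norm_add_pow_le_of_le hq hS (le_trans ?_ hR1)
    gcongr

end IsLSAModel

end Recursion

/-! ### The tail average -/

section TailAverage

variable {H Z Ω : Type*} [NormedAddCommGroup H] [InnerProductSpace ℝ H] [FiniteDimensional ℝ H]
  [MeasurableSpace H] [BorelSpace H] [MeasurableSpace Z] [MeasurableSpace Ω]

section Pathwise

omit [FiniteDimensional ℝ H] [MeasurableSpace H] [BorelSpace H] [MeasurableSpace Z]
  [MeasurableSpace Ω] in
/-- By linearity the initial error and the noise propagate separately. -/
lemma chain_noisyStep_eq (A : Z → H →ₗ[ℝ] H) (e : Z → H) (α : ℝ) (y₀ : H) (X : ℕ → Ω → Z)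
    (ω : Ω) (t : ℕ) :
    chain (noisyStep A e α) y₀ X t ω =
      chain (transientStep A α) y₀ X t ω + chain (noisyStep A e α) 0 X t ω := by
  induction t with
  | zero => simp [chain]
  | succ t ih =>
    simp only [chain, noisyStep, transientStep] at ih ⊢
    rw [ih]
    simp only [map_add, smul_add]
    abel

omit [FiniteDimensional ℝ H] [BorelSpace H] [MeasurableSpace H] [MeasurableSpace Ω] in
lemma chain_noiseSumStep_fst (ν : Measure Z) (A : Z → H →ₗ[ℝ] H) (e : Z → H) (α R : ℝ)
    (X : ℕ → Ω → Z) (ω : Ω) (t : ℕ) :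
    (chain (noiseSumStep ν A e α R) 0 X t ω).1 = chain (noisyStep A e α) 0 X t ω := by
  induction t with
  | zero => rfl
  | succ t ih => simp only [chain, noiseSumStep, ih]

omit [FiniteDimensional ℝ H] [BorelSpace H] [MeasurableSpace H] [MeasurableSpace Ω] in
/-- Summation of the recursion: as long as no truncation has happened, the displacement is the
accumulated mean drift plus the martingale part. -/
lemma smul_noiseSum_add_drift (ν : Measure Z) (A : Z → H →ₗ[ℝ] H) (e : Z → H) (α R : ℝ)
    (X : ℕ → Ω → Z) (ω : Ω) (t : ℕ)
    (hR : ∀ i < t, ‖chain (noisyStep A e α) 0 X i ω‖ ≤ R) :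
    α • ((chain (noiseSumStep ν A e α R) 0 X t ω).2 +
      ∑ i ∈ Finset.range t, ∫ z, A z (chain (noisyStep A e α) 0 X i ω) ∂ν) =
      -chain (noisyStep A e α) 0 X t ω := by
  induction t with
  | zero => simp [chain]
  | succ t ih =>
    have h1 := ih fun i hi => hR i (hi.trans (Nat.lt_succ_self t))
    have h2 := hR t (Nat.lt_succ_self t)
    rw [Finset.sum_range_succ]
    simp only [chain]
    simp only [noiseSumStep, chain_noiseSumStep_fst, if_pos h2]
    set x := chain (noisyStep A e α) 0 X t ω
    set S := (chain (noiseSumStep ν A e α R) 0 X t ω).2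
    set m := ∫ z, A z x ∂ν
    set D := ∑ i ∈ Finset.range t, ∫ z, A z (chain (noisyStep A e α) 0 X i ω) ∂ν
    calc α • (S + (e (X t ω) + (A (X t ω) x - m)) + (D + m))
        = α • (S + D) + α • (A (X t ω) x + e (X t ω)) := by
          rw [← smul_add]
          congr 1
          abel
      _ = -noisyStep A e α x (X t ω) := by
          rw [h1, noisyStep]
          abel

end Pathwise

namespace IsLSAModel

variable {ν : Measure Z} [IsProbabilityMeasure ν] {A : Z → H →ₗ[ℝ] H} {e : Z → H} {N : H → ℝ}
  {κ lam σ B : ℝ} {α : ℝ} {q : ℕ}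

/-- Coercivity of the mean operator turns a bound on its value into a bound on `N`. -/
lemma N_le_of_norm_mean_op (h : IsLSAModel ν A e N κ lam σ B) (u : H) :
    N u ≤ (‖∫ z, A z u ∂ν‖ / (κ * √lam)) ^ 2 := by
  have hκ := h.κ_pos
  have hlam := h.lam_pos
  set v := ∫ z, A z u ∂ν with hv
  have h1 : κ * N u ≤ ‖u‖ * ‖v‖ := by
    refine (h.drift u).trans ?_
    rw [integral_inner (h.integrable_op u), ← hv]
    exact real_inner_le_norm u v
  have h2 := h.le_N u
  have hN : 0 ≤ N u := (by positivity : 0 ≤ lam * ‖u‖ ^ 2).trans h2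
  rw [div_pow, mul_pow, Real.sq_sqrt hlam.le, le_div_iff₀ (by positivity)]
  rcases hN.eq_or_lt with h0 | h0
  · rw [← h0, zero_mul]
    positivity
  · have h3 : (κ * N u) ^ 2 ≤ (‖u‖ * ‖v‖) ^ 2 := pow_le_pow_left₀ (by positivity) h1 2
    have h4 : lam * (κ * N u) ^ 2 ≤ N u * ‖v‖ ^ 2 := by
      calc lam * (κ * N u) ^ 2 ≤ lam * (‖u‖ * ‖v‖) ^ 2 := by gcongr
        _ = (lam * ‖u‖ ^ 2) * ‖v‖ ^ 2 := by ring
        _ ≤ _ := by gcongr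
    have h5 : N u * (N u * (κ ^ 2 * lam)) ≤ N u * ‖v‖ ^ 2 := by nlinarith
    exact le_of_mul_le_mul_left h5 h0

omit [MeasurableSpace Ω] in
/-- The deterministic part of the analysis: bounds on the transient, on the noise-driven iterates
and on the martingale give a bound on the tail average. -/
lemma N_tailAverage_le (h : IsLSAModel ν A e N κ lam σ B) (hα : 0 < α) {M R R' D : ℝ}
    (y₀ : H) (X : ℕ → Ω → Z) (ω : Ω) (n : ℕ)
    (h1 : ∀ t ∈ Finset.Icc n (2 * n), ‖chain (transientStep A α) y₀ X t ω‖ ≤ D)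
    (h2 : ∀ t ≤ 2 * n + 1, ‖chain (noisyStep A e α) 0 X t ω‖ ≤ M * R)
    (h3 : ∀ t ≤ 2 * n + 1, ‖(chain (noiseSumStep ν A e α (M * R)) 0 X t ω).2‖ ≤ M * R') :
    N (((n : ℝ) + 1)⁻¹ • ∑ t ∈ Finset.Icc n (2 * n), chain (noisyStep A e α) y₀ X t ω) ≤
      2 * D ^ 2 + 2 * ((2 * (M * R) / α + 2 * (M * R')) / (((n : ℝ) + 1) * (κ * √lam))) ^ 2 := by
  set x : ℕ → H := fun t => chain (noisyStep A e α) 0 X t ω with hx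
  set S : ℕ → H := fun t => (chain (noiseSumStep ν A e α (M * R)) 0 X t ω).2 with hS
  have hn : (0 : ℝ) < (n : ℝ) + 1 := by positivity
  have hcard : (Finset.Icc n (2 * n)).card = n + 1 := by
    rw [Nat.card_Icc]
    omega
  have hκ := h.κ_pos
  have hlam := h.lam_pos
  have hsplit : ((n : ℝ) + 1)⁻¹ • ∑ t ∈ Finset.Icc n (2 * n), chain (noisyStep A e α) y₀ X t ω =
      ((n : ℝ) + 1)⁻¹ • ∑ t ∈ Finset.Icc n (2 * n), chain (transientStep A α) y₀ X t ω +
      ((n : ℝ) + 1)⁻¹ • ∑ t ∈ Finset.Icc n (2 * n), x t := by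
    rw [← smul_add, ← Finset.sum_add_distrib]
    congr 1
    exact Finset.sum_congr rfl fun t _ => chain_noisyStep_eq A e α y₀ X ω t
  have htr : ‖((n : ℝ) + 1)⁻¹ •
      ∑ t ∈ Finset.Icc n (2 * n), chain (transientStep A α) y₀ X t ω‖ ≤ D := by
    rw [norm_smul, Real.norm_of_nonneg (by positivity), inv_mul_le_iff₀ hn]
    refine (norm_sum_le_of_le _ h1).trans ?_
    rw [Finset.sum_const, hcard, nsmul_eq_mul]
    push_cast
    exact le_rfl
  set u := ((n : ℝ) + 1)⁻¹ • ∑ t ∈ Finset.Icc n (2 * n), x t with hu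
  have hmean : ∫ z, A z u ∂ν =
      ((n : ℝ) + 1)⁻¹ • ∑ t ∈ Finset.Icc n (2 * n), ∫ z, A z (x t) ∂ν := by
    simp only [hu, map_smul, map_sum]
    rw [integral_smul, integral_finsetSum _ fun t _ => h.integrable_op (x t)]
  have hsum : ∑ t ∈ Finset.Icc n (2 * n), ∫ z, A z (x t) ∂ν =
      α⁻¹ • (x n - x (2 * n + 1)) - (S (2 * n + 1) - S n) := by
    have e1 := smul_noiseSum_add_drift ν A e α (M * R) X ω (2 * n + 1)
      fun i hi => h2 i hi.le
    have e2 := smul_noiseSum_add_drift ν A e α (M * R) X ω n fun i hi => h2 i (by omega)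
    have e3 : ∑ t ∈ Finset.Icc n (2 * n), ∫ z, A z (x t) ∂ν =
        ∑ t ∈ Finset.range (2 * n + 1), ∫ z, A z (x t) ∂ν -
          ∑ t ∈ Finset.range n, ∫ z, A z (x t) ∂ν := by
      rw [eq_sub_iff_add_eq', ← Finset.sum_range_add_sum_Ico _ (by omega : n ≤ 2 * n + 1)]
      rfl
    have e4 : ∀ t, -x t = α • (S t + ∑ i ∈ Finset.range t, ∫ z, A z (x i) ∂ν) →
        ∑ i ∈ Finset.range t, ∫ z, A z (x i) ∂ν = -(α⁻¹ • x t) - S t := fun t ht => by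
      rw [← smul_neg, ht, smul_smul, inv_mul_cancel₀ hα.ne', one_smul]
      abel
    rw [e3, e4 _ e1.symm, e4 _ e2.symm, smul_sub]
    abel
  have hfl : ‖∫ z, A z u ∂ν‖ ≤ (2 * (M * R) / α + 2 * (M * R')) / ((n : ℝ) + 1) := by
    rw [hmean, hsum, norm_smul, Real.norm_of_nonneg (by positivity), div_eq_inv_mul]
    refine mul_le_mul_of_nonneg_left ?_ (by positivity)
    refine (norm_sub_le _ _).trans (add_le_add ?_ ?_)
    · rw [norm_smul, Real.norm_of_nonneg (by positivity), inv_mul_le_iff₀ hα,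
        mul_div_cancel₀ _ hα.ne']
      linarith [norm_sub_le (x n) (x (2 * n + 1)), h2 n (by omega), h2 (2 * n + 1) le_rfl]
    · linarith [norm_sub_le (S (2 * n + 1)) (S n), h3 n (by omega), h3 (2 * n + 1) le_rfl]
  have hNu : N u ≤
      ((2 * (M * R) / α + 2 * (M * R')) / (((n : ℝ) + 1) * (κ * √lam))) ^ 2 := by
    refine (h.N_le_of_norm_mean_op u).trans (pow_le_pow_left₀ (by positivity) ?_ 2)
    rw [← div_div _ ((n : ℝ) + 1)]
    exact div_le_div_of_nonneg_right hfl (by positivity)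
  rw [hsplit]
  refine (h.N_add _ _).trans (add_le_add ?_ ?_)
  · refine mul_le_mul_of_nonneg_left ((h.N_le _).trans ?_) two_pos.le
    exact pow_le_pow_left₀ (norm_nonneg _) htr 2
  · exact mul_le_mul_of_nonneg_left hNu two_pos.le

variable {Pr : Measure Ω} [IsProbabilityMeasure Pr] {X : ℕ → Ω → Z}

/-- High-probability bound for the tail average. Since `q` is of the order of `log (T / δ²)`,
Markov's inequality for `2q`-th moments and the union bound over all times cost only the constant
factor `M`. -/
theorem measure_tailAverage (h : IsLSAModel ν A e N κ lam σ B)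
    (hX : ∀ t, Measurable (X t)) (hind : iIndepFun X Pr) (hlaw : ∀ t, Pr.map (X t) = ν)
    (hα : 0 < α) (hq : 1 ≤ q)
    (hq1 : 4 * (q * α) ≤ 1) (hq2 : 8 * (α * (1 + 34 * (q - 1))) ≤ κ) {n : ℕ} (hn : 1 ≤ n)
    {M R R' δ : ℝ} (hM : 0 < M)
    (hR1 : 2 * (q * α * B) ≤ R) (hR2 : 68 * (q * α * σ ^ 2) ≤ κ * lam * R ^ 2)
    (hR'1 : q * (B + 4 * (M * R)) ≤ R')
    (hR'2 : q * (2 * n) * (2 * σ ^ 2 + 8 * (M * R) ^ 2) ≤ R' ^ 2)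
    (hδ : 12 * (2 * n) ^ 2 * Real.exp 2 * Real.exp (51 * q) ≤ δ * M ^ (2 * q)) (y₀ : H) :
    Pr {ω | ¬ N (((n : ℝ) + 1)⁻¹ •
        ∑ t ∈ Finset.Icc n (2 * n), chain (noisyStep A e α) y₀ X t ω) ≤
      2 * (M * (Real.exp (-(α * κ * lam * n / 2)) * ‖y₀‖)) ^ 2 +
      2 * ((2 * (M * R) / α + 2 * (M * R')) / (((n : ℝ) + 1) * (κ * √lam))) ^ 2} ≤
    ENNReal.ofReal δ := by
  have hB := h.B_nonneg
  have hκ := h.κ_pos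
  have hlam := h.lam_pos
  have hq0 : (1 : ℝ) ≤ q := by exact_mod_cast hq
  have hn0 : (1 : ℝ) ≤ n := by exact_mod_cast hn
  have hR0 : 0 ≤ R := le_trans (by positivity) hR1
  have hR'0 : 0 ≤ R' := le_trans (by positivity) hR'1
  have hq2' : 2 * q ≠ 0 := by omega
  set P : ℝ := 4 * n * Real.exp 2 * Real.exp (51 * q) with hP
  have hP1 : 1 ≤ P := by
    have := Real.one_le_exp (show (0 : ℝ) ≤ 2 by norm_num)
    have := Real.one_le_exp (show (0 : ℝ) ≤ 51 * q by positivity)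
    calc (1 : ℝ) = 1 * 1 * 1 := by norm_num
      _ ≤ (4 * n) * Real.exp 2 * Real.exp (51 * q) := by gcongr; linarith
  have hPe : ∀ t ≤ 2 * n + 1, (t : ℝ) * Real.exp 2 ≤ P := fun t ht => by
    have h1 : (t : ℝ) ≤ 4 * n := by
      have : (t : ℝ) ≤ 2 * n + 1 := by exact_mod_cast ht
      linarith
    have := Real.one_le_exp (show (0 : ℝ) ≤ 51 * q by positivity)
    calc (t : ℝ) * Real.exp 2 = t * Real.exp 2 * 1 := by ring
      _ ≤ (4 * n) * Real.exp 2 * Real.exp (51 * q) := by gcongr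
  -- the initial error
  have hE1 : ∀ t : ℕ, Pr {ω | M * (Real.exp (-(α * κ * lam * t / 2)) * ‖y₀‖) <
      ‖chain (transientStep A α) y₀ X t ω‖} ≤ ENNReal.ofReal (P / M ^ (2 * q)) := fun t => by
    refine measure_lt_norm_le (measurable_chain h.measurable_transientStep hX t) hq hM
      (by positivity) ?_
    refine (lintegral_chain_le_pow (V := fun x => ENNReal.ofReal (‖x‖ ^ (2 * q)))
      h.measurable_transientStep hX hind hlaw (by fun_prop)
      (h.transient_moment_step hα hq hq1 hq2) t).trans ?_
    rw [← ENNReal.ofReal_pow (Real.exp_pos _).le, ← ENNReal.ofReal_mul (by positivity)]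
    refine ENNReal.ofReal_le_ofReal ?_
    rw [mul_pow, ← Real.exp_nat_mul, ← Real.exp_nat_mul]
    have e1 : (t : ℝ) * -(q * (α * κ * lam)) = ((2 * q : ℕ) : ℝ) * -(α * κ * lam * t / 2) := by
      push_cast
      ring
    rw [e1]
    exact le_mul_of_one_le_left (by positivity) hP1
  -- the iterates driven by the noise
  have hE2 : ∀ t ≤ 2 * n + 1, Pr {ω | M * R < ‖chain (noisyStep A e α) 0 X t ω‖} ≤
      ENNReal.ofReal (P / M ^ (2 * q)) := fun t ht => by
    refine measure_lt_norm_le (measurable_chain h.measurable_noisyStep hX t) hq hM hR0 ?_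
    refine (lintegral_chain_le_mul (V := fun x => ENNReal.ofReal (‖x‖ ^ (2 * q)))
      h.measurable_noisyStep hX hind hlaw (by fun_prop) le_rfl
      (h.noisy_moment_step hα hq hq1 hq2 hR1 hR2) (by simp [hq2']) t).trans ?_
    rw [one_pow, one_mul, ← ENNReal.ofReal_natCast, ← ENNReal.ofReal_mul (by positivity),
      ← mul_assoc]
    exact ENNReal.ofReal_le_ofReal (mul_le_mul_of_nonneg_right (hPe t ht) (by positivity))
  -- the martingale
  have hE3 : ∀ t ≤ 2 * n + 1,
      Pr {ω | M * R' < ‖(chain (noiseSumStep ν A e α (M * R)) 0 X t ω).2‖} ≤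
      ENNReal.ofReal (P / M ^ (2 * q)) := fun t ht => by
    refine measure_lt_norm_le
      (measurable_snd.comp (measurable_chain (h.measurable_noiseSumStep _) hX t)) hq hM hR'0 ?_
    refine (lintegral_chain_le_mul (V := fun p : H × H => ENNReal.ofReal (‖p.2‖ ^ (2 * q)))
      (h.measurable_noiseSumStep _) hX hind hlaw (by fun_prop)
      (a := ENNReal.ofReal (1 + 34 * q / (2 * n)))
      (by rw [ENNReal.one_le_ofReal]; linarith [show (0 : ℝ) ≤ 34 * q / (2 * n) by positivity])
      (h.noiseSum_moment_step hq (by positivity) (by positivity) hR'1 hR'2)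
      (by simp [hq2']) t).trans ?_
    rw [← ENNReal.ofReal_natCast, ← ENNReal.ofReal_mul (by positivity),
      ← ENNReal.ofReal_pow (by positivity), ← ENNReal.ofReal_mul (by positivity)]
    refine ENNReal.ofReal_le_ofReal ?_
    have e1 : (1 + 34 * (q : ℝ) / (2 * n)) ^ t ≤ Real.exp (51 * q) := by
      calc (1 + 34 * (q : ℝ) / (2 * n)) ^ t ≤ (Real.exp (34 * (q : ℝ) / (2 * n))) ^ t := by
            refine pow_le_pow_left₀ (by positivity) ?_ t
            linarith [Real.add_one_le_exp (34 * (q : ℝ) / (2 * n))]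
        _ = Real.exp (t * (34 * (q : ℝ) / (2 * n))) := by rw [Real.exp_nat_mul]
        _ ≤ Real.exp (51 * q) := by
            refine Real.exp_le_exp.mpr ?_
            have h1 : (t : ℝ) ≤ 3 * n := by
              have : (t : ℝ) ≤ 2 * n + 1 := by exact_mod_cast ht
              linarith
            calc (t : ℝ) * (34 * (q : ℝ) / (2 * n)) ≤ (3 * n) * (34 * (q : ℝ) / (2 * n)) := by
                  gcongr
              _ = 51 * q := by field_simp; norm_num
    have h1 : (t : ℝ) ≤ 4 * n := by
      have : (t : ℝ) ≤ 2 * n + 1 := by exact_mod_cast ht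
      linarith
    calc (1 + 34 * (q : ℝ) / (2 * n)) ^ t * (t * (Real.exp 2 * R' ^ (2 * q)))
        ≤ Real.exp (51 * q) * ((4 * n) * (Real.exp 2 * R' ^ (2 * q))) := by gcongr
      _ = P * R' ^ (2 * q) := by rw [hP]; ring
  -- union bound
  refine (measure_mono (t := ⋃ t ∈ Finset.range (2 * n + 2),
    (({ω | M * (Real.exp (-(α * κ * lam * t / 2)) * ‖y₀‖) <
      ‖chain (transientStep A α) y₀ X t ω‖} ∪
      {ω | M * R < ‖chain (noisyStep A e α) 0 X t ω‖}) ∪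
      {ω | M * R' < ‖(chain (noiseSumStep ν A e α (M * R)) 0 X t ω).2‖})) ?_).trans ?_
  · intro ω hω
    by_contra hcon
    simp only [Set.mem_iUnion, Set.mem_union, Set.mem_ofPred_eq, not_exists, not_or, not_lt,
      Finset.mem_range] at hcon
    refine hω (h.N_tailAverage_le hα y₀ X ω n (fun t ht => ?_)
      (fun t ht => (hcon t (by omega)).1.2) (fun t ht => (hcon t (by omega)).2))
    rw [Finset.mem_Icc] at ht
    refine (hcon t (by omega)).1.1.trans ?_
    have : (n : ℝ) ≤ t := by exact_mod_cast ht.1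
    gcongr
  · refine (measure_biUnion_finset_le _ _).trans ?_
    have hterm : ∀ t ∈ Finset.range (2 * n + 2),
        Pr (({ω | M * (Real.exp (-(α * κ * lam * t / 2)) * ‖y₀‖) <
          ‖chain (transientStep A α) y₀ X t ω‖} ∪
          {ω | M * R < ‖chain (noisyStep A e α) 0 X t ω‖}) ∪
          {ω | M * R' < ‖(chain (noiseSumStep ν A e α (M * R)) 0 X t ω).2‖}) ≤
        ENNReal.ofReal (3 * (P / M ^ (2 * q))) := fun t ht => by
      have ht' : t ≤ 2 * n + 1 := by
        have := Finset.mem_range.mp ht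
        omega
      refine (measure_union_le _ _).trans ((add_le_add ((measure_union_le _ _).trans
        (add_le_add (hE1 t) (hE2 t ht'))) (hE3 t ht')).trans (le_of_eq ?_))
      rw [← ENNReal.ofReal_add (by positivity) (by positivity),
        ← ENNReal.ofReal_add (by positivity) (by positivity)]
      congr 1
      ring
    refine (Finset.sum_le_sum hterm).trans ?_
    rw [Finset.sum_const, Finset.card_range, nsmul_eq_mul, ← ENNReal.ofReal_natCast,
      ← ENNReal.ofReal_mul (by positivity)]
    refine ENNReal.ofReal_le_ofReal ?_
    have hMq : 0 < M ^ (2 * q) := by positivity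
    rw [mul_div_assoc', mul_div_assoc', div_le_iff₀ hMq]
    refine le_trans ?_ hδ
    rw [hP]
    push_cast
    have : 0 < Real.exp 2 * Real.exp (51 * q) := by positivity
    have h2 : (2 * (n : ℝ) + 2) * (3 * (4 * n)) ≤ 12 * (2 * n) ^ 2 := by nlinarith
    calc (2 * (n : ℝ) + 2) * (3 * (4 * n * Real.exp 2 * Real.exp (51 * q)))
        = (2 * (n : ℝ) + 2) * (3 * (4 * n)) * (Real.exp 2 * Real.exp (51 * q)) := by ring
      _ ≤ 12 * (2 * n) ^ 2 * (Real.exp 2 * Real.exp (51 * q)) := by gcongr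
      _ = _ := by ring

end IsLSAModel

end TailAverage

/-! ### The random matrices of Linear-CTD as rank-one tensors -/

section Tensor

variable {K d : ℕ}

/-- The vector `(vᵀ θ(k))_k` of linear parts of the cumulative probabilities at feature `v`. -/
noncomputable def feat (v : EuclideanSpace ℝ (Fin d)) (θ : Param K d) : EuclideanSpace ℝ (Fin K) :=
  WithLp.toLp 2 fun k => ∑ i, v i * θ (k, i)

/-- The tensor `u ⊗ v` as a parameter. -/
noncomputable def tens (u : EuclideanSpace ℝ (Fin K)) (v : EuclideanSpace ℝ (Fin d)) : Param K d :=
  WithLp.toLp 2 fun p => u p.1 * v p.2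

/-- `C G̃(r) C⁻¹`, acting on Euclidean space. -/
noncomputable def backup (γ : ℝ) (r : ℝ) (u : EuclideanSpace ℝ (Fin K)) :
    EuclideanSpace ℝ (Fin K) :=
  WithLp.toLp 2 ((cdfBackup γ K r).mulVec u)

/-- The reward-dependent shift `(K + 1)⁻¹ C (∑ g_j(r) - 1)`. -/
noncomputable def shift (γ : ℝ) (K : ℕ) (r : ℝ) : EuclideanSpace ℝ (Fin K) :=
  WithLp.toLp 2 fun k =>
    ((K : ℝ) + 1)⁻¹ * (Cmat K).mulVec ((∑ j ∈ Finset.range (K + 1), gVec γ K j r) - 1) k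

lemma feat_add (v : EuclideanSpace ℝ (Fin d)) (θ₁ θ₂ : Param K d) :
    feat v (θ₁ + θ₂) = feat v θ₁ + feat v θ₂ := by
  ext k
  simp [feat, mul_add, Finset.sum_add_distrib]

lemma feat_sub (v : EuclideanSpace ℝ (Fin d)) (θ₁ θ₂ : Param K d) :
    feat v (θ₁ - θ₂) = feat v θ₁ - feat v θ₂ := by
  ext k
  simp [feat, mul_sub, Finset.sum_sub_distrib]

lemma feat_smul (v : EuclideanSpace ℝ (Fin d)) (c : ℝ) (θ : Param K d) :
    feat v (c • θ) = c • feat v θ := by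
  ext k
  simp only [feat, PiLp.smul_apply, smul_eq_mul, Finset.mul_sum]
  exact Finset.sum_congr rfl fun i _ => by ring

lemma inner_tens (θ : Param K d) (u : EuclideanSpace ℝ (Fin K)) (v : EuclideanSpace ℝ (Fin d)) :
    inner ℝ θ (tens u v) = inner ℝ (feat v θ) u := by
  simp only [PiLp.inner_apply, tens, feat, RCLike.inner_apply, conj_trivial,
    Fintype.sum_prod_type, Finset.mul_sum]
  exact Finset.sum_congr rfl fun k _ => Finset.sum_congr rfl fun i _ => by ring

lemma norm_tens (u : EuclideanSpace ℝ (Fin K)) (v : EuclideanSpace ℝ (Fin d)) :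
    ‖tens u v‖ = ‖u‖ * ‖v‖ := by
  rw [← pow_left_inj₀ (norm_nonneg _) (by positivity) two_ne_zero, mul_pow,
    EuclideanSpace.real_norm_sq_eq, EuclideanSpace.real_norm_sq_eq,
    EuclideanSpace.real_norm_sq_eq, Fintype.sum_prod_type, Finset.sum_mul_sum]
  simp [tens, mul_pow]

lemma norm_feat_le (v : EuclideanSpace ℝ (Fin d)) (θ : Param K d) :
    ‖feat v θ‖ ≤ ‖v‖ * ‖θ‖ := by
  have h := real_inner_le_norm θ (tens (feat v θ) v)
  rw [inner_tens, real_inner_self_eq_norm_sq, norm_tens] at h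
  rcases (norm_nonneg (feat v θ)).eq_or_lt with h0 | h0
  · rw [← h0]
    positivity
  · nlinarith

lemma norm_backup_le {γ : ℝ} (hγ : 0 ≤ γ) (r : ℝ) (u : EuclideanSpace ℝ (Fin K)) :
    ‖backup γ r u‖ ≤ √γ * ‖u‖ := by
  rw [← pow_le_pow_iff_left₀ (norm_nonneg _) (by positivity) two_ne_zero, mul_pow,
    Real.sq_sqrt hγ, EuclideanSpace.real_norm_sq_eq, EuclideanSpace.real_norm_sq_eq]
  exact sum_sq_cdfBackup_mulVec hγ u

lemma norm_shift_le {γ r : ℝ} (hγ0 : 0 ≤ γ) (hγ : γ < 1) (hr : 0 ≤ r) (hr1 : r ≤ 1) :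
    ‖shift γ K r‖ ≤ √K * (1 - γ) := by
  have hg : 0 ≤ 1 - γ := by linarith
  rw [← pow_le_pow_iff_left₀ (norm_nonneg _) (by positivity) two_ne_zero, mul_pow,
    Real.sq_sqrt (Nat.cast_nonneg K), EuclideanSpace.real_norm_sq_eq]
  have h : ∀ k : Fin K, (shift γ K r k) ^ 2 ≤ (1 - γ) ^ 2 := fun k => by
    rw [← sq_abs]
    refine pow_le_pow_left₀ (abs_nonneg _) ?_ 2
    simp only [shift]
    rw [abs_mul, abs_of_nonneg (by positivity), inv_mul_le_iff₀ (by positivity)]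
    refine (abs_Cmat_mulVec_sum_gVec_sub_one_le hγ0 hγ hr hr1 k).trans ?_
    linarith
  refine (Finset.sum_le_sum fun k _ => h k).trans ?_
  simp

variable {S A : Type*}

lemma toEuclideanLin_Amat {γ : ℝ} (hγ0 : 0 ≤ γ) (hγ : γ < 1)
    (φ : S → EuclideanSpace ℝ (Fin d)) (z : S × (A × (ℝ × S))) (hr : 0 ≤ z.2.2.1)
    (θ : Param K d) :
    Matrix.toEuclideanLin (Amat γ K φ z) θ =
      tens (feat (φ z.1) θ - backup γ z.2.2.1 (feat (φ z.2.2.2) θ)) (φ z.1) := by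
  have hent : ∀ p p' : Fin K × Fin d, Amat γ K φ z p p' =
      (if p.1 = p'.1 then 1 else 0) * (φ z.1 p.2 * φ z.1 p'.2) -
        cdfBackup γ K z.2.2.1 p.1 p'.1 * (φ z.1 p.2 * φ z.2.2.2 p'.2) := fun p p' => by
    rw [← cdfBackup_eq hγ0 hγ hr, ← Matrix.one_apply]
    rfl
  ext ⟨k, i⟩
  rw [Matrix.toLpLin_apply]
  simp only [Matrix.mulVec, dotProduct, hent, Fintype.sum_prod_type, sub_mul,
    Finset.sum_sub_distrib, tens, PiLp.sub_apply, feat, backup, Finset.sum_mul, Finset.mul_sum]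
  congr 1
  · rw [Finset.sum_eq_single k]
    · simp only [if_true, one_mul]
      exact Finset.sum_congr rfl fun j _ => by ring
    · intro b _ hb
      simp [hb.symm]
    · simp
  · exact Finset.sum_congr rfl fun j _ => Finset.sum_congr rfl fun l _ => by ring

lemma bVec_eq (γ : ℝ) (φ : S → EuclideanSpace ℝ (Fin d)) (z : S × (A × (ℝ × S))) :
    bVec γ K φ z = tens (shift γ K z.2.2.1) (φ z.1) := rfl

variable [MeasurableSpace S] [MeasurableSpace A]

lemma measurable_euclidean {β ι : Type*} [MeasurableSpace β] [Fintype ι]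
    {f : β → EuclideanSpace ℝ ι} (hf : ∀ i, Measurable fun b => f b i) : Measurable f :=
  (MeasurableEquiv.toLp 2 (ι → ℝ)).measurable.comp (measurable_pi_lambda (fun b => (f b).ofLp) hf)

lemma measurable_coord {β ι : Type*} [MeasurableSpace β] [Fintype ι]
    {f : β → EuclideanSpace ℝ ι} (hf : Measurable f) (i : ι) : Measurable fun b => f b i :=
  (measurable_pi_apply i).comp ((MeasurableEquiv.toLp 2 (ι → ℝ)).symm.measurable.comp hf)

lemma measurable_gVec (γ : ℝ) (j : ℕ) (k : Fin K) : Measurable fun r => gVec γ K j r k := by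
  unfold gVec g
  fun_prop

lemma measurable_Amat (γ : ℝ) {φ : S → EuclideanSpace ℝ (Fin d)} (hφ : Measurable φ)
    (p p' : Fin K × Fin d) : Measurable fun z : S × (A × (ℝ × S)) => Amat γ K φ z p p' := by
  have hg : ∀ i j : Fin K, Measurable fun r => Gtilde γ K r i j := fun i j => by
    simp only [Gtilde, Matrix.of_apply]
    exact (measurable_gVec γ j i).sub (measurable_gVec γ K i)
  have hr : Measurable fun z : S × (A × (ℝ × S)) => z.2.2.1 := by fun_prop
  have h1 : ∀ i : Fin d, Measurable fun z : S × (A × (ℝ × S)) => φ z.1 i := fun i =>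
    (measurable_coord hφ i).comp measurable_fst
  have h2 : ∀ i : Fin d, Measurable fun z : S × (A × (ℝ × S)) => φ z.2.2.2 i := fun i =>
    (measurable_coord hφ i).comp (by fun_prop)
  simp only [Amat, Matrix.sub_apply, Matrix.kronecker, Matrix.kroneckerMap_apply,
    Matrix.vecMulVec_apply, Matrix.mul_apply]
  refine Measurable.sub (((h1 _).mul (h1 _)).const_mul _) (Measurable.mul ?_ ((h1 _).mul (h2 _)))
  refine Finset.measurable_fun_sum _ fun j _ => Measurable.mul_const ?_ _
  exact Finset.measurable_fun_sum _ fun i _ => ((hg i j).comp hr).const_mul _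

lemma measurable_toEuclideanLin_Amat (γ : ℝ) {φ : S → EuclideanSpace ℝ (Fin d)}
    (hφ : Measurable φ) :
    Measurable fun p : Param K d × (S × (A × (ℝ × S))) =>
      Matrix.toEuclideanLin (Amat γ K φ p.2) p.1 := by
  refine measurable_euclidean fun i => ?_
  simp only [Matrix.toLpLin_apply, Matrix.mulVec, dotProduct]
  refine Finset.measurable_fun_sum _ fun j _ => ?_
  exact ((measurable_Amat γ hφ i j).comp measurable_snd).mul (measurable_coord measurable_fst j)

lemma measurable_shift (γ : ℝ) : Measurable (shift γ K) := by
  refine measurable_euclidean fun k => ?_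
  simp only [shift, Matrix.mulVec, dotProduct]
  refine Measurable.const_mul ?_ _
  refine Finset.measurable_fun_sum _ fun i _ => Measurable.const_mul ?_ _
  simp only [Pi.sub_apply, Finset.sum_apply]
  exact (Finset.measurable_fun_sum _ fun j _ => measurable_gVec γ j i).sub measurable_const

lemma measurable_bVec (γ : ℝ) {φ : S → EuclideanSpace ℝ (Fin d)} (hφ : Measurable φ) :
    Measurable fun z : S × (A × (ℝ × S)) => bVec γ K φ z := by
  have hr : Measurable fun z : S × (A × (ℝ × S)) => z.2.2.1 := by fun_prop
  refine measurable_euclidean fun p => ?_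
  simp only [bVec_eq, tens]
  exact (measurable_coord ((measurable_shift γ).comp hr) p.1).mul
    ((measurable_coord hφ p.2).comp measurable_fst)

lemma measurable_feat {φ : S → EuclideanSpace ℝ (Fin d)} (hφ : Measurable φ) (θ : Param K d) :
    Measurable fun s => feat (φ s) θ := by
  refine measurable_euclidean fun k => ?_
  simp only [feat]
  exact Finset.measurable_fun_sum _ fun i _ => (measurable_coord hφ i).mul_const _

end Tensor

/-! ### Stationary sampling -/

section Sampling

variable {S A : Type*} [MeasurableSpace S] [MeasurableSpace A] {M : MDP S A} {π : Kernel S A}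
  [IsMarkovKernel π] {μ : Measure S}

instance : IsMarkovKernel (stepKernel M π) := by
  unfold stepKernel
  infer_instance

instance [IsProbabilityMeasure μ] : IsProbabilityMeasure (sampleLaw M π μ) := by
  unfold sampleLaw
  infer_instance

lemma map_fst_sampleLaw [IsProbabilityMeasure μ] : (sampleLaw M π μ).map Prod.fst = μ :=
  Measure.fst_compProd μ (stepKernel M π)

/-- By stationarity the next state of a sample also has law `μ`. -/
lemma map_next_sampleLaw [IsProbabilityMeasure μ] (hinv : (stateKernel M π).Invariant μ) :
    (sampleLaw M π μ).map (fun z => z.2.2.2) = μ := by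
  have hf : Measurable fun y : A × (ℝ × S) => y.2.2 := by fun_prop
  have h1 : (sampleLaw M π μ).map Prod.snd = μ.bind (stepKernel M π) :=
    Measure.snd_compProd μ (stepKernel M π)
  have h2 : (sampleLaw M π μ).map (fun z => z.2.2.2) =
      ((sampleLaw M π μ).map Prod.snd).map fun y : A × (ℝ × S) => y.2.2 := by
    rw [Measure.map_map hf measurable_snd]
    rfl
  rw [h2, h1, Measure.map_comp _ _ hf]
  exact hinv

omit [IsMarkovKernel π] in
lemma ae_reward_stepKernel (s : S) :
    ∀ᵐ y ∂(stepKernel M π s), y.2.1 ∈ Set.Icc (0 : ℝ) 1 := by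
  refine Kernel.ae_compProd_of_ae_ae (p := fun y : A × (ℝ × S) => y.2.1 ∈ Set.Icc (0 : ℝ) 1) ?_ ?_
  · exact measurableSet_Icc.preimage (measurable_fst.comp measurable_snd)
  · exact Filter.Eventually.of_forall fun a => M.reward_mem (s, a)

omit [IsMarkovKernel π] in
lemma ae_reward_sampleLaw [IsProbabilityMeasure μ] :
    ∀ᵐ z ∂(sampleLaw M π μ), z.2.2.1 ∈ Set.Icc (0 : ℝ) 1 := by
  refine Measure.ae_compProd_of_ae_ae
    (p := fun z : S × (A × (ℝ × S)) => z.2.2.1 ∈ Set.Icc (0 : ℝ) 1) ?_ ?_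
  · exact measurableSet_Icc.preimage
      (measurable_fst.comp (measurable_snd.comp measurable_snd))
  · exact Filter.Eventually.of_forall fun s => ae_reward_stepKernel s

lemma integral_fst_sampleLaw [IsProbabilityMeasure μ] {f : S → ℝ} (hf : Measurable f) :
    ∫ z, f z.1 ∂(sampleLaw M π μ) = ∫ s, f s ∂μ := by
  conv_rhs => rw [← map_fst_sampleLaw (M := M) (π := π) (μ := μ)]
  rw [integral_map measurable_fst.aemeasurable hf.aestronglyMeasurable]

lemma integral_next_sampleLaw [IsProbabilityMeasure μ] (hinv : (stateKernel M π).Invariant μ)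
    {f : S → ℝ} (hf : Measurable f) :
    ∫ z, f z.2.2.2 ∂(sampleLaw M π μ) = ∫ s, f s ∂μ := by
  conv_rhs => rw [← map_next_sampleLaw hinv]
  rw [integral_map (Measurable.aemeasurable (by fun_prop)) hf.aestronglyMeasurable]

end Sampling

/-! ### The covariance norm -/

section Covariance

variable {S : Type*} [MeasurableSpace S] {μ : Measure S} [IsProbabilityMeasure μ] {K d : ℕ}
  {φ : S → EuclideanSpace ℝ (Fin d)}

/-- The squared norm `‖θ‖²_{I ⊗ Σ}`, as the mean square of the linear parts of the cumulative
probabilities. -/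
noncomputable def covSq (μ : Measure S) (φ : S → EuclideanSpace ℝ (Fin d)) (θ : Param K d) : ℝ :=
  ∫ s, ‖feat (φ s) θ‖ ^ 2 ∂μ

omit [MeasurableSpace S] in
lemma norm_feat_feature_le (hφ1 : ∀ s, ‖φ s‖ ≤ 1) (θ : Param K d) (s : S) :
    ‖feat (φ s) θ‖ ≤ ‖θ‖ :=
  (norm_feat_le _ _).trans (mul_le_of_le_one_left (norm_nonneg _) (hφ1 s))

lemma integrable_sq_feat (hφ : Measurable φ) (hφ1 : ∀ s, ‖φ s‖ ≤ 1) (θ : Param K d) :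
    Integrable (fun s => ‖feat (φ s) θ‖ ^ 2) μ :=
  integrable_sq_norm_of_ae_le (measurable_feat hφ θ)
    (Filter.Eventually.of_forall (norm_feat_feature_le hφ1 θ))

omit [IsProbabilityMeasure μ] in
lemma covSq_nonneg (θ : Param K d) : 0 ≤ covSq μ φ θ := integral_nonneg fun _ => sq_nonneg _

lemma covSq_le (hφ : Measurable φ) (hφ1 : ∀ s, ‖φ s‖ ≤ 1) (θ : Param K d) :
    covSq μ φ θ ≤ ‖θ‖ ^ 2 := by
  calc covSq μ φ θ ≤ ∫ _, ‖θ‖ ^ 2 ∂μ :=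
        integral_mono (integrable_sq_feat hφ hφ1 θ) (integrable_const _) fun s =>
          pow_le_pow_left₀ (norm_nonneg _) (norm_feat_feature_le hφ1 θ s) 2
    _ = ‖θ‖ ^ 2 := by simp

lemma covSq_add_le (hφ : Measurable φ) (hφ1 : ∀ s, ‖φ s‖ ≤ 1) (θ₁ θ₂ : Param K d) :
    covSq μ φ (θ₁ + θ₂) ≤ 2 * covSq μ φ θ₁ + 2 * covSq μ φ θ₂ := by
  simp only [covSq, feat_add]
  exact integral_sq_norm_add_le (measurable_feat hφ θ₁) (measurable_feat hφ θ₂)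
    (Filter.Eventually.of_forall (norm_feat_feature_le hφ1 θ₁))
    (Filter.Eventually.of_forall (norm_feat_feature_le hφ1 θ₂))

omit [MeasurableSpace S] in
lemma abs_feature_le (hφ1 : ∀ s, ‖φ s‖ ≤ 1) (s : S) (i : Fin d) : |φ s i| ≤ 1 :=
  (PiLp.norm_apply_le (φ s) i).trans (hφ1 s)

lemma integrable_feature_mul (hφ : Measurable φ) (hφ1 : ∀ s, ‖φ s‖ ≤ 1) (i j : Fin d) :
    Integrable (fun s => φ s i * φ s j) μ := by
  refine Integrable.of_bound (C := 1)
    ((measurable_coord hφ i).mul (measurable_coord hφ j)).aestronglyMeasurable ?_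
  refine Filter.Eventually.of_forall fun s => ?_
  rw [norm_mul, Real.norm_eq_abs, Real.norm_eq_abs]
  exact mul_le_one₀ (abs_feature_le hφ1 s i) (abs_nonneg _) (abs_feature_le hφ1 s j)

lemma dotProduct_featureCov (hφ : Measurable φ) (hφ1 : ∀ s, ‖φ s‖ ≤ 1) (v : Fin d → ℝ) :
    dotProduct v ((featureCov μ φ).mulVec v) = ∫ s, (∑ i, φ s i * v i) ^ 2 ∂μ := by
  have h : ∀ s, (∑ i, φ s i * v i) ^ 2 = ∑ i, ∑ j, (v i * v j) * (φ s i * φ s j) := fun s => by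
    rw [sq, Finset.sum_mul_sum]
    exact Finset.sum_congr rfl fun i _ => Finset.sum_congr rfl fun j _ => by ring
  simp_rw [h]
  rw [integral_finsetSum _ fun i _ => integrable_finsetSum _ fun j _ =>
    (integrable_feature_mul hφ hφ1 i j).const_mul _]
  simp only [dotProduct, Matrix.mulVec, Finset.mul_sum]
  refine Finset.sum_congr rfl fun i _ => ?_
  rw [integral_finsetSum _ fun j _ => (integrable_feature_mul hφ hφ1 i j).const_mul _]
  refine Finset.sum_congr rfl fun j _ => ?_
  rw [integral_const_mul, featureCov, Matrix.of_apply]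
  ring

lemma covSq_eq_sum (hφ : Measurable φ) (hφ1 : ∀ s, ‖φ s‖ ≤ 1) (θ : Param K d) :
    covSq μ φ θ =
      ∑ k, dotProduct (fun i => θ (k, i)) ((featureCov μ φ).mulVec fun i => θ (k, i)) := by
  simp_rw [dotProduct_featureCov hφ hφ1]
  rw [← integral_finsetSum]
  · simp only [covSq, EuclideanSpace.real_norm_sq_eq, feat]
  · intro k _
    refine Integrable.of_bound (C := ‖θ‖ ^ 2) ?_ (Filter.Eventually.of_forall fun s => ?_)
    · exact (((measurable_coord (measurable_feat hφ θ) k)).pow_const 2).aestronglyMeasurable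
    · rw [Real.norm_of_nonneg (sq_nonneg _), ← sq_abs]
      exact pow_le_pow_left₀ (abs_nonneg _)
        ((PiLp.norm_apply_le (feat (φ s) θ) k).trans (norm_feat_feature_le hφ1 θ s)) 2

lemma normCov_eq (hφ : Measurable φ) (hφ1 : ∀ s, ‖φ s‖ ≤ 1) (θ : Param K d) :
    normCov (featureCov μ φ) θ = √(covSq μ φ θ) := by
  rw [normCov, covSq_eq_sum hφ hφ1]
  congr 1
  simp only [dotProduct, Matrix.mulVec, Fintype.sum_prod_type, Matrix.kronecker,
    Matrix.kroneckerMap_apply, Matrix.one_apply]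
  refine Finset.sum_congr rfl fun k _ => Finset.sum_congr rfl fun i _ => ?_
  congr 1
  rw [Finset.sum_eq_single k]
  · simp
  · intro b _ hb
    simp [hb.symm]
  · simp

omit [IsProbabilityMeasure μ] in
lemma lamMin_mul_le (v : Fin d → ℝ) :
    lamMin μ φ * dotProduct v v ≤ dotProduct v ((featureCov μ φ).mulVec v) := by
  have hH : (featureCov μ φ).IsHermitian := by
    ext i j
    simp [featureCov, mul_comm]
  have hS : (featureCov μ φ - algebraMap ℝ _ (lamMin μ φ)).PosSemidef := by
    rw [Matrix.posSemidef_iff_isHermitian_and_spectrum_nonneg]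
    refine ⟨hH.sub ?_, ?_⟩
    · rw [Matrix.algebraMap_eq_diagonal]
      exact Matrix.isHermitian_diagonal _
    · rw [← spectrum.sub_singleton_eq]
      rintro _ ⟨x, hx, y, hy, rfl⟩
      rw [Set.mem_singleton_iff] at hy
      subst hy
      have hb : BddBelow (spectrum ℝ (featureCov μ φ)) := by
        rw [hH.spectrum_real_eq_range_eigenvalues]
        exact (Set.finite_range _).bddBelow
      exact sub_nonneg.mpr (csInf_le hb hx)
  have h := hS.dotProduct_mulVec_nonneg v
  rw [Matrix.sub_mulVec, dotProduct_sub] at h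
  have h2 : (algebraMap ℝ (Matrix (Fin d) (Fin d) ℝ) (lamMin μ φ)).mulVec v =
      lamMin μ φ • v := by
    rw [Algebra.algebraMap_eq_smul_one, Matrix.smul_mulVec, Matrix.one_mulVec]
  rw [h2, dotProduct_smul, smul_eq_mul] at h
  simp only [star_trivial] at h
  linarith

lemma lamMin_mul_le_covSq (hφ : Measurable φ) (hφ1 : ∀ s, ‖φ s‖ ≤ 1) (θ : Param K d) :
    lamMin μ φ * ‖θ‖ ^ 2 ≤ covSq μ φ θ := by
  rw [covSq_eq_sum hφ hφ1, EuclideanSpace.real_norm_sq_eq, Fintype.sum_prod_type, Finset.mul_sum]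
  refine Finset.sum_le_sum fun k _ => ?_
  refine le_trans (le_of_eq ?_) (lamMin_mul_le (μ := μ) (φ := φ) fun i => θ (k, i))
  simp only [dotProduct, sq]

/-- In dimension zero the spectrum is empty and `lamMin` is the junk value `sInf ∅ = 0`. -/
lemma lamMin_le_one (hφ : Measurable φ) (hφ1 : ∀ s, ‖φ s‖ ≤ 1) : lamMin μ φ ≤ 1 := by
  rcases Nat.eq_zero_or_pos d with hd | hd
  · subst hd
    have : spectrum ℝ (featureCov μ φ) = ∅ := spectrum.of_subsingleton _
    rw [lamMin, this, Real.sInf_empty]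
    exact zero_le_one
  · set θ : Param 1 d := EuclideanSpace.single (0, ⟨0, hd⟩) 1 with hθ
    have h1 : ‖θ‖ = 1 := by simp [hθ]
    have h2 := (lamMin_mul_le_covSq (μ := μ) hφ hφ1 θ).trans (covSq_le hφ hφ1 θ)
    rw [h1] at h2
    linarith

end Covariance

/-! ### Cumulative distribution functions of linear-categorical families -/

section Cdf

variable {S : Type*} {K d : ℕ} {γ : ℝ} {φ : S → EuclideanSpace ℝ (Fin d)}

lemma supportPt_nonneg (hγ : γ < 1) (j : ℕ) : 0 ≤ supportPt γ K j := by
  have : 0 < 1 - γ := by linarith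
  unfold supportPt gap
  positivity

lemma supportPt_last (hγ : γ < 1) (hK : 0 < K) : supportPt γ K K = (1 - γ)⁻¹ := by
  have : (0 : ℝ) < K := by exact_mod_cast hK
  have : 0 < 1 - γ := by linarith
  unfold supportPt gap
  field_simp

lemma supportPt_succ (k : ℕ) : supportPt γ K (k + 1) = supportPt γ K k + gap γ K := by
  unfold supportPt
  push_cast
  ring

lemma supportPt_mono (hγ : γ < 1) (hK : 0 < K) : Monotone (supportPt γ K) :=
  monotone_nat_of_le_succ fun k => by
    rw [supportPt_succ]
    linarith [gap_pos hγ hK]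

lemma cumProb_of_lt (θ : Param K d) (s : S) {k : ℕ} (hk : k < K) :
    cumProb φ θ s k = feat (φ s) θ ⟨k, hk⟩ + ((k : ℝ) + 1) / ((K : ℝ) + 1) := by
  simp [cumProb, hk, feat]

lemma cumProb_last (θ : Param K d) (s : S) : cumProb φ θ s K = 1 := by simp [cumProb]

/-- Summation by parts against the masses `F j - F (j - 1)`. -/
lemma sum_increment_mul (F c : ℕ → ℝ) (n : ℕ) :
    ∑ j ∈ Finset.range (n + 1), (F j - if j = 0 then 0 else F (j - 1)) * c j =
      F n * c n + ∑ j ∈ Finset.range n, F j * (c j - c (j + 1)) := by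
  induction n with
  | zero => simp
  | succ n ih =>
    rw [Finset.sum_range_succ, ih, Finset.sum_range_succ _ n]
    simp only [Nat.add_one_ne_zero, if_false, Nat.add_sub_cancel]
    ring

lemma sum_massProb_mul (θ : Param K d) (s : S) (c : ℕ → ℝ) :
    ∑ j ∈ Finset.range (K + 1), massProb φ θ s j * c j =
      c K + ∑ j ∈ Finset.range K, cumProb φ θ s j * (c j - c (j + 1)) := by
  have h := sum_increment_mul (cumProb φ θ s) c K
  rw [cumProb_last, one_mul] at h
  exact h

/-- The projected backup of `η_θ(s')` in CDF coordinates is affine in the linear part of `θ`. -/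
lemma sum_massProb_mul_ramp (hγ0 : 0 ≤ γ) (hγ : γ < 1) {r : ℝ} (hr : 0 ≤ r) (θ : Param K d)
    (s : S) (k : Fin K) :
    ∑ j ∈ Finset.range (K + 1), massProb φ θ s j * ramp ((k : ℕ) + 1 - gridPos γ K r j) =
      backup γ r (feat (φ s) θ) k + shift γ K r k + ((k : ℕ) + 1) / ((K : ℝ) + 1) := by
  set c : ℕ → ℝ := fun j => ramp ((k : ℕ) + 1 - gridPos γ K r j) with hc
  have hK1 : (K : ℝ) + 1 ≠ 0 := by positivity
  have h1 : ∑ j ∈ Finset.range K, cumProb φ θ s j * (c j - c (j + 1)) =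
      backup γ r (feat (φ s) θ) k +
        ∑ j ∈ Finset.range K, ((j : ℝ) + 1) / ((K : ℝ) + 1) * (c j - c (j + 1)) := by
    rw [← Fin.sum_univ_eq_sum_range (fun j => cumProb φ θ s j * (c j - c (j + 1))),
      ← Fin.sum_univ_eq_sum_range (fun j => ((j : ℝ) + 1) / ((K : ℝ) + 1) * (c j - c (j + 1)))]
    simp only [backup, Matrix.mulVec, dotProduct, cdfBackup, Matrix.of_apply]
    rw [← Finset.sum_add_distrib]
    refine Finset.sum_congr rfl fun j _ => ?_
    rw [cumProb_of_lt θ s j.2]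
    simp only [hc]
    ring
  have h2 : ((K : ℝ) + 1)⁻¹ * ∑ j ∈ Finset.range (K + 1), c j =
      c K + ∑ j ∈ Finset.range K, ((j : ℝ) + 1) / ((K : ℝ) + 1) * (c j - c (j + 1)) := by
    have h := sum_increment_mul (fun j => ((j : ℝ) + 1) / ((K : ℝ) + 1)) c K
    rw [div_self hK1, one_mul] at h
    rw [← h, Finset.mul_sum]
    refine Finset.sum_congr rfl fun j _ => ?_
    congr 1
    rcases j with _ | j
    · simp
    · simp only [Nat.add_one_ne_zero, if_false, Nat.add_sub_cancel]
      push_cast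
      field_simp
      ring
  have h3 : shift γ K r k = ((K : ℝ) + 1)⁻¹ *
      (∑ j ∈ Finset.range (K + 1), c j - ((k : ℕ) + 1)) := by
    simp only [shift]
    rw [Cmat_mulVec_sum_gVec_sub_one hγ0 hγ hr k]
  rw [sum_massProb_mul θ s c, h1, h3, mul_sub, h2]
  field_simp
  ring

lemma eta_apply (θ : Param K d) (s : S) {B : Set ℝ} (hB : MeasurableSet B) [DecidablePred (· ∈ B)] :
    eta γ φ θ s B = ∑ j ∈ Finset.range (K + 1),
      massProb φ θ s j * if supportPt γ K j ∈ B then 1 else 0 := by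
  rw [eta, FunLike.coe_sum, Finset.sum_apply]
  refine Finset.sum_congr rfl fun j _ => ?_
  change massProb φ θ s j * (Measure.dirac (supportPt γ K j)).toSignedMeasure B = _
  rw [Measure.toSignedMeasure_apply_measurable hB, measureReal_def, Measure.dirac_apply' _ hB,
    Set.indicator_apply]
  split_ifs <;> simp

lemma cdfAt_eta (hγ : γ < 1) (θ : Param K d) (s : S) (x : ℝ) :
    cdfAt (eta γ φ θ s) x = ∑ j ∈ Finset.range (K + 1),
      massProb φ θ s j * if supportPt γ K j ≤ x then 1 else 0 := by
  classical
  rw [cdfAt, eta_apply θ s measurableSet_Icc]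
  refine Finset.sum_congr rfl fun j _ => ?_
  simp [supportPt_nonneg hγ j]

/-- On the `k`-th cell of the grid the CDF of `η_θ(s)` is `F_k(s; θ)`. -/
lemma cdfAt_eta_of_mem (hγ : γ < 1) (θ : Param K d) (s : S) {k : ℕ} (hk : k < K) {x : ℝ}
    (hx : x ∈ Set.Ioo (supportPt γ K k) (supportPt γ K (k + 1))) :
    cdfAt (eta γ φ θ s) x = cumProb φ θ s k := by
  have hK : 0 < K := by omega
  have hm := supportPt_mono hγ hK
  have hle : ∀ j, supportPt γ K j ≤ x ↔ j ≤ k := fun j => by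
    constructor
    · intro h
      by_contra hj
      exact absurd (h.trans_lt hx.2) (not_lt.mpr (hm (by omega)))
    · intro h
      exact (hm h).trans hx.1.le
  rw [cdfAt_eta hγ, sum_massProb_mul θ s fun j => if supportPt γ K j ≤ x then (1 : ℝ) else 0]
  simp only [hle]
  rw [if_neg (by omega), zero_add, Finset.sum_eq_single k]
  · simp
  · intro j _ hj
    rcases lt_or_gt_of_ne hj with h | h
    · rw [if_pos (by omega), if_pos (by omega)]
      ring
    · rw [if_neg (by omega), if_neg (by omega)]
      ring
  · intro h
    exact absurd (Finset.mem_range.mpr hk) h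

/-- Integration over `[0, (1 - γ)⁻¹]` cell by cell. -/
lemma integral_eq_sum_cells (hγ : γ < 1) (hK : 0 < K) {f : ℝ → ℝ} {h : ℕ → ℝ → ℝ}
    (hint : ∀ k < K, IntervalIntegrable (h k) volume (supportPt γ K k) (supportPt γ K (k + 1)))
    (heq : ∀ k < K, ∀ x ∈ Set.Ioo (supportPt γ K k) (supportPt γ K (k + 1)), f x = h k x) :
    ∫ x in (0 : ℝ)..(1 - γ)⁻¹, f x =
      ∑ k ∈ Finset.range K, ∫ x in (supportPt γ K k)..(supportPt γ K (k + 1)), h k x := by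
  have hm : ∀ k, supportPt γ K k ≤ supportPt γ K (k + 1) := fun k =>
    supportPt_mono hγ hK (Nat.le_succ k)
  have h0 : supportPt γ K 0 = 0 := by simp [supportPt]
  have hf : ∀ k < K, IntervalIntegrable f volume (supportPt γ K k) (supportPt γ K (k + 1)) := by
    intro k hk
    have h1 := hint k hk
    rw [intervalIntegrable_iff_integrableOn_Ioo_of_le (hm k)] at h1 ⊢
    exact h1.congr_fun (fun x hx => (heq k hk x hx).symm) measurableSet_Ioo
  rw [← supportPt_last hγ hK, ← h0, ← intervalIntegral.sum_integral_adjacent_intervals hf]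
  refine Finset.sum_congr rfl fun k hk => ?_
  exact intervalIntegral.integral_congr_Ioo_of_le (hm k)
    fun x hx => heq k (Finset.mem_range.mp hk) x hx

lemma integral_cell_indicator {a b y : ℝ} (hab : a ≤ b) (hy : 0 ≤ y) :
    IntervalIntegrable (fun x => if y ∈ Set.Icc 0 x then (1 : ℝ) else 0) volume a b ∧
    ∫ x in a..b, (if y ∈ Set.Icc 0 x then (1 : ℝ) else 0) = max 0 (min (b - a) (b - y)) := by
  have hiff : ∀ x, y ∈ Set.Icc 0 x ↔ y ≤ x := fun x => by simp [hy]
  simp only [hiff]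
  have hii : ∀ u v : ℝ, IntervalIntegrable (fun x => if y ≤ x then (1 : ℝ) else 0) volume u v := by
    intro u v
    refine (intervalIntegrable_const (c := (1 : ℝ))).mono_fun ?_ ?_
    · exact (Measurable.ite measurableSet_Ici measurable_const
        measurable_const).aestronglyMeasurable
    · refine Filter.Eventually.of_forall fun x => ?_
      dsimp only
      split_ifs <;> simp
  refine ⟨hii a b, ?_⟩
  have hone : ∀ u v : ℝ, u ≤ v → y ≤ u →
      ∫ x in u..v, (if y ≤ x then (1 : ℝ) else 0) = v - u := fun u v huv hyu => by
    rw [intervalIntegral.integral_congr_Ioo_of_le (g := fun _ => (1 : ℝ)) huv fun x hx =>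
      if_pos (hyu.trans hx.1.le)]
    simp
  have hzero : ∀ u v : ℝ, u ≤ v → v ≤ y →
      ∫ x in u..v, (if y ≤ x then (1 : ℝ) else 0) = 0 := fun u v huv hvy => by
    rw [intervalIntegral.integral_congr_Ioo_of_le (g := fun _ => (0 : ℝ)) huv fun x hx =>
      if_neg (not_le.mpr (hx.2.trans_le hvy))]
    simp
  rcases le_total y a with h1 | h1
  · rw [hone a b hab h1, min_eq_left (by linarith), max_eq_right (by linarith)]
  · rcases le_total b y with h2 | h2
    · rw [hzero a b hab h2, min_eq_right (by linarith), max_eq_left (by linarith)]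
    · rw [← intervalIntegral.integral_add_adjacent_intervals (hii a y) (hii y b),
        hzero a y h1 le_rfl, hone y b h2 le_rfl, min_eq_right (by linarith),
        max_eq_right (by linarith), zero_add]

/-- The hat-function weights are the cell averages of the CDF of a shifted point mass. -/
lemma integral_cell_backup_indicator (hγ0 : 0 ≤ γ) (hγ : γ < 1) (hK : 0 < K) {r : ℝ} (hr : 0 ≤ r)
    (j k : ℕ) :
    ∫ x in (supportPt γ K k)..(supportPt γ K (k + 1)),
      (if r + γ * supportPt γ K j ∈ Set.Icc 0 x then (1 : ℝ) else 0) =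
      gap γ K * ramp (k + 1 - gridPos γ K r j) := by
  have hg := gap_pos hγ hK
  have hy : 0 ≤ r + γ * supportPt γ K j :=
    add_nonneg hr (mul_nonneg hγ0 (supportPt_nonneg hγ j))
  rw [(integral_cell_indicator (by rw [supportPt_succ]; linarith) hy).2, supportPt_succ,
    add_sub_cancel_left, ramp, mul_max_of_nonneg _ _ hg.le, mul_min_of_nonneg _ _ hg.le, mul_zero,
    mul_one]
  congr 2
  unfold gridPos supportPt
  field_simp

end Cdf

/-! ### The loss -/

section Loss

variable {S : Type*} [MeasurableSpace S] {μ : Measure S} [IsProbabilityMeasure μ] {K d : ℕ}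
  {γ : ℝ} {φ : S → EuclideanSpace ℝ (Fin d)}

omit [MeasurableSpace S] in
lemma wasserstein_eta (hγ : γ < 1) (hK : 0 < K) (θ₁ θ₂ : Param K d) (s : S) :
    wasserstein γ (eta γ φ θ₁ s) (eta γ φ θ₂ s) =
      gap γ K * ∑ k, |feat (φ s) (θ₁ - θ₂) k| := by
  rw [wasserstein, integral_eq_sum_cells hγ hK
    (h := fun k _ => |cumProb φ θ₁ s k - cumProb φ θ₂ s k|) (fun k _ => intervalIntegrable_const)
    (fun k hk x hx => by rw [cdfAt_eta_of_mem hγ θ₁ s hk hx, cdfAt_eta_of_mem hγ θ₂ s hk hx])]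
  rw [← Fin.sum_univ_eq_sum_range (fun k => ∫ _ in (supportPt γ K k)..(supportPt γ K (k + 1)),
    |cumProb φ θ₁ s k - cumProb φ θ₂ s k|), Finset.mul_sum]
  refine Finset.sum_congr rfl fun k _ => ?_
  rw [intervalIntegral.integral_const, supportPt_succ, add_sub_cancel_left, smul_eq_mul,
    cumProb_of_lt θ₁ s k.2, cumProb_of_lt θ₂ s k.2, feat_sub]
  congr 2
  simp only [PiLp.sub_apply]
  ring

/-- The `W₁` loss is at most the covariance norm of the parameter error, in units of
`√K (1 - γ)`. -/
lemma loss_le (hγ : γ < 1) (hK : 0 < K) (hφ : Measurable φ) (hφ1 : ∀ s, ‖φ s‖ ≤ 1)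
    (θ₁ θ₂ : Param K d) :
    loss γ μ φ θ₁ θ₂ ≤ √(covSq μ φ (θ₂ - θ₁)) / (√K * (1 - γ)) := by
  have hg : 0 < 1 - γ := by linarith
  have hK' : (0 : ℝ) < K := by exact_mod_cast hK
  have hsq : ∀ s, wasserstein γ (eta γ φ θ₁ s) (eta γ φ θ₂ s) ^ 2 ≤
      (K * (1 - γ) ^ 2)⁻¹ * ‖feat (φ s) (θ₂ - θ₁)‖ ^ 2 := fun s => by
    have hn : ‖feat (φ s) (θ₂ - θ₁)‖ ^ 2 = ∑ k, |feat (φ s) (θ₁ - θ₂) k| ^ 2 := by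
      rw [← norm_neg, EuclideanSpace.real_norm_sq_eq]
      refine Finset.sum_congr rfl fun k _ => ?_
      rw [sq_abs, feat_sub, feat_sub, neg_sub]
    have hcs := sq_sum_le_card_mul_sum_sq (s := Finset.univ)
      (f := fun k => |feat (φ s) (θ₁ - θ₂) k|)
    rw [Finset.card_univ, Fintype.card_fin] at hcs
    rw [wasserstein_eta hγ hK, mul_pow, hn]
    calc gap γ K ^ 2 * (∑ k, |feat (φ s) (θ₁ - θ₂) k|) ^ 2
        ≤ gap γ K ^ 2 * (K * ∑ k, |feat (φ s) (θ₁ - θ₂) k| ^ 2) := by gcongr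
      _ = _ := by
        unfold gap
        field_simp
  rw [loss, wassersteinDist]
  have hint := integrable_sq_feat (μ := μ) hφ hφ1 (θ₂ - θ₁)
  have hle : ∫ s, wasserstein γ (eta γ φ θ₁ s) (eta γ φ θ₂ s) ^ 2 ∂μ ≤
      (K * (1 - γ) ^ 2)⁻¹ * covSq μ φ (θ₂ - θ₁) := by
    rw [covSq, ← integral_const_mul]
    exact integral_mono_of_nonneg (Filter.Eventually.of_forall fun s => sq_nonneg _)
      (hint.const_mul _) (Filter.Eventually.of_forall hsq)
  refine (Real.sqrt_le_sqrt hle).trans (le_of_eq ?_)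
  rw [Real.sqrt_mul (by positivity), Real.sqrt_inv, Real.sqrt_mul hK'.le, Real.sqrt_sq hg.le]
  field_simp

end Loss

/-! ### The projected Bellman equation as a linear system -/

/-- First-order optimality of a least-squares problem along a line. -/
lemma integral_mul_eq_zero_of_forall_le {β : Type*} [MeasurableSpace β] {ρ : Measure β}
    [IsFiniteMeasure ρ] {G ψ : β → ℝ} (hG : Measurable G) (hψ : Measurable ψ) {a b : ℝ}
    (ha : ∀ p, |G p| ≤ a) (hb : ∀ p, |ψ p| ≤ b)
    (hmin : ∀ h : ℝ, ∫ p, G p ^ 2 ∂ρ ≤ ∫ p, (G p - h * ψ p) ^ 2 ∂ρ) :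
    ∫ p, G p * ψ p ∂ρ = 0 := by
  have hi1 : Integrable (fun p => G p ^ 2) ρ := by
    refine Integrable.of_bound (C := a ^ 2) (by fun_prop) (Filter.Eventually.of_forall fun p => ?_)
    rw [Real.norm_of_nonneg (sq_nonneg _), ← sq_abs]
    exact pow_le_pow_left₀ (abs_nonneg _) (ha p) 2
  have hi2 : Integrable (fun p => ψ p ^ 2) ρ := by
    refine Integrable.of_bound (C := b ^ 2) (by fun_prop) (Filter.Eventually.of_forall fun p => ?_)
    rw [Real.norm_of_nonneg (sq_nonneg _), ← sq_abs]
    exact pow_le_pow_left₀ (abs_nonneg _) (hb p) 2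
  have hi3 : Integrable (fun p => G p * ψ p) ρ := by
    refine Integrable.of_bound (C := a * b) (by fun_prop)
      (Filter.Eventually.of_forall fun p => ?_)
    rw [norm_mul]
    exact mul_le_mul (ha p) (hb p) (abs_nonneg _) ((abs_nonneg _).trans (ha p))
  set B := ∫ p, G p * ψ p ∂ρ with hB
  set C := ∫ p, ψ p ^ 2 ∂ρ with hC
  have hC0 : 0 ≤ C := integral_nonneg fun p => sq_nonneg _
  have hq : ∀ h : ℝ, 2 * h * B ≤ h ^ 2 * C := fun h => by
    have h1 := hmin h
    have h2 : ∀ p, (G p - h * ψ p) ^ 2 = (G p ^ 2 - 2 * h * (G p * ψ p)) + h ^ 2 * ψ p ^ 2 :=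
      fun p => by ring
    have hi4 : Integrable (fun p => G p ^ 2 - 2 * h * (G p * ψ p)) ρ := hi1.sub (hi3.const_mul _)
    simp_rw [h2] at h1
    rw [integral_add hi4 (hi2.const_mul _), integral_sub hi1 (hi3.const_mul _),
      integral_const_mul, integral_const_mul] at h1
    linarith
  have h3 := hq (B / (C + 1))
  have hC1 : 0 < C + 1 := by linarith
  have h4 : 2 * (B / (C + 1)) * B = 2 * B ^ 2 * (C + 1) / (C + 1) ^ 2 := by field_simp
  have h5 : (B / (C + 1)) ^ 2 * C = B ^ 2 * C / (C + 1) ^ 2 := by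
    rw [div_pow, div_mul_eq_mul_div]
  rw [h4, h5, div_le_div_iff_of_pos_right (by positivity)] at h3
  have h6 : B ^ 2 = 0 := le_antisymm (by nlinarith [sq_nonneg B]) (sq_nonneg B)
  simpa using h6

section CdfMeasurability

variable {S A : Type*} {K d : ℕ} {γ : ℝ} {φ : S → EuclideanSpace ℝ (Fin d)}

/-- The CDF of `η_θ(s)` as a function of both variables. -/
noncomputable def etaCdf (γ : ℝ) (φ : S → EuclideanSpace ℝ (Fin d)) (θ : Param K d) (s : S)
    (x : ℝ) : ℝ :=
  ∑ j ∈ Finset.range (K + 1), massProb φ θ s j * if supportPt γ K j ≤ x then 1 else 0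

/-- The CDF of the backup `(b_{r,γ})_# η_θ(s')` for the sample `y = (a, r, s')`. -/
noncomputable def backupCdf (γ : ℝ) (φ : S → EuclideanSpace ℝ (Fin d)) (θ : Param K d)
    (y : A × (ℝ × S)) (x : ℝ) : ℝ :=
  ∑ j ∈ Finset.range (K + 1), massProb φ θ y.2.2 j *
    if y.2.1 + γ * supportPt γ K j ∈ Set.Icc 0 x then 1 else 0

lemma massProb_add_smul (θ u : Param K d) (h : ℝ) (s : S) (k : ℕ) :
    massProb φ (θ + h • u) s k - massProb φ θ s k =
      h * (massProb φ (θ + u) s k - massProb φ θ s k) := by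
  have hc : ∀ k, cumProb φ (θ + h • u) s k - cumProb φ θ s k =
      h * (cumProb φ (θ + u) s k - cumProb φ θ s k) := fun k => by
    by_cases hk : k < K
    · simp only [cumProb_of_lt _ _ hk, feat_add, feat_smul, PiLp.add_apply, PiLp.smul_apply,
        smul_eq_mul]
      ring
    · simp [cumProb, hk]
  unfold massProb
  by_cases hk : k = 0
  · simp only [hk, if_true, sub_zero]
    exact hc 0
  · simp only [hk, if_false]
    linarith [hc k, hc (k - 1)]

lemma etaCdf_add_smul (θ u : Param K d) (h : ℝ) (s : S) (x : ℝ) :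
    etaCdf γ φ (θ + h • u) s x = etaCdf γ φ θ s x +
      h * (etaCdf γ φ (θ + u) s x - etaCdf γ φ θ s x) := by
  unfold etaCdf
  rw [← Finset.sum_sub_distrib, Finset.mul_sum, ← Finset.sum_add_distrib]
  refine Finset.sum_congr rfl fun j _ => ?_
  have := massProb_add_smul (φ := φ) θ u h s j
  rw [← sub_mul, ← mul_assoc, ← this]
  ring

lemma abs_cumProb_le (hφ1 : ∀ s, ‖φ s‖ ≤ 1) (θ : Param K d) (s : S) (k : ℕ) :
    |cumProb φ θ s k| ≤ ‖θ‖ + 1 := by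
  by_cases hk : k < K
  · rw [cumProb_of_lt θ s hk]
    have hk' : (k : ℝ) ≤ K := by exact_mod_cast hk.le
    refine (abs_add_le _ _).trans (add_le_add ?_ ?_)
    · exact (PiLp.norm_apply_le (feat (φ s) θ) ⟨k, hk⟩).trans (norm_feat_feature_le hφ1 θ s)
    · rw [abs_of_nonneg (by positivity), div_le_one (by positivity)]
      linarith
  · simp [cumProb, hk]

lemma abs_massProb_le (hφ1 : ∀ s, ‖φ s‖ ≤ 1) (θ : Param K d) (s : S) (k : ℕ) :
    |massProb φ θ s k| ≤ 2 * (‖θ‖ + 1) := by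
  unfold massProb
  split_ifs with h
  · rw [sub_zero]
    linarith [abs_cumProb_le hφ1 θ s k, norm_nonneg θ]
  · linarith [abs_sub (cumProb φ θ s k) (cumProb φ θ s (k - 1)), abs_cumProb_le hφ1 θ s k,
      abs_cumProb_le hφ1 θ s (k - 1)]

lemma abs_sum_massProb_mul_le (hφ1 : ∀ s, ‖φ s‖ ≤ 1) (θ : Param K d) (s : S) {c : ℕ → ℝ}
    (hc : ∀ j, |c j| ≤ 1) :
    |∑ j ∈ Finset.range (K + 1), massProb φ θ s j * c j| ≤ (K + 1) * (2 * (‖θ‖ + 1)) := by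
  refine (Finset.abs_sum_le_sum_abs _ _).trans ?_
  refine (Finset.sum_le_card_nsmul _ _ (2 * (‖θ‖ + 1)) fun j _ => ?_).trans (le_of_eq ?_)
  · rw [abs_mul]
    exact (mul_le_of_le_one_right (abs_nonneg _) (hc j)).trans (abs_massProb_le hφ1 θ s j)
  · rw [Finset.card_range, nsmul_eq_mul]
    push_cast
    ring

lemma abs_etaCdf_le (hφ1 : ∀ s, ‖φ s‖ ≤ 1) (θ : Param K d) (s : S) (x : ℝ) :
    |etaCdf γ φ θ s x| ≤ (K + 1) * (2 * (‖θ‖ + 1)) :=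
  abs_sum_massProb_mul_le hφ1 θ s fun j => by split_ifs <;> simp

lemma abs_backupCdf_le (hφ1 : ∀ s, ‖φ s‖ ≤ 1) (θ : Param K d) (y : A × (ℝ × S)) (x : ℝ) :
    |backupCdf γ φ θ y x| ≤ (K + 1) * (2 * (‖θ‖ + 1)) :=
  abs_sum_massProb_mul_le hφ1 θ y.2.2 fun j => by split_ifs <;> simp

variable [MeasurableSpace S] [MeasurableSpace A]

lemma measurable_cumProb (hφ : Measurable φ) (θ : Param K d) (k : ℕ) :
    Measurable fun s => cumProb φ θ s k := by
  by_cases hk : k < K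
  · simp only [cumProb_of_lt _ _ hk]
    exact (measurable_coord (measurable_feat hφ θ) _).add_const _
  · simp only [cumProb, hk, dif_neg, not_false_iff]
    exact measurable_const

lemma measurable_massProb (hφ : Measurable φ) (θ : Param K d) (k : ℕ) :
    Measurable fun s => massProb φ θ s k := by
  unfold massProb
  refine (measurable_cumProb hφ θ k).sub ?_
  split_ifs
  · exact measurable_const
  · exact measurable_cumProb hφ θ _

lemma measurable_etaCdf (hφ : Measurable φ) (θ : Param K d) :
    Measurable fun p : S × ℝ => etaCdf γ φ θ p.1 p.2 := by
  unfold etaCdf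
  refine Finset.measurable_fun_sum _ fun j _ => ?_
  refine ((measurable_massProb hφ θ j).comp measurable_fst).mul
    (Measurable.ite ?_ measurable_const measurable_const)
  exact measurableSet_le measurable_const measurable_snd

lemma measurable_backupCdf (hφ : Measurable φ) (θ : Param K d) :
    Measurable fun p : (A × (ℝ × S)) × ℝ => backupCdf γ φ θ p.1 p.2 := by
  unfold backupCdf
  refine Finset.measurable_fun_sum _ fun j _ => ?_
  have h1 : Measurable fun p : (A × (ℝ × S)) × ℝ => p.1.2.2 := by fun_prop
  have h2 : Measurable fun p : (A × (ℝ × S)) × ℝ => p.1.2.1 := by fun_prop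
  refine ((measurable_massProb hφ θ j).comp h1).mul
    (Measurable.ite ?_ measurable_const measurable_const)
  simp only [Set.mem_Icc]
  exact (measurableSet_le measurable_const (h2.add_const _)).inter
    (measurableSet_le (h2.add_const _) measurable_snd)

end CdfMeasurability

section NormalEquation

attribute [local irreducible] etaCdf backupCdf

variable {S A : Type*} [MeasurableSpace S] [MeasurableSpace A] {M : MDP S A} {π : Kernel S A}
  [IsMarkovKernel π] {μ : Measure S} [IsProbabilityMeasure μ] {K d : ℕ}
  {φ : S → EuclideanSpace ℝ (Fin d)}

/-- The stochastic gradient `A(z) θ - b(z)` of Linear-CTD at the sample `z`. -/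
noncomputable def ctdNoise (γ : ℝ) (φ : S → EuclideanSpace ℝ (Fin d)) (θ : Param K d)
    (z : S × (A × (ℝ × S))) : Param K d :=
  Matrix.toEuclideanLin (Amat γ K φ z) θ - bVec γ K φ z

omit [MeasurableSpace S] [MeasurableSpace A] in
lemma ctdNoise_eq {γ : ℝ} (hγ0 : 0 ≤ γ) (hγ : γ < 1) (θ : Param K d) (z : S × (A × (ℝ × S)))
    (hr : 0 ≤ z.2.2.1) :
    ctdNoise γ φ θ z = tens (feat (φ z.1) θ - backup γ z.2.2.1 (feat (φ z.2.2.2) θ) -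
      shift γ K z.2.2.1) (φ z.1) := by
  rw [ctdNoise, toEuclideanLin_Amat hγ0 hγ φ z hr, bVec_eq]
  ext p
  simp only [tens, PiLp.sub_apply]
  ring

lemma measurable_ctdNoise {γ : ℝ} (hφ : Measurable φ) (θ : Param K d) :
    Measurable (ctdNoise (A := A) γ φ θ) :=
  ((measurable_toEuclideanLin_Amat γ hφ).comp measurable_prodMk_left).sub (measurable_bVec γ hφ)

omit [MeasurableSpace S] [MeasurableSpace A] in
lemma norm_ctdNoise_le {γ : ℝ} (hγ0 : 0 ≤ γ) (hγ : γ < 1) (hφ1 : ∀ s, ‖φ s‖ ≤ 1)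
    (θ : Param K d) (z : S × (A × (ℝ × S))) (hr : z.2.2.1 ∈ Set.Icc (0 : ℝ) 1) :
    ‖ctdNoise γ φ θ z‖ ≤ 2 * ‖θ‖ + √K * (1 - γ) := by
  rw [ctdNoise_eq hγ0 hγ θ z hr.1, norm_tens]
  refine (mul_le_of_le_one_right (norm_nonneg _) (hφ1 z.1)).trans ?_
  refine (norm_sub_le _ _).trans (add_le_add ((norm_sub_le _ _).trans ?_)
    (norm_shift_le hγ0 hγ hr.1 hr.2))
  have h1 := norm_feat_feature_le hφ1 θ z.1
  have h2 := norm_feat_feature_le hφ1 θ z.2.2.2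
  have h3 := norm_backup_le hγ0 z.2.2.1 (feat (φ z.2.2.2) θ)
  have h4 : √γ * ‖feat (φ z.2.2.2) θ‖ ≤ ‖feat (φ z.2.2.2) θ‖ :=
    mul_le_of_le_one_left (norm_nonneg _) (Real.sqrt_le_one.mpr hγ.le)
  linarith

omit [IsMarkovKernel π] in
lemma cdfAt_bellman (θ : Param K d) (s : S) (x : ℝ) :
    cdfAt (bellman M π (eta M.γ φ θ) s) x =
      ∫ y, backupCdf M.γ φ θ y x ∂(stepKernel M π s) := by
  classical
  rw [cdfAt, bellman]
  refine integral_congr_ae (Filter.Eventually.of_forall fun y => ?_)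
  have hm : Measurable fun x : ℝ => y.2.1 + M.γ * x := by fun_prop
  change (eta M.γ φ θ y.2.2).map (fun x : ℝ => y.2.1 + M.γ * x) (Set.Icc 0 x) = _
  rw [VectorMeasure.map_apply _ hm measurableSet_Icc,
    eta_apply θ y.2.2 (hm measurableSet_Icc)]
  change _ = backupCdf M.γ φ θ y x
  rw [backupCdf]
  refine Finset.sum_congr rfl fun j _ => ?_
  simp only [Set.mem_preimage]

omit [MeasurableSpace S] [MeasurableSpace A] in
/-- Integrating the CDF residual of one sample against a change of the parameter gives the
corresponding component of the stochastic gradient. -/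
lemma integral_residual_mul {γ : ℝ} (hγ0 : 0 ≤ γ) (hγ : γ < 1) (hK : 0 < K) (θ u : Param K d)
    (s : S) (y : A × (ℝ × S)) (hr : 0 ≤ y.2.1) :
    ∫ x in (0 : ℝ)..(1 - γ)⁻¹, (backupCdf γ φ θ y x - etaCdf γ φ θ s x) *
      (etaCdf γ φ (θ + u) s x - etaCdf γ φ θ s x) =
      -(gap γ K * inner ℝ u (ctdNoise γ φ θ (s, y))) := by
  have hm : ∀ k, supportPt γ K k ≤ supportPt γ K (k + 1) := fun k =>
    supportPt_mono hγ hK (Nat.le_succ k)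
  have hpos : ∀ j, 0 ≤ y.2.1 + γ * supportPt γ K j := fun j =>
    add_nonneg hr (mul_nonneg hγ0 (supportPt_nonneg hγ j))
  have hterm : ∀ k j, IntervalIntegrable (fun x => massProb φ θ y.2.2 j *
      if y.2.1 + γ * supportPt γ K j ∈ Set.Icc 0 x then (1 : ℝ) else 0) volume
      (supportPt γ K k) (supportPt γ K (k + 1)) := fun k j =>
    (integral_cell_indicator (hm k) (hpos j)).1.const_mul _
  have hcell : ∀ k, IntervalIntegrable (fun x => backupCdf γ φ θ y x) volume
      (supportPt γ K k) (supportPt γ K (k + 1)) := fun k => by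
    have := IntervalIntegrable.sum (Finset.range (K + 1)) (fun j _ => hterm k j)
    exact this.congr fun x _ => by simp [backupCdf]
  have hcellv : ∀ k, ∫ x in (supportPt γ K k)..(supportPt γ K (k + 1)), backupCdf γ φ θ y x =
      gap γ K * ∑ j ∈ Finset.range (K + 1),
        massProb φ θ y.2.2 j * ramp (k + 1 - gridPos γ K y.2.1 j) := fun k => by
    simp only [backupCdf]
    rw [intervalIntegral.integral_finsetSum fun j _ => hterm k j, Finset.mul_sum]
    refine Finset.sum_congr rfl fun j _ => ?_
    rw [intervalIntegral.integral_const_mul, integral_cell_backup_indicator hγ0 hγ hK hr]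
    ring
  rw [integral_eq_sum_cells hγ hK
    (h := fun k x => (backupCdf γ φ θ y x - cumProb φ θ s k) *
      (cumProb φ (θ + u) s k - cumProb φ θ s k))
    (fun k _ => ((hcell k).sub intervalIntegrable_const).mul_const _)
    (fun k hk x hx => by
      have h1 : ∀ θ' : Param K d, etaCdf γ φ θ' s x = cumProb φ θ' s k := fun θ' => by
        rw [← cdfAt_eta_of_mem hγ θ' s hk hx, cdfAt_eta hγ, etaCdf]
      rw [h1, h1])]
  rw [← Fin.sum_univ_eq_sum_range (fun k => ∫ x in (supportPt γ K k)..(supportPt γ K (k + 1)),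
    (backupCdf γ φ θ y x - cumProb φ θ s k) * (cumProb φ (θ + u) s k - cumProb φ θ s k))]
  rw [ctdNoise_eq hγ0 hγ θ (s, y) hr, inner_tens, PiLp.inner_apply, Finset.mul_sum,
    ← Finset.sum_neg_distrib]
  refine Finset.sum_congr rfl fun k _ => ?_
  rw [intervalIntegral.integral_mul_const, intervalIntegral.integral_sub (hcell k)
    intervalIntegrable_const, hcellv, intervalIntegral.integral_const, supportPt_succ,
    add_sub_cancel_left, smul_eq_mul, sum_massProb_mul_ramp hγ0 hγ hr θ y.2.2 k,
    cumProb_of_lt θ s k.2, cumProb_of_lt (θ + u) s k.2, feat_add]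
  simp only [PiLp.add_apply, PiLp.sub_apply, RCLike.inner_apply, conj_trivial]
  ring

/-- The CDF of `T η_θ` minus that of `η_θ`. -/
noncomputable def bellmanResidual (M : MDP S A) (π : Kernel S A)
    (φ : S → EuclideanSpace ℝ (Fin d)) (θ : Param K d) (p : S × ℝ) : ℝ :=
  ∫ y, backupCdf M.γ φ θ y p.2 ∂(stepKernel M π p.1) - etaCdf M.γ φ θ p.1 p.2

/-- The change of the CDF of `η_θ` when `θ` is moved by `u`. -/
noncomputable def cdfChange (γ : ℝ) (φ : S → EuclideanSpace ℝ (Fin d)) (θ u : Param K d)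
    (p : S × ℝ) : ℝ :=
  etaCdf γ φ (θ + u) p.1 p.2 - etaCdf γ φ θ p.1 p.2

lemma measurable_bellmanResidual (hφ : Measurable φ) (θ : Param K d) :
    Measurable (bellmanResidual M π φ θ) := by
  have hm := measurable_backupCdf (γ := M.γ) (A := A) hφ θ
  have hp : Measurable fun q : (S × ℝ) × (A × (ℝ × S)) => (q.2, q.1.2) := by fun_prop
  have hbm : Measurable (Function.uncurry fun (p : S × ℝ) (y : A × (ℝ × S)) =>
      backupCdf M.γ φ θ y p.2) := hm.comp hp
  have := StronglyMeasurable.integral_kernel_prod_right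
    (κ := (stepKernel M π).prodMkRight ℝ)
    (f := fun (p : S × ℝ) (y : A × (ℝ × S)) => backupCdf M.γ φ θ y p.2) hbm.stronglyMeasurable
  exact this.measurable.sub (measurable_etaCdf hφ θ)

lemma abs_bellmanResidual_le (hφ1 : ∀ s, ‖φ s‖ ≤ 1) (θ : Param K d) (p : S × ℝ) :
    |bellmanResidual M π φ θ p| ≤ 2 * ((K + 1) * (2 * (‖θ‖ + 1))) := by
  have h1 : |∫ y, backupCdf M.γ φ θ y p.2 ∂(stepKernel M π p.1)| ≤
      (K + 1) * (2 * (‖θ‖ + 1)) := by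
    have h := norm_integral_le_of_norm_le_const (μ := stepKernel M π p.1)
      (f := fun y => backupCdf M.γ φ θ y p.2) (C := (K + 1) * (2 * (‖θ‖ + 1)))
      (Filter.Eventually.of_forall fun y => abs_backupCdf_le (γ := M.γ) hφ1 θ y p.2)
    rwa [probReal_univ, mul_one, Real.norm_eq_abs] at h
  have h2 := abs_etaCdf_le (γ := M.γ) hφ1 θ p.1 p.2
  refine (abs_sub _ _).trans ?_
  linarith

omit [MeasurableSpace A] in
lemma measurable_cdfChange {γ : ℝ} (hφ : Measurable φ) (θ u : Param K d) :
    Measurable (cdfChange γ φ θ u) :=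
  (measurable_etaCdf hφ _).sub (measurable_etaCdf hφ _)

omit [MeasurableSpace S] [MeasurableSpace A] in
lemma abs_cdfChange_le {γ : ℝ} (hφ1 : ∀ s, ‖φ s‖ ≤ 1) (θ u : Param K d) (p : S × ℝ) :
    |cdfChange γ φ θ u p| ≤
      (K + 1) * (2 * (‖θ + u‖ + 1)) + (K + 1) * (2 * (‖θ‖ + 1)) :=
  (abs_sub _ _).trans (add_le_add (abs_etaCdf_le hφ1 _ _ _) (abs_etaCdf_le hφ1 _ _ _))

/-- The objective of the projection along a line, as one integral over states and returns. -/
lemma cramerDist_bellman_eq (hφ : Measurable φ) (hφ1 : ∀ s, ‖φ s‖ ≤ 1) (θ u : Param K d) (h : ℝ) :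
    cramerDist M.γ μ (bellman M π (eta M.γ φ θ)) (fun s => eta M.γ φ (θ + h • u) s) =
      √(∫ p, (bellmanResidual M π φ θ p - h * cdfChange M.γ φ θ u p) ^ 2
        ∂(μ.prod ((volume : Measure ℝ).restrict (Set.Ioc 0 (1 - M.γ)⁻¹)))) := by
  have hγ := M.γ_lt_one
  have hR : (0 : ℝ) ≤ (1 - M.γ)⁻¹ := inv_nonneg.mpr (by linarith)
  have hm1 := measurable_bellmanResidual (M := M) (π := π) hφ θ
  have hm2 := measurable_cdfChange (γ := M.γ) hφ θ u
  have hint : Integrable (fun p => (bellmanResidual M π φ θ p - h * cdfChange M.γ φ θ u p) ^ 2)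
      (μ.prod ((volume : Measure ℝ).restrict (Set.Ioc 0 (1 - M.γ)⁻¹))) := by
    refine Integrable.of_bound (C := (2 * ((K + 1) * (2 * (‖θ‖ + 1))) + |h| *
      ((K + 1) * (2 * (‖θ + u‖ + 1)) + (K + 1) * (2 * (‖θ‖ + 1)))) ^ 2)
      ((hm1.sub (hm2.const_mul h)).pow_const 2).aestronglyMeasurable
      (Filter.Eventually.of_forall fun p => ?_)
    rw [Real.norm_of_nonneg (sq_nonneg _), ← sq_abs]
    refine pow_le_pow_left₀ (abs_nonneg _) ((abs_sub _ _).trans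
      (add_le_add (abs_bellmanResidual_le hφ1 θ p) ?_)) 2
    rw [abs_mul]
    exact mul_le_mul_of_nonneg_left (abs_cdfChange_le hφ1 θ u p) (abs_nonneg _)
  rw [cramerDist, integral_prod _ hint]
  congr 1
  refine integral_congr_ae (Filter.Eventually.of_forall fun s => ?_)
  simp only [cramerSq]
  rw [intervalIntegral.integral_of_le hR]
  refine integral_congr_ae (Filter.Eventually.of_forall fun x => ?_)
  have h1 : cdfAt (eta M.γ φ (θ + h • u) s) x = etaCdf M.γ φ (θ + h • u) s x := by
    rw [cdfAt_eta hγ, etaCdf]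
  simp only [cdfAt_bellman, h1, etaCdf_add_smul, bellmanResidual, cdfChange]
  ring

/-- Exchanging the integrals over returns and over samples. -/
lemma integral_bellmanResidual_mul (hK : 0 < K) (hφ : Measurable φ) (hφ1 : ∀ s, ‖φ s‖ ≤ 1)
    (θ u : Param K d) (s : S) :
    ∫ x, bellmanResidual M π φ θ (s, x) * cdfChange M.γ φ θ u (s, x)
      ∂((volume : Measure ℝ).restrict (Set.Ioc 0 (1 - M.γ)⁻¹)) =
    ∫ y, -(gap M.γ K * inner ℝ u (ctdNoise M.γ φ θ (s, y))) ∂(stepKernel M π s) := by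
  have hγ0 := M.γ_pos.le
  have hγ := M.γ_lt_one
  have hR : (0 : ℝ) ≤ (1 - M.γ)⁻¹ := inv_nonneg.mpr (by linarith)
  have hm := measurable_backupCdf (γ := M.γ) (A := A) hφ θ
  have hm' := measurable_etaCdf (γ := M.γ) hφ θ
  have hm'' := measurable_cdfChange (γ := M.γ) hφ θ u
  have h1 : ∀ x, bellmanResidual M π φ θ (s, x) * cdfChange M.γ φ θ u (s, x) =
      ∫ y, (backupCdf M.γ φ θ y x - etaCdf M.γ φ θ s x) *
        cdfChange M.γ φ θ u (s, x) ∂(stepKernel M π s) := fun x => by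
    have hbi : Integrable (fun y => backupCdf M.γ φ θ y x) (stepKernel M π s) :=
      Integrable.of_bound (C := (K + 1) * (2 * (‖θ‖ + 1)))
        (hm.comp measurable_prodMk_right).aestronglyMeasurable
        (Filter.Eventually.of_forall fun y => abs_backupCdf_le hφ1 θ y x)
    rw [integral_mul_const, integral_sub hbi (integrable_const _), integral_const, probReal_univ,
      one_smul, bellmanResidual]
  have hswap : Integrable (Function.uncurry fun (x : ℝ) (y : A × (ℝ × S)) =>
      (backupCdf M.γ φ θ y x - etaCdf M.γ φ θ s x) * cdfChange M.γ φ θ u (s, x))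
      (((volume : Measure ℝ).restrict (Set.Ioc 0 (1 - M.γ)⁻¹)).prod (stepKernel M π s)) := by
    refine Integrable.of_bound (C := 2 * ((K + 1) * (2 * (‖θ‖ + 1))) *
      ((K + 1) * (2 * (‖θ + u‖ + 1)) + (K + 1) * (2 * (‖θ‖ + 1)))) ?_
      (Filter.Eventually.of_forall fun p => ?_)
    · refine Measurable.aestronglyMeasurable (Measurable.mul (Measurable.sub ?_ ?_) ?_)
      · exact hm.comp (measurable_snd.prodMk measurable_fst)
      · exact hm'.comp (measurable_const.prodMk measurable_fst)
      · exact hm''.comp (measurable_const.prodMk measurable_fst)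
    · simp only [Function.uncurry]
      rw [norm_mul]
      refine mul_le_mul ?_ (abs_cdfChange_le hφ1 θ u _) (abs_nonneg _) (by positivity)
      refine (abs_sub _ _).trans ?_
      linarith [abs_backupCdf_le (γ := M.γ) hφ1 θ p.2 p.1, abs_etaCdf_le (γ := M.γ) hφ1 θ s p.1]
  simp_rw [h1]
  rw [integral_integral_swap hswap]
  refine integral_congr_ae ((ae_reward_stepKernel s).mono fun y hy => ?_)
  have := integral_residual_mul (φ := φ) hγ0 hγ hK θ u s y hy.1
  rw [intervalIntegral.integral_of_le hR] at this
  exact this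

lemma integrable_ctdNoise (hφ : Measurable φ) (hφ1 : ∀ s, ‖φ s‖ ≤ 1) (θ : Param K d) :
    Integrable (ctdNoise M.γ φ θ) (sampleLaw M π μ) :=
  Integrable.of_bound (measurable_ctdNoise hφ θ).aestronglyMeasurable
    (2 * ‖θ‖ + √K * (1 - M.γ)) (ae_reward_sampleLaw.mono fun z hz =>
      norm_ctdNoise_le M.γ_pos.le M.γ_lt_one hφ1 θ z hz)

/-- The first-order condition of the projected Bellman equation: `E[A] θ⋆ = E[b]`. -/
lemma integral_ctdNoise_eq_zero (hK : 0 < K) (hφ : Measurable φ) (hφ1 : ∀ s, ‖φ s‖ ≤ 1)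
    {θ : Param K d} (hθ : IsProjectedBellmanSolution M π μ φ θ) :
    ∫ z, ctdNoise M.γ φ θ z ∂(sampleLaw M π μ) = 0 := by
  have hγ := M.γ_lt_one
  have hgap := gap_pos hγ hK
  have hnint := integrable_ctdNoise (M := M) (π := π) (μ := μ) hφ hφ1 θ
  have hvolf : IsFiniteMeasure ((volume : Measure ℝ).restrict (Set.Ioc 0 (1 - M.γ)⁻¹)) :=
    ⟨by simp⟩
  have key : ∀ u : Param K d, ∫ z, inner ℝ u (ctdNoise M.γ φ θ z) ∂(sampleLaw M π μ) = 0 := by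
    intro u
    have hG := measurable_bellmanResidual (M := M) (π := π) hφ θ
    have hψ := measurable_cdfChange (γ := M.γ) hφ θ u
    have hGb := abs_bellmanResidual_le (M := M) (π := π) (φ := φ) hφ1 θ
    have hψb := abs_cdfChange_le (γ := M.γ) (φ := φ) hφ1 θ u
    have hmin : ∀ h : ℝ, ∫ p, bellmanResidual M π φ θ p ^ 2
        ∂(μ.prod ((volume : Measure ℝ).restrict (Set.Ioc 0 (1 - M.γ)⁻¹))) ≤
        ∫ p, (bellmanResidual M π φ θ p - h * cdfChange M.γ φ θ u p) ^ 2
        ∂(μ.prod ((volume : Measure ℝ).restrict (Set.Ioc 0 (1 - M.γ)⁻¹))) := by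
      intro h
      have h1 := hθ (θ + h • u)
      have h0 := cramerDist_bellman_eq (M := M) (π := π) (μ := μ) hφ hφ1 θ u 0
      rw [zero_smul, add_zero] at h0
      rw [h0, cramerDist_bellman_eq hφ hφ1 θ u h,
        Real.sqrt_le_sqrt_iff (integral_nonneg fun p => sq_nonneg _)] at h1
      simpa using h1
    have hzero := integral_mul_eq_zero_of_forall_le hG hψ hGb hψb hmin
    have hGψ : Integrable (fun p => bellmanResidual M π φ θ p * cdfChange M.γ φ θ u p)
        (μ.prod ((volume : Measure ℝ).restrict (Set.Ioc 0 (1 - M.γ)⁻¹))) := by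
      refine Integrable.of_bound (C := 2 * ((K + 1) * (2 * (‖θ‖ + 1))) *
        ((K + 1) * (2 * (‖θ + u‖ + 1)) + (K + 1) * (2 * (‖θ‖ + 1))))
        (hG.mul hψ).aestronglyMeasurable
        (Filter.Eventually.of_forall fun p => ?_)
      rw [norm_mul]
      exact mul_le_mul (hGb p) (hψb p) (abs_nonneg _) (by positivity)
    rw [integral_prod _ hGψ] at hzero
    simp_rw [integral_bellmanResidual_mul hK hφ hφ1 θ u] at hzero
    have hci : Integrable (fun z => -(gap M.γ K * inner ℝ u (ctdNoise M.γ φ θ z)))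
        (μ.compProd (stepKernel M π)) := ((hnint.const_inner u).const_mul _).neg
    rw [← Measure.integral_compProd hci, integral_neg, integral_const_mul, neg_eq_zero,
      mul_eq_zero] at hzero
    exact hzero.resolve_left hgap.ne'
  have h := key (∫ z, ctdNoise M.γ φ θ z ∂(sampleLaw M π μ))
  rwa [integral_inner hnint, inner_self_eq_zero] at h

end NormalEquation

/-! ### Linear-CTD as linear stochastic approximation -/

section Model

variable {S A : Type*} [MeasurableSpace S] [MeasurableSpace A] {M : MDP S A} {π : Kernel S A}
  [IsMarkovKernel π] {μ : Measure S} [IsProbabilityMeasure μ] {K d : ℕ}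
  {φ : S → EuclideanSpace ℝ (Fin d)}

omit [MeasurableSpace S] [MeasurableSpace A] in
lemma norm_toEuclideanLin_Amat_le {γ : ℝ} (hγ0 : 0 ≤ γ) (hγ : γ < 1) (hφ1 : ∀ s, ‖φ s‖ ≤ 1)
    (θ : Param K d) (z : S × (A × (ℝ × S))) (hr : 0 ≤ z.2.2.1) :
    ‖Matrix.toEuclideanLin (Amat γ K φ z) θ‖ ≤
      ‖feat (φ z.1) θ‖ + ‖feat (φ z.2.2.2) θ‖ := by
  rw [toEuclideanLin_Amat hγ0 hγ φ z hr, norm_tens]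
  refine (mul_le_of_le_one_right (norm_nonneg _) (hφ1 z.1)).trans ((norm_sub_le _ _).trans ?_)
  refine add_le_add le_rfl ((norm_backup_le hγ0 _ _).trans ?_)
  exact mul_le_of_le_one_left (norm_nonneg _) (Real.sqrt_le_one.mpr hγ.le)

/-- Stationarity makes both the current and the next features contribute the same covariance norm,
so the nonexpansive factor `√γ` of the backup leaves a coercivity constant `1 - √γ`. -/
lemma isLSAModel_ctd (hinv : (stateKernel M π).Invariant μ) (hK : 0 < K) (hφ : Measurable φ)
    (hφ1 : ∀ s, ‖φ s‖ ≤ 1) (hlam : 0 < lamMin μ φ) {θ : Param K d}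
    (hθ : IsProjectedBellmanSolution M π μ φ θ) {s v : ℝ} (hs : s = √K * (1 - M.γ))
    (hv : √(covSq μ φ θ) = s * v) :
    IsLSAModel (sampleLaw M π μ) (fun z => Matrix.toEuclideanLin (Amat M.γ K φ z))
      (ctdNoise M.γ φ θ) (covSq μ φ) (1 - √M.γ) (lamMin μ φ) (3 * (s * (v + 1)))
      (2 * (s * (v + 1)) / √(lamMin μ φ)) := by
  have hγ0 := M.γ_pos.le
  have hγ := M.γ_lt_one
  have hK' : (0 : ℝ) < K := by exact_mod_cast hK
  have hs0 : 0 < s := by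
    rw [hs]
    exact mul_pos (Real.sqrt_pos.mpr hK') (by linarith)
  have hv0 : 0 ≤ v := by
    have : 0 ≤ s * v := by rw [← hv]; positivity
    exact nonneg_of_mul_nonneg_right this hs0
  have hlam1 : lamMin μ φ ≤ 1 := lamMin_le_one hφ hφ1
  have hsl : 0 < √(lamMin μ φ) := Real.sqrt_pos.mpr hlam
  have hsl1 : √(lamMin μ φ) ≤ 1 := Real.sqrt_le_one.mpr hlam1
  have hsγ : √M.γ < 1 := by
    rw [← Real.sqrt_one]
    exact Real.sqrt_lt_sqrt hγ0 hγ
  have hfm := fun x : Param K d => (measurable_feat hφ x).norm.pow_const 2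
  have hi1 : ∀ x : Param K d, Integrable (fun z : S × (A × (ℝ × S)) => ‖feat (φ z.1) x‖ ^ 2)
      (sampleLaw M π μ) := fun x =>
    integrable_sq_norm_of_ae_le ((measurable_feat hφ x).comp measurable_fst)
      (Filter.Eventually.of_forall fun z => norm_feat_feature_le hφ1 x z.1)
  have hi2 : ∀ x : Param K d, Integrable (fun z : S × (A × (ℝ × S)) => ‖feat (φ z.2.2.2) x‖ ^ 2)
      (sampleLaw M π μ) := fun x =>
    integrable_sq_norm_of_ae_le ((measurable_feat hφ x).comp (by fun_prop))
      (Filter.Eventually.of_forall fun z => norm_feat_feature_le hφ1 x z.2.2.2)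
  have hv1 : ∀ x : Param K d, ∫ z, ‖feat (φ z.1) x‖ ^ 2 ∂(sampleLaw M π μ) = covSq μ φ x :=
    fun x => integral_fst_sampleLaw (hfm x)
  have hv2 : ∀ x : Param K d, ∫ z, ‖feat (φ z.2.2.2) x‖ ^ 2 ∂(sampleLaw M π μ) = covSq μ φ x :=
    fun x => integral_next_sampleLaw hinv (hfm x)
  have hmA := measurable_toEuclideanLin_Amat (S := S) (A := A) (K := K) M.γ hφ
  have hAle : ∀ᵐ z ∂(sampleLaw M π μ), ∀ x : Param K d,
      ‖Matrix.toEuclideanLin (Amat M.γ K φ z) x‖ ≤ 2 * ‖x‖ := by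
    filter_upwards [ae_reward_sampleLaw (M := M) (π := π) (μ := μ)] with z hz x
    refine (norm_toEuclideanLin_Amat_le hγ0 hγ hφ1 x z hz.1).trans ?_
    linarith [norm_feat_feature_le hφ1 x z.1, norm_feat_feature_le hφ1 x z.2.2.2]
  have hsq : ∀ x : Param K d,
      ∫ z, ‖Matrix.toEuclideanLin (Amat M.γ K φ z) x‖ ^ 2 ∂(sampleLaw M π μ) ≤
        4 * covSq μ φ x := fun x => by
    have h1 : ∫ z, ‖Matrix.toEuclideanLin (Amat M.γ K φ z) x‖ ^ 2 ∂(sampleLaw M π μ) ≤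
        ∫ z, (2 * ‖feat (φ z.1) x‖ ^ 2 + 2 * ‖feat (φ z.2.2.2) x‖ ^ 2) ∂(sampleLaw M π μ) := by
      refine integral_mono_of_nonneg (Filter.Eventually.of_forall fun z => sq_nonneg _)
        (((hi1 x).const_mul 2).add ((hi2 x).const_mul 2)) ?_
      filter_upwards [ae_reward_sampleLaw (M := M) (π := π) (μ := μ)] with z hz
      have h := pow_le_pow_left₀ (norm_nonneg _)
        (norm_toEuclideanLin_Amat_le hγ0 hγ hφ1 x z hz.1) 2
      refine h.trans ?_
      nlinarith [sq_nonneg (‖feat (φ z.1) x‖ - ‖feat (φ z.2.2.2) x‖)]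
    rw [integral_add ((hi1 x).const_mul 2) ((hi2 x).const_mul 2), integral_const_mul,
      integral_const_mul, hv1, hv2] at h1
    linarith
  have hcov : covSq μ φ θ = (s * v) ^ 2 := by rw [← hv, Real.sq_sqrt (covSq_nonneg θ)]
  have hshift : ∀ᵐ z ∂(sampleLaw M π μ), ‖bVec M.γ K φ z‖ ≤ s := by
    filter_upwards [ae_reward_sampleLaw (M := M) (π := π) (μ := μ)] with z hz
    rw [bVec_eq, norm_tens, hs]
    exact (mul_le_of_le_one_right (norm_nonneg _) (hφ1 z.1)).trans
      (norm_shift_le hγ0 hγ hz.1 hz.2)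
  refine
    { κ_pos := by linarith
      lam_pos := hlam
      B_nonneg := by positivity
      measurable_op := hmA
      measurable_noise := measurable_ctdNoise hφ θ
      norm_op := hAle
      drift := fun x => ?_
      sq_op := hsq
      le_N := lamMin_mul_le_covSq hφ hφ1
      N_le := covSq_le hφ hφ1
      N_add := covSq_add_le hφ hφ1
      norm_noise := ?_
      mean_noise := integral_ctdNoise_eq_zero hK hφ hφ1 hθ
      sq_noise := ?_ }
  · have hlow : Integrable (fun z : S × (A × (ℝ × S)) => (1 - √M.γ / 2) * ‖feat (φ z.1) x‖ ^ 2 -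
        √M.γ / 2 * ‖feat (φ z.2.2.2) x‖ ^ 2) (sampleLaw M π μ) :=
      ((hi1 x).const_mul _).sub ((hi2 x).const_mul _)
    have hupi : Integrable (fun z => inner ℝ x (Matrix.toEuclideanLin (Amat M.γ K φ z) x))
        (sampleLaw M π μ) :=
      (Integrable.of_bound (hmA.comp measurable_prodMk_left).aestronglyMeasurable (2 * ‖x‖)
        (hAle.mono fun z hz => hz x)).const_inner x
    have h1 := integral_mono_ae hlow hupi (by
      filter_upwards [ae_reward_sampleLaw (M := M) (π := π) (μ := μ)] with z hz
      rw [toEuclideanLin_Amat hγ0 hγ φ z hz.1, inner_tens, inner_sub_right,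
        real_inner_self_eq_norm_sq]
      have h2 := (real_inner_le_norm (feat (φ z.1) x) _).trans (mul_le_mul_of_nonneg_left
        (norm_backup_le hγ0 z.2.2.1 (feat (φ z.2.2.2) x)) (norm_nonneg _))
      have h3 := mul_nonneg (Real.sqrt_nonneg M.γ)
        (sq_nonneg (‖feat (φ z.1) x‖ - ‖feat (φ z.2.2.2) x‖))
      nlinarith)
    rw [integral_sub ((hi1 x).const_mul _) ((hi2 x).const_mul _), integral_const_mul,
      integral_const_mul, hv1, hv2] at h1
    refine le_trans (le_of_eq ?_) h1
    ring
  · filter_upwards [ae_reward_sampleLaw (M := M) (π := π) (μ := μ)] with z hz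
    refine (norm_ctdNoise_le hγ0 hγ hφ1 θ z hz).trans ?_
    rw [← hs, le_div_iff₀ hsl]
    have h1 : √(lamMin μ φ) * ‖θ‖ ≤ s * v := by
      rw [← hv, ← Real.sqrt_sq (norm_nonneg θ), ← Real.sqrt_mul hlam.le]
      exact Real.sqrt_le_sqrt (lamMin_mul_le_covSq hφ hφ1 θ)
    nlinarith
  · have hb2 : ∫ z, ‖-bVec M.γ K φ z‖ ^ 2 ∂(sampleLaw M π μ) ≤ s ^ 2 := by
      have := integral_mono_of_nonneg (μ := sampleLaw M π μ) (f := fun z => ‖-bVec M.γ K φ z‖ ^ 2)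
        (g := fun _ => s ^ 2) (Filter.Eventually.of_forall fun z => sq_nonneg _)
        (integrable_const _) (hshift.mono fun z hz => by
          simp only [norm_neg]
          exact pow_le_pow_left₀ (norm_nonneg _) hz 2)
      simpa using this
    have hmAθ := hmA.comp (measurable_prodMk_left (x := θ))
    simp only [Function.comp_def] at hmAθ
    have hmb : Measurable fun z : S × (A × (ℝ × S)) => -bVec M.γ K φ z :=
      (measurable_bVec (S := S) (A := A) (K := K) M.γ hφ).neg
    have h1 := integral_sq_norm_add_le (ν := sampleLaw M π μ) hmAθ hmb
      (hAle.mono fun z hz => hz θ) (hshift.mono fun z hz => by rwa [norm_neg])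
    simp only [← sub_eq_add_neg] at h1
    have h2 := hsq θ
    rw [hcov] at h2
    refine h1.trans ?_
    nlinarith [mul_nonneg (sq_nonneg s) hv0, sq_nonneg s, sq_nonneg (s * v)]

omit [MeasurableSpace S] [MeasurableSpace A] in
/-- The error of Linear-CTD follows the linear stochastic approximation recursion. -/
lemma ctdIterate_sub_eq_chain {Ω : Type*} (γ α : ℝ) (θ θ₀ : Param K d)
    (X : ℕ → Ω → S × (A × (ℝ × S))) (ω : Ω) (t : ℕ) :
    ctdIterate γ K φ α θ₀ X t ω - θ =
      chain (noisyStep (fun z => Matrix.toEuclideanLin (Amat γ K φ z)) (ctdNoise γ φ θ) α)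
        (θ₀ - θ) X t ω := by
  induction t with
  | zero => rfl
  | succ t ih =>
    simp only [chain, ← ih, noisyStep, ctdIterate, ctdNoise, map_sub]
    rw [sub_right_comm]
    congr 2
    abel

omit [MeasurableSpace S] [MeasurableSpace A] in
lemma tailAverage_sub_eq {Ω : Type*} (γ α : ℝ) (θ θ₀ : Param K d)
    (X : ℕ → Ω → S × (A × (ℝ × S))) (ω : Ω) (n : ℕ) :
    tailAverage γ K φ α θ₀ X (2 * n) ω - θ = ((n : ℝ) + 1)⁻¹ • ∑ t ∈ Finset.Icc n (2 * n),
      chain (noisyStep (fun z => Matrix.toEuclideanLin (Amat γ K φ z)) (ctdNoise γ φ θ) α)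
        (θ₀ - θ) X t ω := by
  have hn : (n : ℝ) + 1 ≠ 0 := by positivity
  have hcard : (Finset.Icc n (2 * n)).card = n + 1 := by
    rw [Nat.card_Icc]
    omega
  have h1 : (((2 * n : ℕ) : ℝ) / 2 + 1) = (n : ℝ) + 1 := by
    push_cast
    ring
  have h2 : 2 * n / 2 = n := by omega
  simp only [← ctdIterate_sub_eq_chain, tailAverage, h1, h2]
  rw [Finset.sum_sub_distrib, Finset.sum_const, hcard, smul_sub, ← Nat.cast_smul_eq_nsmul ℝ,
    smul_smul]
  push_cast
  rw [inv_mul_cancel₀ hn, one_smul]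

end Model

/-! ### Choice of constants -/

/-- Bernoulli's inequality turns `exp (-x) ≤ (1 + y)⁻ᶜ` into a bound for `exp (-x) * y`. -/
lemma exists_mul_log_le_imp_mul_exp_neg_le {M : ℝ} (hM : 1 ≤ M) :
    ∃ c : ℝ, 0 < c ∧ ∀ y x : ℝ, 0 ≤ y → c * Real.log (1 + y) ≤ x →
      M * (Real.exp (-x) * y) ≤ 1 / 2 := by
  obtain ⟨k, hk⟩ := exists_nat_ge (4 * M ^ 2)
  refine ⟨k + 1, by positivity, fun y x hy hx => ?_⟩
  have hx0 : 0 ≤ x := le_trans (by have := Real.log_nonneg (by linarith : 1 ≤ 1 + y); positivity) hx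
  by_cases hyM : 2 * M * y ≤ 1
  · have : Real.exp (-x) ≤ 1 := Real.exp_le_one_iff.mpr (by linarith)
    nlinarith [mul_le_mul_of_nonneg_left (mul_le_of_le_one_left hy this) (by linarith : 0 ≤ M)]
  · push Not at hyM
    have h1 : (1 + y) ^ (k + 1) ≤ Real.exp x := by
      rw [← Real.exp_log (by linarith : 0 < 1 + y), ← Real.exp_nat_mul]
      exact Real.exp_le_exp.mpr (by push_cast; exact hx)
    have h2 : 1 + (k : ℝ) * y ≤ (1 + y) ^ k := one_add_mul_le_pow (by linarith) k
    have h3 : 2 * M * y ≤ Real.exp x := by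
      refine le_trans ?_ h1
      rw [pow_succ]
      have h4 : 2 * M ≤ (1 + y) ^ k := by
        refine le_trans ?_ h2
        nlinarith [mul_le_mul_of_nonneg_right hk hy]
      exact mul_le_mul h4 (by linarith) hy (by positivity)
    rw [Real.exp_neg]
    have hE := Real.exp_pos x
    rw [inv_mul_eq_div, ← mul_div_assoc, div_le_div_iff₀ hE two_pos]
    linarith

/-- A sample size bound whose logarithmic factor involves the sample size itself follows from an
explicit bound. Either `log T` is of the order of `l`, or `T` is so large that `√T` dominates both
the logarithmic factor and `x`. -/
lemma exists_mul_pow_le_imp_mul_log_pow_le {b : ℝ} (hb : 0 < b) :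
    ∃ c : ℝ, 0 < c ∧ ∀ l x T : ℝ, 1 ≤ l → 0 ≤ x → x ≤ Real.exp (16 * l) → 2 ≤ T →
      c * l ^ 3 * x ≤ T → b * (2 + Real.log T) ^ 3 * x ≤ T := by
  have hC : 32 ≤ max 32 (1152 * b) := le_max_left _ _
  have hC' : 1152 * b ≤ max 32 (1152 * b) := le_max_right _ _
  set C := max 32 (1152 * b)
  refine ⟨b * (2 + C) ^ 3, by positivity, fun l x T hl hx hxl hT h => ?_⟩
  have hlog : 0 ≤ Real.log T := Real.log_nonneg (by linarith)
  rcases le_total (Real.log T) (C * l) with hle | hge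
  · refine le_trans ?_ h
    rw [mul_assoc b _ (l ^ 3), ← mul_pow]
    gcongr
    nlinarith
  · have h1 : b * (2 + Real.log T) ^ 3 ≤ Real.exp (Real.log T / 2) := by
      have h2 := Real.pow_div_factorial_le_exp ((2 + Real.log T) / 2) (by linarith) 4
      have h3 : Real.exp ((2 + Real.log T) / 2) = Real.exp 1 * Real.exp (Real.log T / 2) := by
        rw [← Real.exp_add]
        congr 1
        ring
      have h4 : Real.exp 1 < 3 := Real.exp_one_lt_three
      have h5 : 1152 * b ≤ 2 + Real.log T := by nlinarith
      have h6 := Real.exp_pos (Real.log T / 2)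
      have h7 : (4 : ℕ).factorial = 24 := rfl
      rw [h3, h7] at h2
      have h8 := mul_le_mul_of_nonneg_right h5 (by positivity : 0 ≤ (2 + Real.log T) ^ 3)
      push_cast at h2
      nlinarith
    have h2 : x ≤ Real.exp (Real.log T / 2) := by
      refine hxl.trans (Real.exp_le_exp.mpr ?_)
      nlinarith
    calc b * (2 + Real.log T) ^ 3 * x ≤ Real.exp (Real.log T / 2) * Real.exp (Real.log T / 2) :=
          mul_le_mul h1 h2 hx (Real.exp_pos _).le
      _ = T := by rw [← Real.exp_add, add_halves, Real.exp_log (by linarith)]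

lemma log_div_sq_le_logInv_mul {δ T : ℝ} (hδ : 0 < δ) (hT : 2 ≤ T) :
    Real.log (T / δ ^ 2) ≤ logInv δ * (2 + Real.log T) := by
  have h1 : 1 ≤ logInv δ := le_max_left _ _
  have h2 : Real.log (1 / δ) ≤ logInv δ := le_max_right _ _
  have h3 : 0 ≤ Real.log T := Real.log_nonneg (by linarith)
  rw [Real.log_div (by linarith) (by positivity), Real.log_pow]
  rw [one_div, Real.log_inv] at h2
  push_cast
  nlinarith

/-- With `q` of the order of `log (T / δ²)`, the `2q`-th moment bound, multiplied by the number of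
union bounds, is below `δ`. -/
lemma union_bound_le {δ T : ℝ} {q : ℕ} (hδ : 0 < δ) (hδ1 : δ < 1) (hT : 2 ≤ T)
    (hq : Real.log (T / δ ^ 2) ≤ 16 * q) :
    12 * T ^ 2 * Real.exp 2 * Real.exp (51 * q) ≤ δ * Real.exp 100 ^ (2 * q) := by
  have h1 : Real.exp 100 ^ (2 * q) = Real.exp (149 * q) * Real.exp (51 * q) := by
    rw [← Real.exp_nat_mul, ← Real.exp_add]
    congr 1
    push_cast
    ring
  have hy : 0 < T / δ ^ 2 := by positivity
  have h2 : (T / δ ^ 2) ^ 9 ≤ Real.exp (149 * q) := by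
    rw [← Real.exp_log hy, ← Real.exp_nat_mul]
    refine Real.exp_le_exp.mpr ?_
    have : (0 : ℝ) ≤ q := q.cast_nonneg
    push_cast
    linarith
  have h3 : Real.exp 2 ≤ 8 := by
    have h4 : Real.exp 2 = Real.exp 1 ^ 2 := by
      rw [← Real.exp_nat_mul]
      norm_num
    rw [h4]
    nlinarith [Real.exp_one_lt_d9, Real.exp_pos 1]
  have h5 : 12 * T ^ 2 * Real.exp 2 ≤ δ * (T / δ ^ 2) ^ 9 := by
    have h6 : T ^ 9 ≤ δ * (T / δ ^ 2) ^ 9 := by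
      rw [div_pow, mul_div_assoc', le_div_iff₀ (by positivity), mul_comm]
      gcongr
      rw [← pow_mul]
      exact pow_le_of_le_one hδ.le hδ1.le (by norm_num)
    have h7 : 128 ≤ T ^ 7 := by
      calc (128 : ℝ) = 2 ^ 7 := by norm_num
        _ ≤ T ^ 7 := by gcongr
    have h8 : T ^ 9 = T ^ 2 * T ^ 7 := by ring
    nlinarith [sq_nonneg T, mul_le_mul_of_nonneg_left h7 (sq_nonneg T),
      mul_le_mul_of_nonneg_left h3 (sq_nonneg T)]
  rw [h1, ← mul_assoc]
  exact mul_le_mul_of_nonneg_right (h5.trans (mul_le_mul_of_nonneg_left h2 hδ.le))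
    (Real.exp_pos _).le

lemma weighted_sum_le {M c Y r₁ r₂ r₃ r₄ r₅ : ℝ} (hM : 1 ≤ M) (hc : 10 ^ 4 * M ^ 2 ≤ c)
    (hY : 0 ≤ Y) (h₁ : 0 ≤ r₁) (h₂ : 0 ≤ r₂) (h₃ : 0 ≤ r₃) (h₄ : 0 ≤ r₄) (h₅ : 0 ≤ r₅)
    (hp₁ : c * r₁ ≤ 58 * Y) (hp₂ : c * r₂ ≤ 4 * Y) (hp₃ : c * r₃ ≤ 58 * Y) (hp₄ : c * r₄ ≤ Y)
    (hp₅ : c * r₅ ≤ 58 * Y) :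
    2 * M * (r₁ + r₂ + 4 * M * r₃ + 6 * r₄ + 4 * M * r₅) ≤ Y / 8 := by
  have hM0 : 0 < M := by linarith
  have htot : c * (r₁ + r₂ + 4 * M * r₃ + 6 * r₄ + 4 * M * r₅) ≤ 600 * M * Y := by
    linarith [mul_le_mul_of_nonneg_left hp₃ hM0.le, mul_le_mul_of_nonneg_left hp₅ hM0.le,
      mul_le_mul_of_nonneg_right hM hY]
  have hW0 : 0 ≤ r₁ + r₂ + 4 * M * r₃ + 6 * r₄ + 4 * M * r₅ := by positivity
  set W := r₁ + r₂ + 4 * M * r₃ + 6 * r₄ + 4 * M * r₅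
  have h4 : 10 ^ 4 * M ^ 2 * W ≤ 600 * M * Y := (mul_le_mul_of_nonneg_right hc hW0).trans htot
  have h5 : M * (10 ^ 4 * M * W) ≤ M * (600 * Y) := by linarith
  have h6 := le_of_mul_le_mul_left h5 hM0
  linarith

set_option maxHeartbeats 400000 in
/-- The radii at which the iterates and the sums of the noise-driven recursion are controlled, and
the resulting error of the tail average. -/
lemma exists_radii {M α g lam T ε Q w s κ q n c : ℝ} (hM : 1 ≤ M) (hα : 0 < α) (hα1 : α ≤ 1)
    (hg : 0 < g) (hg1 : g ≤ 1) (hlam : 0 < lam) (hε : 0 < ε) (hw : 1 ≤ w)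
    (hs : 0 < s) (hQ : 1 ≤ Q) (hκ : g / 2 ≤ κ) (hq : 1 ≤ q) (hqQ : q ≤ 2 * Q) (hqα : q * α ≤ 1 / 19)
    (hn : T = 2 * n) (hT : 2 ≤ T) (hc : 10 ^ 4 * M ^ 2 ≤ c)
    (h1 : c ^ 2 * (w ^ 2 * Q) ≤ T * (ε ^ 2 * g ^ 2 * lam))
    (h2 : c ^ 2 * (w ^ 2 * α * Q ^ 2) ≤ T * (ε ^ 2 * g ^ 3 * lam ^ 2))
    (h3 : c * (w * Q) ≤ T * (ε * √α * √g ^ 3 * lam)) :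
    ∃ R R' : ℝ, 2 * (q * α * (2 * (s * w) / √lam)) ≤ R ∧
      68 * (q * α * (3 * (s * w)) ^ 2) ≤ κ * lam * R ^ 2 ∧
      q * (2 * (s * w) / √lam + 4 * (M * R)) ≤ R' ∧
      q * (2 * n) * (2 * (3 * (s * w)) ^ 2 + 8 * (M * R) ^ 2) ≤ R' ^ 2 ∧
      0 ≤ R ∧ 0 ≤ R' ∧
      (2 * (M * R) / α + 2 * (M * R')) / ((n + 1) * (κ * √lam)) ≤ ε * s / 2 := by
  obtain ⟨a, ha, rfl⟩ : ∃ a, 0 < a ∧ α = a ^ 2 :=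
    ⟨√α, Real.sqrt_pos.mpr hα, (Real.sq_sqrt hα.le).symm⟩
  obtain ⟨h, hh, rfl⟩ : ∃ h, 0 < h ∧ g = h ^ 2 :=
    ⟨√g, Real.sqrt_pos.mpr hg, (Real.sq_sqrt hg.le).symm⟩
  obtain ⟨m, hm, rfl⟩ : ∃ m, 0 < m ∧ lam = m ^ 2 :=
    ⟨√lam, Real.sqrt_pos.mpr hlam, (Real.sq_sqrt hlam.le).symm⟩
  obtain ⟨t, ht, rfl⟩ : ∃ t, 0 < t ∧ T = t ^ 2 :=
    ⟨√T, Real.sqrt_pos.mpr (by linarith), (Real.sq_sqrt (by linarith)).symm⟩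
  obtain ⟨l, hl, rfl⟩ : ∃ l, 0 < l ∧ Q = l ^ 2 :=
    ⟨√Q, Real.sqrt_pos.mpr (by linarith), (Real.sq_sqrt (by linarith)).symm⟩
  rw [Real.sqrt_sq ha.le, Real.sqrt_sq hh.le] at h3
  rw [Real.sqrt_sq hm.le]
  have ha1 : a ≤ 1 := by nlinarith
  have hh1 : h ≤ 1 := by nlinarith
  have hl1 : 1 ≤ l := by nlinarith
  have hc0 : 0 < c := lt_of_lt_of_le (by positivity) hc
  have hw0 : 0 < w := by linarith
  have hM0 : 0 < M := by linarith
  have hq0 : 0 < q := by linarith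
  have h1' : c * (w * l) ≤ t * (ε * h ^ 2 * m) := by
    refine le_of_sq_le_sq ?_ (by positivity)
    calc (c * (w * l)) ^ 2 = c ^ 2 * (w ^ 2 * l ^ 2) := by ring
      _ ≤ _ := h1
      _ = _ := by ring
  have h2' : c * (w * a * l ^ 2) ≤ t * (ε * h ^ 3 * m ^ 2) := by
    refine le_of_sq_le_sq ?_ (by positivity)
    calc (c * (w * a * l ^ 2)) ^ 2 = c ^ 2 * (w ^ 2 * a ^ 2 * (l ^ 2) ^ 2) := by ring
      _ ≤ _ := h2
      _ = _ := by ring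
  -- up to the constant, the smallest radius allowed by the condition on `R ^ 2`
  set R := 58 * (s * w * a * l) / (h * m) with hR
  have hR0 : 0 < R := by positivity
  have hqa : q * a ^ 2 ≤ 2 * (a * l) := by
    -- geometric mean of the bounds `q a² ≤ 1` and `q a² ≤ 2 (a l)²`
    refine le_of_sq_le_sq ?_ (by positivity)
    calc (q * a ^ 2) ^ 2 = q * a ^ 2 * (q * a ^ 2) := sq _
      _ ≤ 1 / 19 * (2 * l ^ 2 * a ^ 2) := by gcongr
      _ ≤ (2 * (a * l)) ^ 2 := by nlinarith [sq_nonneg (a * l)]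
  have hRm : R * (h * m) = 58 * (s * w * a * l) := by
    rw [hR, div_mul_cancel₀ _ (by positivity)]
  set Y := ε * s * t ^ 2 * h ^ 2 * m with hY
  have hp1 : c * (R / a ^ 2) ≤ 58 * Y := by
    rw [hR, div_div, mul_div_assoc', div_le_iff₀ (by positivity), hY]
    have := mul_le_mul_of_nonneg_left h3 (by positivity : 0 ≤ 58 * s * a)
    have h4 : c * (58 * (s * w * a * l)) ≤ c * (58 * (s * w * a * l ^ 2)) := by
      gcongr
      nlinarith
    calc c * (58 * (s * w * a * l)) ≤ c * (58 * (s * w * a * l ^ 2)) := h4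
      _ = 58 * s * a * (c * (w * l ^ 2)) := by ring
      _ ≤ _ := this
      _ = _ := by ring
  have hp2 : c * (q * (2 * (s * w) / m)) ≤ 4 * Y := by
    rw [mul_div_assoc', mul_div_assoc', div_le_iff₀ hm, hY]
    have h4 := mul_le_mul_of_nonneg_left h3 (by positivity : 0 ≤ 4 * s)
    have h5 : a * h ≤ 1 := mul_le_one₀ ha1 hh.le hh1
    have h6 : c * (q * (2 * (s * w))) ≤ c * (2 * l ^ 2 * (2 * (s * w))) := by gcongr
    have h7 : 4 * s * (t ^ 2 * (ε * a * h ^ 3 * m ^ 2)) ≤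
        4 * s * (t ^ 2 * (ε * h ^ 2 * m ^ 2)) := by
      calc 4 * s * (t ^ 2 * (ε * a * h ^ 3 * m ^ 2)) =
            4 * s * (t ^ 2 * (ε * h ^ 2 * m ^ 2)) * (a * h) := by ring
        _ ≤ _ := mul_le_of_le_one_right (by positivity) h5
    calc c * (q * (2 * (s * w))) ≤ c * (2 * l ^ 2 * (2 * (s * w))) := h6
      _ = 4 * s * (c * (w * l ^ 2)) := by ring
      _ ≤ _ := h4
      _ ≤ _ := h7
      _ = _ := by ring
  have hp3 : c * (q * R) ≤ 58 * Y := by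
    refine le_trans ?_ hp1
    gcongr
    rw [le_div_iff₀ (by positivity)]
    calc q * R * a ^ 2 = q * a ^ 2 * R := by ring
      _ ≤ 1 / 19 * R := by gcongr
      _ ≤ R := by linarith
  have hp4 : c * (t * l * (s * w)) ≤ Y := by
    calc c * (t * l * (s * w)) = s * t * (c * (w * l)) := by ring
      _ ≤ s * t * (t * (ε * h ^ 2 * m)) := by gcongr
      _ = Y := by rw [hY]; ring
  have hp5 : c * (t * l * R) ≤ 58 * Y := by
    rw [hR, mul_div_assoc', mul_div_assoc', div_le_iff₀ (by positivity), hY]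
    calc c * (t * l * (58 * (s * w * a * l))) = 58 * s * t * (c * (w * a * l ^ 2)) := by ring
      _ ≤ 58 * s * t * (t * (ε * h ^ 3 * m ^ 2)) := by gcongr
      _ = _ := by ring
  refine ⟨R, q * (2 * (s * w) / m + 4 * (M * R)) + t * l * (6 * (s * w) + 4 * (M * R)), ?_, ?_,
    le_add_of_nonneg_right (by positivity), ?_, hR0.le, by positivity, ?_⟩
  · rw [hR, le_div_iff₀ (by positivity)]
    have h4 : 2 * (q * a ^ 2 * (2 * (s * w) / m)) * (h * m) = 4 * (q * a ^ 2) * (s * w) * h := by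
      field_simp
      ring
    rw [h4]
    calc 4 * (q * a ^ 2) * (s * w) * h ≤ 4 * (2 * (a * l)) * (s * w) * 1 := by gcongr
      _ = 8 * (s * w * a * l) := by ring
      _ ≤ _ := by gcongr; norm_num
  · have h4 : h ^ 2 / 2 * m ^ 2 * R ^ 2 = 1682 * (s * w * a * l) ^ 2 := by
      calc h ^ 2 / 2 * m ^ 2 * R ^ 2 = (R * (h * m)) ^ 2 / 2 := by ring
        _ = _ := by rw [hRm]; ring
    calc 68 * (q * a ^ 2 * (3 * (s * w)) ^ 2) ≤ 68 * (2 * l ^ 2 * a ^ 2 * (3 * (s * w)) ^ 2) := by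
          gcongr
      _ = 1224 * (s * w * a * l) ^ 2 := by ring
      _ ≤ 1682 * (s * w * a * l) ^ 2 := by gcongr; norm_num
      _ = h ^ 2 / 2 * m ^ 2 * R ^ 2 := h4.symm
      _ ≤ κ * m ^ 2 * R ^ 2 := by gcongr
  · rw [← hn]
    have hMR : 0 < M * R := by positivity
    have hsw : 0 < s * w := by positivity
    calc q * t ^ 2 * (2 * (3 * (s * w)) ^ 2 + 8 * (M * R) ^ 2)
        ≤ 2 * l ^ 2 * t ^ 2 * (2 * (3 * (s * w)) ^ 2 + 8 * (M * R) ^ 2) := by gcongr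
      _ ≤ 2 * l ^ 2 * t ^ 2 * (2 * (3 * (s * w)) ^ 2 + 8 * (M * R) ^ 2) +
          (t * l) ^ 2 * (48 * (s * w) * (M * R)) := le_add_of_nonneg_right (by positivity)
      _ = (t * l * (6 * (s * w) + 4 * (M * R))) ^ 2 := by ring
      _ ≤ _ := by
          gcongr
          exact le_add_of_nonneg_left (by positivity)
  · have hκ0 : 0 < κ := lt_of_lt_of_le (by positivity) hκ
    have hn0 : 0 < n := by linarith
    have hden : t ^ 2 * h ^ 2 * m / 4 ≤ (n + 1) * (κ * m) := by
      calc t ^ 2 * h ^ 2 * m / 4 = n * (h ^ 2 / 2 * m) := by rw [hn]; ring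
        _ ≤ (n + 1) * (κ * m) := by
          gcongr
          linarith
    rw [div_le_iff₀ (by positivity)]
    refine le_trans ?_ (mul_le_mul_of_nonneg_left hden (by positivity))
    have hYe : ε * s / 2 * (t ^ 2 * h ^ 2 * m / 4) = Y / 8 := by
      rw [hY]
      ring
    have hY0 : 0 < Y := by positivity
    have hnum : 2 * (M * R) / a ^ 2 + 2 * (M * (q * (2 * (s * w) / m + 4 * (M * R)) +
        t * l * (6 * (s * w) + 4 * (M * R)))) =
        2 * M * (R / a ^ 2 + q * (2 * (s * w) / m) + 4 * M * (q * R) + 6 * (t * l * (s * w)) +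
          4 * M * (t * l * R)) := by ring
    rw [hYe, hnum]
    exact weighted_sum_le hM hc hY0.le (by positivity) (by positivity) (by positivity)
      (by positivity) (by positivity) hp1 hp2 hp3 hp4 hp5

/-! ### The sample size condition -/

lemma one_le_hiddenLog {γ lam α ε δ v : ℝ} {K : ℕ} (hγ : γ < 1) (hlam : 0 < lam) (hα : 0 < α)
    (hε : 0 < ε) (hδ : 0 < δ) (hδ1 : δ < 1) (hv : 0 ≤ v) :
    1 ≤ hiddenLog γ lam α ε δ K v := by
  have h1 : 0 ≤ Real.log (1 / δ) := Real.log_nonneg (by rw [le_div_iff₀ hδ]; linarith)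
  have h2 : 0 < (1 - γ)⁻¹ := inv_pos.mpr (by linarith)
  have h3 : 0 ≤ lam⁻¹ + α⁻¹ + ε⁻¹ + K + v := by positivity
  rw [hiddenLog, Real.le_log_iff_exp_le (by positivity)]
  linarith

lemma leading_term_le_pow {E v e g lam α l : ℝ} (hE : 2 ≤ E) (hv0 : 0 ≤ v) (hv : v ≤ E ^ 2)
    (he0 : 0 < e) (he : e⁻¹ ≤ E) (hg0 : 0 < g) (hg : g⁻¹ ≤ E) (hlam0 : 0 < lam) (hlam : lam⁻¹ ≤ E)
    (hα0 : 0 ≤ α) (hα : α ≤ 1) (hl0 : 0 ≤ l) (hl : l ≤ E) :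
    (v ^ 2 + 1) / (e ^ 2 * g ^ 2 * lam) * (1 + α * l / (g * lam)) * l ≤ E ^ 15 := by
  have hE0 : 0 < E := by linarith
  have h1 : v ^ 2 + 1 ≤ E ^ 5 := by
    have h2 : v ^ 2 ≤ (E ^ 2) ^ 2 := by gcongr
    have h3 : (1 : ℝ) ≤ E ^ 4 := one_le_pow₀ (by linarith)
    nlinarith
  have h4 : (v ^ 2 + 1) / (e ^ 2 * g ^ 2 * lam) ≤ E ^ 10 := by
    calc (v ^ 2 + 1) / (e ^ 2 * g ^ 2 * lam) = (v ^ 2 + 1) * (e⁻¹ ^ 2 * g⁻¹ ^ 2 * lam⁻¹) := by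
          rw [div_eq_mul_inv, mul_inv, mul_inv, inv_pow, inv_pow]
      _ ≤ E ^ 5 * (E ^ 2 * E ^ 2 * E) := by gcongr
      _ = E ^ 10 := by ring
  have h5 : 1 + α * l / (g * lam) ≤ E ^ 4 := by
    have h6 : α * l / (g * lam) ≤ E ^ 3 := by
      calc α * l / (g * lam) = α * l * (g⁻¹ * lam⁻¹) := by rw [div_eq_mul_inv, mul_inv]
        _ ≤ 1 * E * (E * E) := by gcongr
        _ = E ^ 3 := by ring
    have h7 : (1 : ℝ) ≤ E ^ 3 := one_le_pow₀ (by linarith)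
    nlinarith
  calc (v ^ 2 + 1) / (e ^ 2 * g ^ 2 * lam) * (1 + α * l / (g * lam)) * l
      ≤ E ^ 10 * E ^ 4 * E := by gcongr
    _ = E ^ 15 := by ring

lemma middle_term_le_pow {E v e g lam α l : ℝ} (hE : 2 ≤ E) (hv : v ≤ E ^ 2)
    (he0 : 0 < e) (he : e⁻¹ ≤ E) (hg0 : 0 < g) (hg1 : g ≤ 1) (hg : g⁻¹ ≤ E) (hlam0 : 0 < lam)
    (hlam : lam⁻¹ ≤ E) (hα0 : 0 < α) (hα1 : α ≤ 1) (hα : α⁻¹ ≤ E) (hl0 : 0 ≤ l) (hl : l ≤ E) :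
    (v + 1) / (e * √α * √g ^ 3 * lam) * l ≤ E ^ 15 := by
  have hE0 : 0 < E := by linarith
  have hsα : 0 < √α := Real.sqrt_pos.mpr hα0
  have hsg : 0 < √g := Real.sqrt_pos.mpr hg0
  have h1 : v + 1 ≤ E ^ 3 := by
    have h3 : (1 : ℝ) ≤ E ^ 2 := one_le_pow₀ (by linarith)
    nlinarith
  have h2 : (√α)⁻¹ ≤ E := by
    refine le_trans (inv_anti₀ hα0 ?_) hα
    exact Real.le_sqrt_of_sq_le (pow_le_of_le_one hα0.le hα1 two_ne_zero)
  have h3 : (√g)⁻¹ ≤ E := by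
    refine le_trans (inv_anti₀ hg0 ?_) hg
    exact Real.le_sqrt_of_sq_le (pow_le_of_le_one hg0.le hg1 two_ne_zero)
  calc (v + 1) / (e * √α * √g ^ 3 * lam) * l
      = (v + 1) * (e⁻¹ * (√α)⁻¹ * (√g)⁻¹ ^ 3 * lam⁻¹) * l := by
        rw [div_eq_mul_inv, mul_inv, mul_inv, mul_inv, inv_pow]
    _ ≤ E ^ 3 * (E * E * E ^ 3 * E) * E := by gcongr
    _ = E ^ 10 := by ring
    _ ≤ E ^ 15 := pow_le_pow_right₀ (by linarith) (by norm_num)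

/-- The leading term of the sample size bound is a sum of two terms, so it gives the first two
bounds; the middle term gives the third. -/
lemma noise_bounds_of_le {b v ε g lam α l P T : ℝ} (hb : 1 ≤ b) (hv : 0 ≤ v) (hα : 0 < α)
    (hε : 0 < ε) (hg : 0 < g) (hlam : 0 < lam) (hl : 0 < l) (hP1 : 1 ≤ P)
    (h : 2 * b ^ 2 * P ^ 3 * ((v ^ 2 + 1) / (ε ^ 2 * g ^ 2 * lam) * (1 + α * l / (g * lam)) * l +
      (v + 1) / (ε * √α * √g ^ 3 * lam) * l) ≤ T) :
    b ^ 2 * ((v + 1) ^ 2 * (l * P)) ≤ T * (ε ^ 2 * g ^ 2 * lam) ∧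
      b ^ 2 * ((v + 1) ^ 2 * α * (l * P) ^ 2) ≤ T * (ε ^ 2 * g ^ 3 * lam ^ 2) ∧
      b * ((v + 1) * (l * P)) ≤ T * (ε * √α * √g ^ 3 * lam) := by
  have hsα : 0 < √α := Real.sqrt_pos.mpr hα
  have hsg : 0 < √g := Real.sqrt_pos.mpr hg
  set Y := (v ^ 2 + 1) / (ε ^ 2 * g ^ 2 * lam) with hY
  have hY0 : 0 < Y := by positivity
  set Z := (v + 1) / (ε * √α * √g ^ 3 * lam) * l with hZ
  have hZ0 : 0 ≤ Z := by positivity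
  have hYl0 : 0 ≤ Y * l := by positivity
  have hYa0 : 0 ≤ Y * (α * l ^ 2 / (g * lam)) := by positivity
  have hsplit : Y * (1 + α * l / (g * lam)) * l = Y * l + Y * (α * l ^ 2 / (g * lam)) := by ring
  rw [hsplit] at h
  have hPP2 : P ^ 2 ≤ P ^ 3 := pow_le_pow_right₀ hP1 (by norm_num)
  have hPP1 : P ≤ P ^ 3 := le_self_pow₀ hP1 (by norm_num)
  have hbb : b ≤ 2 * b ^ 2 := by nlinarith
  have hww : (v + 1) ^ 2 ≤ 2 * (v ^ 2 + 1) := by linarith [sq_nonneg (v - 1)]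
  have hYm : Y * (ε ^ 2 * g ^ 2 * lam) = v ^ 2 + 1 := by
    rw [hY, div_mul_cancel₀ _ (by positivity)]
  refine ⟨?_, ?_, ?_⟩
  · have h1 : 2 * b ^ 2 * P * (Y * l) ≤ T := by
      refine le_trans ?_ h
      gcongr
      linarith
    calc b ^ 2 * ((v + 1) ^ 2 * (l * P)) ≤ b ^ 2 * (2 * (v ^ 2 + 1) * (l * P)) := by gcongr
      _ = 2 * b ^ 2 * P * (Y * l) * (ε ^ 2 * g ^ 2 * lam) := by
          rw [← hYm]
          ring
      _ ≤ _ := by gcongr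
  · have h1 : 2 * b ^ 2 * P ^ 2 * (Y * (α * l ^ 2 / (g * lam))) ≤ T := by
      refine le_trans ?_ h
      gcongr
      linarith
    calc b ^ 2 * ((v + 1) ^ 2 * α * (l * P) ^ 2)
        ≤ b ^ 2 * (2 * (v ^ 2 + 1) * α * (l * P) ^ 2) := by gcongr
      _ = 2 * b ^ 2 * P ^ 2 * (Y * (α * l ^ 2 / (g * lam))) * (ε ^ 2 * g ^ 3 * lam ^ 2) := by
          rw [← hYm]
          field_simp
      _ ≤ _ := by gcongr
  · have h1 : b * P * Z ≤ T := by
      refine le_trans ?_ h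
      gcongr
      linarith
    calc b * ((v + 1) * (l * P)) = b * P * Z * (ε * √α * √g ^ 3 * lam) := by
          rw [hZ]
          field_simp
      _ ≤ _ := by gcongr

/-- The sample size bound of the theorem, with the logarithm of the sample size absorbed, in the
form in which it controls the error of the tail average. -/
lemma exists_sample_size_bounds {b : ℝ} (hb : 1 ≤ b) :
    ∃ c : ℝ, 0 < c ∧ ∀ (γ lam α ε δ v v₁ v₂ T : ℝ) (K : ℕ), 0 < γ → γ < 1 → 0 < lam →
      0 < α → α ≤ 1 → 0 < ε → 0 < δ → δ < 1 → 0 < K → 0 ≤ v →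
      v₁ = v / (√(K : ℝ) * (1 - γ)) → 0 ≤ v₂ → 2 ≤ T →
      c * hiddenLog γ lam α ε δ K v ^ 3 * sampleOrder γ lam α ε δ v₁ v₂ ≤ T →
      b ^ 2 * ((v₁ + 1) ^ 2 * (logInv δ * (2 + Real.log T))) ≤
          T * (ε ^ 2 * (1 - γ) ^ 2 * lam) ∧
        b ^ 2 * ((v₁ + 1) ^ 2 * α * (logInv δ * (2 + Real.log T)) ^ 2) ≤
          T * (ε ^ 2 * (1 - γ) ^ 3 * lam ^ 2) ∧
        b * ((v₁ + 1) * (logInv δ * (2 + Real.log T))) ≤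
          T * (ε * √α * √(1 - γ) ^ 3 * lam) ∧
        b * Real.log (1 + v₂ / ε) ≤ T * (α * (1 - γ) * lam) := by
  obtain ⟨c, hc, hcT⟩ := exists_mul_pow_le_imp_mul_log_pow_le (b := 2 * b ^ 2) (by positivity)
  refine ⟨max c b, lt_max_of_lt_left hc, ?_⟩
  intro γ lam α ε δ v v₁ v₂ T K hγ0 hγ hlam hα hα1 hε hδ hδ1 hK hv hv₁ hv₂ hT h
  have hΛ := one_le_hiddenLog (K := K) hγ hlam hα hε hδ hδ1 hv
  have hlogδ : 0 ≤ Real.log (1 / δ) := Real.log_nonneg (by rw [le_div_iff₀ hδ]; linarith)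
  have hg : 0 < 1 - γ := by linarith
  have hgi : 0 < (1 - γ)⁻¹ := inv_pos.mpr hg
  have hli : 0 < lam⁻¹ := inv_pos.mpr hlam
  have hαi : 0 < α⁻¹ := inv_pos.mpr hα
  have hεi : 0 < ε⁻¹ := inv_pos.mpr hε
  have hK' : (1 : ℝ) ≤ K := by exact_mod_cast hK
  have hexp : Real.exp (hiddenLog γ lam α ε δ K v) =
      Real.exp 1 + (1 - γ)⁻¹ + lam⁻¹ + α⁻¹ + ε⁻¹ + K + v + Real.log (1 / δ) := by
    rw [hiddenLog, Real.exp_log]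
    positivity
  set E := Real.exp (hiddenLog γ lam α ε δ K v) with hE
  have he1 : 2 < Real.exp 1 := by linarith [Real.exp_one_gt_d9]
  have hE2 : 2 ≤ E := by linarith
  have hl1 : 1 ≤ logInv δ := le_max_left _ _
  have hlE : logInv δ ≤ E := max_le (by linarith) (by linarith)
  have hsK : 1 ≤ √(K : ℝ) := Real.one_le_sqrt.mpr hK'
  have hv₁0 : 0 ≤ v₁ := by rw [hv₁]; positivity
  have hv₁E : v₁ ≤ E ^ 2 := by
    calc v₁ = v * ((√(K : ℝ))⁻¹ * (1 - γ)⁻¹) := by rw [hv₁, div_eq_mul_inv, mul_inv]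
      _ ≤ E * (1 * E) := by
        gcongr
        · linarith
        · exact inv_le_one_of_one_le₀ hsK
        · linarith
      _ = E ^ 2 := by ring
  have hrpow : (1 - γ) ^ (3 / 2 : ℝ) = √(1 - γ) ^ 3 := by
    rw [Real.sqrt_eq_rpow, ← Real.rpow_natCast, ← Real.rpow_mul hg.le]
    norm_num
  rw [sampleOrder, hrpow] at h
  have hX1 := leading_term_le_pow (lam := lam) (α := α) hE2 hv₁0 hv₁E hε (by linarith) hg
    (by linarith) hlam (by linarith) hα.le hα1 (by linarith) hlE
  have hX2 := middle_term_le_pow (lam := lam) (α := α) hE2 hv₁E hε (by linarith) hg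
    (by linarith) (by linarith) hlam (by linarith) hα hα1 (by linarith) (by linarith) hlE
  have hX3 : 0 ≤ Real.log (1 + v₂ / ε) / (α * (1 - γ) * lam) := by
    have : 0 ≤ Real.log (1 + v₂ / ε) := Real.log_nonneg (by
      have : 0 ≤ v₂ / ε := by positivity
      linarith)
    positivity
  have hl0 : 0 < logInv δ := by linarith
  set X1 := (v₁ ^ 2 + 1) / (ε ^ 2 * (1 - γ) ^ 2 * lam) *
    (1 + α * logInv δ / ((1 - γ) * lam)) * logInv δ with hX1def
  have hX10 : 0 ≤ X1 := by positivity
  set X2 := (v₁ + 1) / (ε * √α * √(1 - γ) ^ 3 * lam) * logInv δ with hX2def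
  have hX20 : 0 ≤ X2 := by positivity
  set X3 := Real.log (1 + v₂ / ε) / (α * (1 - γ) * lam) with hX3def
  have hΛ3 : 1 ≤ hiddenLog γ lam α ε δ K v ^ 3 := one_le_pow₀ hΛ
  set Λ := hiddenLog γ lam α ε δ K v
  have hlog : 0 ≤ Real.log T := Real.log_nonneg (by linarith)
  have hP := hcT Λ (X1 + X2) T hΛ (by positivity) (by
      rw [show Real.exp (16 * Λ) = E ^ 16 by rw [hE, ← Real.exp_nat_mul]; norm_num]
      have : E ^ 15 * 2 ≤ E ^ 15 * E := by gcongr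
      rw [pow_succ]
      linarith) hT (by
      refine le_trans ?_ h
      have h0 : 0 ≤ X1 + X2 := add_nonneg hX10 hX20
      calc c * Λ ^ 3 * (X1 + X2) ≤ max c b * Λ ^ 3 * (X1 + X2) := by
            gcongr
            exact le_max_left _ _
        _ ≤ max c b * Λ ^ 3 * (X1 + X2 + X3) :=
          mul_le_mul_of_nonneg_left (le_add_of_nonneg_right hX3) (by positivity))
  obtain ⟨h1, h2, h3⟩ := noise_bounds_of_le hb hv₁0 hα hε hg hlam hl0 (by linarith) hP
  refine ⟨h1, h2, h3, ?_⟩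
  have h4 : b * X3 ≤ T := by
    refine le_trans ?_ h
    calc b * X3 = b * 1 * X3 := by ring
      _ ≤ max c b * Λ ^ 3 * (X1 + X2 + X3) := by
        gcongr
        · exact le_max_right _ _
        · exact le_add_of_nonneg_left (add_nonneg hX10 hX20)
  calc b * Real.log (1 + v₂ / ε) = b * X3 * (α * (1 - γ) * lam) := by
        rw [hX3def]
        field_simp
    _ ≤ _ := by gcongr

/-! ### The high-probability bound -/

/-- A moment order `q` of about `log (T / δ²) / 16` is small enough for the step size condition and
large enough for the union bound. -/
lemma exists_moment_order {α δ T κ : ℝ} (hα : 0 < α) (hδ : 0 < δ) (hδ1 : δ < 1) (hT : 2 ≤ T)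
    (hκ1 : κ ≤ 1) (h : α < κ / (38 * Real.log (T / δ ^ 2))) :
    ∃ q : ℕ, 1 ≤ q ∧ Real.log (T / δ ^ 2) ≤ 16 * q ∧ (q : ℝ) ≤ 2 * Real.log (T / δ ^ 2) ∧
      q * α ≤ 1 / 19 ∧ 8 * (α * (1 + 34 * ((q : ℝ) - 1))) ≤ κ ∧ α ≤ 1 := by
  have hL : 0.69 ≤ Real.log (T / δ ^ 2) := by
    refine le_trans (by linarith [Real.log_two_gt_d9]) (Real.log_le_log two_pos (y := T / δ ^ 2) ?_)
    rw [le_div_iff₀ (by positivity)]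
    nlinarith [pow_le_one₀ (n := 2) hδ.le hδ1.le]
  set L := Real.log (T / δ ^ 2)
  rw [lt_div_iff₀ (by linarith)] at h
  have h1 := Nat.lt_floor_add_one (L / 16)
  have h2 := Nat.floor_le (by linarith : 0 ≤ L / 16)
  have hαL := mul_le_mul_of_nonneg_left hL hα.le
  refine ⟨⌊L / 16⌋₊ + 1, by omega, ?_, ?_, ?_, ?_, ?_⟩
  · push_cast
    linarith
  · push_cast
    linarith
  · push_cast
    have : (⌊L / 16⌋₊ + 1 : ℝ) * α ≤ 2 * L * α := by
      gcongr
      linarith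
    linarith
  · push_cast
    have := mul_le_mul_of_nonneg_left h2 hα.le
    linarith
  · linarith

set_option maxHeartbeats 1000000 in
/-- The error bound for samples given by everywhere measurable maps. The tail average is off by a
transient term, which the step size and the sample size make smaller than `ε / 2`, and by the
contribution of the noise, whose size is controlled with high probability. -/
lemma exists_measure_loss_le :
    ∃ c : ℝ, 0 < c ∧ ∀ (S A Ω : Type*) [MeasurableSpace S] [MeasurableSpace A] [MeasurableSpace Ω]
      (Pr : Measure Ω) [IsProbabilityMeasure Pr] (M : MDP S A) (π : Kernel S A) [IsMarkovKernel π]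
      (μ : Measure S) [IsProbabilityMeasure μ] (_ : (stateKernel M π).Invariant μ)
      (d : ℕ) (φ : S → EuclideanSpace ℝ (Fin d)) (_ : Measurable φ) (_ : ∀ s, ‖φ s‖ ≤ 1)
      (_ : 0 < lamMin μ φ) (K : ℕ) (_ : 0 < K) (θstar : Param K d)
      (_ : IsProjectedBellmanSolution M π μ φ θstar) (θ₀ : Param K d)
      (X : ℕ → Ω → S × (A × (ℝ × S))) (_ : ∀ t, Measurable (X t))
      (_ : iIndepFun X Pr) (_ : ∀ t, Pr.map (X t) = sampleLaw M π μ)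
      (ε δ α : ℝ) (n : ℕ) (_ : 0 < ε) (_ : 0 < δ) (_ : δ < 1) (_ : 1 ≤ n) (_ : 0 < α)
      (_ : α < (1 - √M.γ) / (38 * Real.log (((2 * n : ℕ) : ℝ) / δ ^ 2)))
      (_ : c * hiddenLog M.γ (lamMin μ φ) α ε δ K (normCov (featureCov μ φ) θstar) ^ 3 *
        sampleOrder M.γ (lamMin μ φ) α ε δ (normV₁ M.γ (featureCov μ φ) θstar)
          (normV₂ M.γ (θ₀ - θstar)) ≤ ((2 * n : ℕ) : ℝ)),
      Pr {ω | ¬ loss M.γ μ φ θstar (tailAverage M.γ K φ α θ₀ X (2 * n) ω) ≤ ε} ≤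
        ENNReal.ofReal δ := by
  -- the factor lost in Markov's inequality; its size comes from `union_bound_le`
  have hM1 : 1 ≤ Real.exp 100 := Real.one_le_exp (by norm_num)
  obtain ⟨c₁, hc₁, htrans⟩ := exists_mul_log_le_imp_mul_exp_neg_le hM1
  have hb1 : 10 ^ 4 * Real.exp 100 ^ 2 ≤ max (10 ^ 4 * Real.exp 100 ^ 2) (8 * c₁) := le_max_left _ _
  have hb2 : 8 * c₁ ≤ max (10 ^ 4 * Real.exp 100 ^ 2) (8 * c₁) := le_max_right _ _
  set M₀ := Real.exp 100 with hM₀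
  set b := max (10 ^ 4 * M₀ ^ 2) (8 * c₁)
  have hb : 1 ≤ b := le_trans (by nlinarith [one_le_pow₀ (n := 2) hM1]) hb1
  obtain ⟨c, hc, hbounds⟩ := exists_sample_size_bounds hb
  refine ⟨c, hc, ?_⟩
  intro S A Ω _ _ _ Pr _ M π _ μ _ hinv d φ hφ hφ1 hlam K hK θ hθ θ₀ X hX hind hlaw ε δ α n hε hδ
    hδ1 hn hα hαlt hT
  have hγ0 := M.γ_pos
  have hγ := M.γ_lt_one
  have hg : 0 < 1 - M.γ := by linarith
  have hsγ : √M.γ ≤ 1 := Real.sqrt_le_one.mpr hγ.le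
  have hκ : (1 - M.γ) / 2 ≤ 1 - √M.γ := by
    nlinarith [Real.sq_sqrt hγ0.le, Real.sqrt_nonneg M.γ]
  have hn' : (1 : ℝ) ≤ n := by exact_mod_cast hn
  have hT2 : (2 : ℝ) ≤ ((2 * n : ℕ) : ℝ) := by
    push_cast
    linarith
  have hTn : ((2 * n : ℕ) : ℝ) = 2 * (n : ℝ) := by push_cast; rfl
  set T : ℝ := ((2 * n : ℕ) : ℝ) with hTdef
  obtain ⟨q, hq, hLq, hqL, hqα, hq2, hα1⟩ := exists_moment_order hα hδ hδ1 hT2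
    (by linarith [Real.sqrt_nonneg M.γ]) hαlt
  have hs0 : 0 < √(K : ℝ) * (1 - M.γ) :=
    mul_pos (Real.sqrt_pos.mpr (by exact_mod_cast hK)) hg
  obtain ⟨s, hs⟩ : ∃ s, s = √(K : ℝ) * (1 - M.γ) := ⟨_, rfl⟩
  rw [← hs] at hs0
  have hv₁ : normV₁ M.γ (featureCov μ φ) θ = √(covSq μ φ θ) / s := by
    rw [normV₁, normCov_eq hφ hφ1, hs]
  have hv₂ : normV₂ M.γ (θ₀ - θ) = ‖θ₀ - θ‖ / s := by rw [normV₂, hs]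
  have hcov : √(covSq μ φ θ) = s * normV₁ M.γ (featureCov μ φ) θ := by
    rw [hv₁, mul_div_cancel₀ _ hs0.ne']
  obtain ⟨hT1, hT2', hT3, hT4⟩ := hbounds M.γ (lamMin μ φ) α ε δ (normCov (featureCov μ φ) θ)
    (normV₁ M.γ (featureCov μ φ) θ) (normV₂ M.γ (θ₀ - θ)) T K hγ0 hγ hlam hα hα1 hε hδ hδ1 hK
    (Real.sqrt_nonneg _) rfl (by rw [hv₂]; positivity) hT2 hT
  have hv₁0 : 0 ≤ normV₁ M.γ (featureCov μ φ) θ := by rw [hv₁]; positivity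
  set v := normV₁ M.γ (featureCov μ φ) θ
  have hlogT : 0 ≤ Real.log T := Real.log_nonneg (by linarith)
  have hl1 : 1 ≤ logInv δ := le_max_left _ _
  have hLQ := log_div_sq_le_logInv_mul hδ hT2
  have hq1 : (1 : ℝ) ≤ q := by exact_mod_cast hq
  obtain ⟨R, R', hR1, hR2, hR'1, hR'2, hR0, hR'0, herr⟩ := exists_radii (w := v + 1) (n := (n : ℝ))
    hM1 hα hα1 hg (by linarith) hlam hε (by linarith) hs0
    (by nlinarith : 1 ≤ logInv δ * (2 + Real.log T)) hκ hq1 (by linarith) hqα hTn hT2 hb1 hT1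
    hT2' hT3
  have hmodel := isLSAModel_ctd hinv hK hφ hφ1 hlam hθ hs hcov
  have hδ' := union_bound_le hδ hδ1 hT2 hLq
  rw [hTn, ← hM₀] at hδ'
  refine (measure_mono ?_).trans (hmodel.measure_tailAverage hX hind hlaw hα hq (by linarith) hq2 hn
    (by linarith) hR1 hR2 hR'1 hR'2 hδ' (θ₀ - θ))
  intro ω hω hN
  refine hω ((loss_le hγ hK hφ hφ1 _ _).trans ?_)
  rw [tailAverage_sub_eq, ← hs, div_le_iff₀ hs0]
  refine Real.sqrt_le_iff.mpr ⟨by positivity, hN.trans ?_⟩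
  -- the transient term: the exponent is at least a multiple of `log (1 + ‖θ₀ - θ‖ / (s ε))`
  have hdecay := htrans (normV₂ M.γ (θ₀ - θ) / ε) (α * (1 - √M.γ) * lamMin μ φ * n / 2)
    (by rw [hv₂]; positivity) (by
      have hlog : 0 ≤ Real.log (1 + normV₂ M.γ (θ₀ - θ) / ε) := Real.log_nonneg (by
        have : 0 ≤ normV₂ M.γ (θ₀ - θ) / ε := by rw [hv₂]; positivity
        linarith)
      have h1 := mul_le_mul_of_nonneg_right hb2 hlog
      have h2 : α * ((1 - M.γ) / 2) * lamMin μ φ * n ≤ α * (1 - √M.γ) * lamMin μ φ * n := by gcongr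
      rw [hTn] at hT4
      linarith)
  have hD : M₀ * (Real.exp (-(α * (1 - √M.γ) * lamMin μ φ * n / 2)) * ‖θ₀ - θ‖) ≤ ε * s / 2 := by
    have h1 : ‖θ₀ - θ‖ = normV₂ M.γ (θ₀ - θ) / ε * (ε * s) := by
      rw [hv₂]
      field_simp
    have h2 := mul_le_mul_of_nonneg_right hdecay (by positivity : 0 ≤ ε * s)
    calc _ = M₀ * (Real.exp (-(α * (1 - √M.γ) * lamMin μ φ * n / 2)) *
          (normV₂ M.γ (θ₀ - θ) / ε)) * (ε * s) := by
          nth_rewrite 1 [h1]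
          ring
      _ ≤ _ := h2
      _ = _ := by ring
  have hκ0 : 0 < 1 - √M.γ := by linarith
  have hM₀0 : 0 < M₀ := by linarith
  have h1 := pow_le_pow_left₀ (by positivity) hD 2
  have h2 := pow_le_pow_left₀ (by positivity) herr 2
  calc _ ≤ 2 * (ε * s / 2) ^ 2 + 2 * (ε * s / 2) ^ 2 := by gcongr
    _ = (ε * s) ^ 2 := by ring

lemma ctdIterate_congr {S A Ω : Type*} {d K : ℕ} {φ : S → EuclideanSpace ℝ (Fin d)} {γ α : ℝ}
    {θ₀ : Param K d}
    {X Y : ℕ → Ω → S × (A × (ℝ × S))} {ω : Ω} (h : ∀ t, X t ω = Y t ω) (t : ℕ) :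
    ctdIterate γ K φ α θ₀ X t ω = ctdIterate γ K φ α θ₀ Y t ω := by
  induction t with
  | zero => rfl
  | succ t ih => simp only [ctdIterate, ih, h]

end LinearCTD

theorem theorem2 :
    ∃ c : ℝ, 0 < c ∧ ∃ m : ℕ,
      ∀ (S A Ω : Type*)
        [TopologicalSpace S] [PolishSpace S] [MeasurableSpace S] [BorelSpace S]
        [TopologicalSpace A] [PolishSpace A] [MeasurableSpace A] [BorelSpace A]
        [MeasurableSpace Ω] (Pr : Measure Ω) [IsProbabilityMeasure Pr]
        (M : LinearCTD.MDP S A) (π : Kernel S A) [IsMarkovKernel π] (μ : Measure S)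
        (_ : LinearCTD.IsUniqueStationary M π μ)
        (d : ℕ) (φ : S → EuclideanSpace ℝ (Fin d)) (_ : Measurable φ) (_ : ∀ s, ‖φ s‖ ≤ 1)
        (_ : 0 < LinearCTD.lamMin μ φ)
        (K : ℕ) (_ : (1 - M.γ)⁻¹ ≤ (K : ℝ))
        (θstar : LinearCTD.Param K d)
        (_ : LinearCTD.IsProjectedBellmanSolution M π μ φ θstar)
        (θ₀ : LinearCTD.Param K d)
        (X : ℕ → Ω → S × (A × (ℝ × S)))
        (_ : iIndepFun X Pr) (_ : ∀ t, HasLaw (X t) (LinearCTD.sampleLaw M π μ) Pr)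
        (ε δ α : ℝ) (T : ℕ)
        (_ : 0 < ε) (_ : 0 < δ) (_ : δ < 1) (_ : 2 ≤ T) (_ : Even T)
        (_ : 0 < α) (_ : α < (1 - √M.γ) / (38 * Real.log ((T : ℝ) / δ ^ 2)))
        (_ : c *
            LinearCTD.hiddenLog M.γ (LinearCTD.lamMin μ φ) α ε δ K
              (LinearCTD.normCov (LinearCTD.featureCov μ φ) θstar) ^ m *
            LinearCTD.sampleOrder M.γ (LinearCTD.lamMin μ φ) α ε δ
              (LinearCTD.normV₁ M.γ (LinearCTD.featureCov μ φ) θstar)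
              (LinearCTD.normV₂ M.γ (θ₀ - θstar)) ≤ (T : ℝ)),
        1 - δ ≤ Pr.real {ω | LinearCTD.loss M.γ μ φ θstar
            (LinearCTD.tailAverage M.γ K φ α θ₀ X T ω) ≤ ε} := by
  obtain ⟨c, hc, hmain⟩ := LinearCTD.exists_measure_loss_le
  refine ⟨c, hc, 3, ?_⟩
  intro S A Ω _ _ _ _ _ _ _ _ _ Pr _ M π _ μ hμ d φ hφ hφ1 hlam K hK θ hθ θ₀ X hind hlaw ε δ α T
    hε hδ hδ1 hT hev hα hαlt hTle
  have := hμ.1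
  obtain ⟨n, rfl⟩ := hev.two_dvd
  have hK0 : 0 < K := by
    have h1 : 0 < (1 - M.γ)⁻¹ := inv_pos.mpr (by linarith [M.γ_lt_one])
    exact_mod_cast h1.trans_le hK
  -- the samples are only almost everywhere measurable; replace them by measurable versions
  have hae : ∀ t, X t =ᵐ[Pr] (hlaw t).aemeasurable.mk (X t) :=
    fun t => (hlaw t).aemeasurable.ae_eq_mk
  have hbad := hmain S A Ω Pr M π μ hμ.2.1 d φ hφ hφ1 hlam K hK0 θ hθ θ₀
    (fun t => (hlaw t).aemeasurable.mk (X t)) (fun t => (hlaw t).aemeasurable.measurable_mk)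
    (hind.congr hae) (fun t => (Measure.map_congr (hae t)).symm.trans (hlaw t).map_eq)
    ε δ α n hε hδ hδ1 (by omega) hα hαlt hTle
  have hbad' : Pr {ω | ¬ LinearCTD.loss M.γ μ φ θ
      (LinearCTD.tailAverage M.γ K φ α θ₀ X (2 * n) ω) ≤ ε} ≤ ENNReal.ofReal δ := by
    refine (measure_mono_ae ?_).trans hbad
    filter_upwards [ae_all_iff.mpr hae] with ω hω h
    have heq : LinearCTD.tailAverage M.γ K φ α θ₀ X (2 * n) ω = LinearCTD.tailAverage M.γ K φ α θ₀
        (fun t => (hlaw t).aemeasurable.mk (X t)) (2 * n) ω := by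
      simp only [LinearCTD.tailAverage, LinearCTD.ctdIterate_congr hω]
    exact fun h' => h (by rwa [heq])
  have hcover := measureReal_union_le (μ := Pr)
    {ω | LinearCTD.loss M.γ μ φ θ (LinearCTD.tailAverage M.γ K φ α θ₀ X (2 * n) ω) ≤ ε}
    {ω | ¬ LinearCTD.loss M.γ μ φ θ (LinearCTD.tailAverage M.γ K φ α θ₀ X (2 * n) ω) ≤ ε}
  have huniv : {ω | LinearCTD.loss M.γ μ φ θ
      (LinearCTD.tailAverage M.γ K φ α θ₀ X (2 * n) ω) ≤ ε} ∪ {ω | ¬ LinearCTD.loss M.γ μ φ θ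
      (LinearCTD.tailAverage M.γ K φ α θ₀ X (2 * n) ω) ≤ ε} = Set.univ :=
    Set.union_compl_self _
  rw [huniv, probReal_univ] at hcover
  have hreal : Pr.real {ω | ¬ LinearCTD.loss M.γ μ φ θ
      (LinearCTD.tailAverage M.γ K φ α θ₀ X (2 * n) ω) ≤ ε} ≤ δ :=
    ENNReal.toReal_le_of_le_ofReal hδ.le hbad'
  linarith
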